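/- Let $F$ be a field of characteristic zero, $\overline F$ an algebraic closure, and let $(\mathfrak g, G)$ be one of the following split pairs over $\overline F$: $A_n$: $(\mathfrak{sl}_{n+1}, GL_{n+1})$, $n\ge 1$; $B_n$: $(\mathfrak{so}_{2n+1}, SO_{2n+1})$, $n\ge1$; $C_n$: $(\mathfrak{sp}_{2n}, Sp_{2n})$, $n\ge1$; $D_n$: $(\mathfrak{so}_{2n}, SO_{2n})$, $n\ge3$. The forms defining the orthogonal and symplectic groups are the standard split ones over $F$, so that the diagonal matrices in $\mathfrak g$ form a Cartan subalgebra $\mathfrak h$; the simple roots $\alpha_1,\dots,\alpha_n$ are the standard ones, and for $D_n$ the roots $\alpha_{n-1},\alpha_n$ are the end nodes of the branch. Let $(\Gamma_1,\Gamma_2,\tau)$ be an admissible triple: $\Gamma_1,\Gamma_2$ are sets of simple roots, $\tau:\Gamma_1\to\Gamma_2$ is an isometric bijection, and for every $\alpha\in\Gamma_1$ some $\tau^k(\alpha)$ lies in $\Gamma_2\setminus\Gamma_1$. Let $r$ be any $r$-matrix of the Belavin–Drinfeld list for this triple, $$r=r_0+\sum_{\alpha>0}e_{-\alpha}\otimes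 e_\alpha+\sum_{\alpha\in \mathrm{Span}(\Gamma_1)^+}\ \sum_{k\ge1}e_{-\alpha}\wedge e_{\tau^k(\alpha)}\in\mathfrak g\otimes\mathfrak g ,$$ where the last sum is over the pairs for which $\tau^k(\alpha)$ is defined, $x\wedge y=x\otimes y-y\otimes x$, the root vectors satisfy $(e_\alpha,e_{-\alpha})=1$ for a nondegenerate invariant form, $e_\alpha\mapsto e_{\tau(\alpha)}$ extends to a Lie algebra homomorphism on the subalgebra generated by the $e_\alpha$ with $\alpha$ a root in $\mathrm{Span}(\Gamma_1)$, and $r_0\in\mathfrak h\otimes\mathfrak h$ satisfies $r_0+r_0^{21}=\sum_k t_k\otimes t_k$ for an orthonormal basis $(t_k)$ of $\mathfrak h$ and $(\tau(\alpha)\otimes\mathrm{id}+\mathrm{id}\otimes\alpha)(r_0)=0$ for all $\alpha\in\Gamma_1$. Let $C(r)=\{X\in G(\overline F): \mathrm{Ad}_X r=r\}$. A non-twisted cocycle is an $X\in G(\overline F)$ with $X^{-1}\sigma(X)\in C(r)$ for all $\sigma\in\mathrm{Gal}(\overline F/F)$; two cocycles are equivalent if $X_1=QX_2C$ with $Q\in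 G(F)$, $C\in C(r)$; and $H^1_{BD}(r)=H^1_{BD}(G,r)$ is the set of equivalence classes. A string of $\tau$ is a set $\{\alpha,\tau(\alpha),\dots,\tau^k(\alpha)\}$ with $\alpha\in\Gamma_1\setminus\Gamma_2$ and $\tau^k(\alpha)\in\Gamma_2\setminus\Gamma_1$. Then: 1. For types $A_n$ (with respect to $GL_{n+1}$), $B_n$ and $C_n$, $H^1_{BD}(r)$ has exactly one element. 2. For type $D_n$, if some string of $\tau$ contains both $\alpha_{n-1}$ and $\alpha_n$, then there is a bijection $H^1_{BD}(r)\cong F^*/(F^*)^2$ that maps the class of the identity to $1$; in particular $H^1_{BD}(r)$ has exactly $2$ elements when $F=\mathbb C((\hbar))$. 3. For type $D_n$, if no string of $\tau$ contains both $\alpha_{n-1}$ and $\alpha_n$, then $H^1_{BD}(r)$ has exactly one element. -/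

import Mathlib

/-!
Non-twisted Belavin–Drinfeld cohomology of the classical simple Lie algebras.

Everything takes place inside the matrix algebra `Matrix ι ι K`. Since `K` is a field, `𝔤 ⊗ 𝔤` and
`𝔥 ⊗ 𝔥` are subspaces of `Matrix ι ι K ⊗ Matrix ι ι K`, and tensors are written there.
-/

open scoped TensorProduct

attribute [local instance] LieRing.ofAssociativeRing

namespace BelavinDrinfeld

noncomputable section

/-! ### Simple roots of the classical types, in the coordinates `ε_k` -/

/-- Type `A_n`: `α_i = ε_i - ε_{i+1}` (`1 ≤ i ≤ n`), with `n + 1` coordinates. -/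
def simpleRootsA (n : ℕ) (i : Fin n) : Fin (n + 1) → ℤ :=
  Pi.single i.castSucc 1 - Pi.single i.succ 1

/-- Type `B_n`: `α_i = ε_i - ε_{i+1}` for `i < n`, and `α_n = ε_n`. -/
def simpleRootsB (n : ℕ) (i : Fin n) : Fin n → ℤ :=
  if h : (i : ℕ) + 1 < n then Pi.single i 1 - Pi.single ⟨i + 1, h⟩ 1 else Pi.single i 1

/-- Type `C_n`: `α_i = ε_i - ε_{i+1}` for `i < n`, and `α_n = 2 ε_n`. -/
def simpleRootsC (n : ℕ) (i : Fin n) : Fin n → ℤ :=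
  if h : (i : ℕ) + 1 < n then Pi.single i 1 - Pi.single ⟨i + 1, h⟩ 1 else Pi.single i 2

/-- Type `D_n`: `α_i = ε_i - ε_{i+1}` for `i < n`, and `α_n = ε_{n-1} + ε_n`
(used for `n ≥ 3`; the end nodes of the branch are `α_{n-1}` and `α_n`). -/
def simpleRootsD (n : ℕ) (i : Fin n) : Fin n → ℤ :=
  if h : (i : ℕ) + 1 < n then Pi.single i 1 - Pi.single ⟨i + 1, h⟩ 1
  else Pi.single ⟨(i : ℕ) - 1, lt_of_le_of_lt (Nat.sub_le _ _) i.isLt⟩ 1 + Pi.single i 1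

/-! ### Admissible triples -/

/-- An admissible triple `(Γ₁, Γ₂, τ)` for the simple roots `v 0, …, v (n-1)`. The invariant form
on the dual of the Cartan subalgebra is, up to a scalar, the dot product of the `ε`-coordinates. -/
structure AdmissibleTriple {n m : ℕ} (v : Fin n → Fin m → ℤ) where
  /-- the source `Γ₁` -/
  Γ₁ : Finset (Fin n)
  /-- the target `Γ₂` -/
  Γ₂ : Finset (Fin n)
  /-- the bijection `τ : Γ₁ → Γ₂` -/
  τ : Γ₁ ≃ Γ₂
  /-- `τ` is isometric -/
  isometric : ∀ i j : Γ₁, v (τ i) ⬝ᵥ v (τ j) = v i ⬝ᵥ v j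
  /-- every `α ∈ Γ₁` has some `τ^k(α) ∈ Γ₂ \ Γ₁` -/
  nilpotent : ∀ i ∈ Γ₁, ∃ j ∈ Γ₂, j ∉ Γ₁ ∧
    Relation.ReflTransGen (fun a b : Fin n => ∃ h : a ∈ Γ₁, (τ ⟨a, h⟩ : Fin n) = b) i j

namespace AdmissibleTriple

variable {n m : ℕ} {v : Fin n → Fin m → ℤ} (T : AdmissibleTriple v)

/-- `τ^k(i) = j` for some `k ≥ 0` (with all the intermediate values in `Γ₁`). -/
def Reaches : Fin n → Fin n → Prop :=
  Relation.ReflTransGen (fun a b : Fin n => ∃ h : a ∈ T.Γ₁, (T.τ ⟨a, h⟩ : Fin n) = b)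

/-- Some string `α, τ(α), …, τ^k(α)`, where `α ∈ Γ₁ \ Γ₂` and `τ^k(α) ∈ Γ₂ \ Γ₁`, contains both
`i` and `j`. -/
def SameString (i j : Fin n) : Prop :=
  ∃ s ∈ T.Γ₁, s ∉ T.Γ₂ ∧ T.Reaches s i ∧ T.Reaches s j

/-- The element `∑ a_i α_i` lies in `Span Γ₁`. -/
def InSpan (a : Fin n → ℤ) : Prop := ∀ i, a i ≠ 0 → i ∈ T.Γ₁

/-- The linear extension of `τ` to `Span Γ₁`, in coordinates with respect to the simple roots
(meaningful only on elements `a` with `T.InSpan a`). -/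
def push (a : Fin n → ℤ) : Fin n → ℤ :=
  fun j => if h : j ∈ T.Γ₂ then a (T.τ.symm ⟨j, h⟩) else 0

end AdmissibleTriple

/-! ### Roots and the Belavin–Drinfeld list

`L` is a Lie algebra of matrices whose diagonal matrices form a Cartan subalgebra, `d k` is the
diagonal position of the coordinate `ε_k`, and `v` is the list of simple roots. A root is given by
its vector of integer coordinates with respect to the simple roots. -/

section Roots

variable {K : Type*} [Field K] {ι : Type*} [Fintype ι] [DecidableEq ι]
  (L : LieSubalgebra K (Matrix ι ι K)) {n m : ℕ} (d : Fin m → ι) (v : Fin n → Fin m → ℤ)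

/-- The Cartan subalgebra `𝔥` of diagonal matrices in `L`. -/
def cartan : Submodule K (Matrix ι ι K) where
  carrier := {H | H ∈ L ∧ H.IsDiag}
  add_mem' := fun hx hy => ⟨L.add_mem hx.1 hy.1, hx.2.add hy.2⟩
  zero_mem' := ⟨L.zero_mem, Matrix.isDiag_zero⟩
  smul_mem' := fun c _ hx => ⟨L.smul_mem c hx.1, hx.2.smul c⟩

/-- The functional `∑ a_i α_i`, where `ε_k` reads off the diagonal entry at the position `d k`. -/
def weight (a : Fin n → ℤ) : Matrix ι ι K →ₗ[K] K :=
  ∑ i, (a i : K) • ∑ k, (v i k : K) • Matrix.entryLinearMap K K (d k) (d k)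

/-- `x` lies in the weight space of `L` for the weight `∑ a_i α_i` of `𝔥`. -/
def InWeightSpace (a : Fin n → ℤ) (x : Matrix ι ι K) : Prop :=
  x ∈ L ∧ ∀ H ∈ cartan L, ⁅H, x⁆ = weight d v a H • x

/-- `∑ a_i α_i` is a root. -/
def IsRoot (a : Fin n → ℤ) : Prop :=
  a ≠ 0 ∧ ∃ x, x ≠ 0 ∧ InWeightSpace L d v a x

/-- `∑ a_i α_i` is a positive root. -/
def IsPosRoot (a : Fin n → ℤ) : Prop :=
  IsRoot L d v a ∧ 0 ≤ a

variable {v} (T : AdmissibleTriple v)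

/-- A choice of root vectors `e_α`, normalized as in the Belavin–Drinfeld theorem with respect to
the invariant form `(x, y) = c · tr (x y)`: one has `(e_α, e_{-α}) = 1` for all roots `α`, and
`e_α ↦ e_{τ(α)}` (`α` a root in `Span Γ₁`) extends to a homomorphism on the Lie algebra generated
by these `e_α`. -/
structure IsRootVectorSystem (c : K) (e : (Fin n → ℤ) → Matrix ι ι K) : Prop where
  mem : ∀ a, IsRoot L d v a → InWeightSpace L d v a (e a)
  form_eq_one : ∀ a, IsRoot L d v a → c * (e a * e (-a)).trace = 1
  compatible : ∃ φ : LieSubalgebra.lieSpan K (Matrix ι ι K)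
      {x | ∃ a, IsRoot L d v a ∧ T.InSpan a ∧ x = e a} →ₗ⁅K⁆ Matrix ι ι K,
    ∀ a (ha : IsRoot L d v a) (hs : T.InSpan a),
      φ ⟨e a, LieSubalgebra.subset_lieSpan ⟨a, ha, hs, rfl⟩⟩ = e (T.push a)

/-- The two conditions on the Cartan part `r₀ ∈ 𝔥 ⊗ 𝔥`: the symmetric part is `∑ t_k ⊗ t_k` for an
orthonormal basis `t` of `𝔥`, and `(τ(α) ⊗ id + id ⊗ α) r₀ = 0` for all `α ∈ Γ₁`. -/
structure IsCartanPart (c : K) (r₀ : cartan L ⊗[K] cartan L) : Prop where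
  symm_part : ∃ t : Module.Basis (Fin n) K (cartan L),
    (∀ k l, c * ((t k : Matrix ι ι K) * (t l : Matrix ι ι K)).trace = if k = l then 1 else 0) ∧
    r₀ + TensorProduct.comm K (cartan L) (cartan L) r₀ = ∑ k, t k ⊗ₜ[K] t k
  compatible : ∀ i : T.Γ₁,
    TensorProduct.lid K (cartan L) (TensorProduct.map
        (weight d v (Pi.single (T.τ i : Fin n) 1) ∘ₗ (cartan L).subtype) LinearMap.id r₀) +
      TensorProduct.rid K (cartan L) (TensorProduct.map
        LinearMap.id (weight d v (Pi.single (i : Fin n) 1) ∘ₗ (cartan L).subtype) r₀) = 0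

/-- The wedge `x ∧ y = x ⊗ y - y ⊗ x`. -/
def wedge (x y : Matrix ι ι K) : Matrix ι ι K ⊗[K] Matrix ι ι K :=
  x ⊗ₜ[K] y - y ⊗ₜ[K] x

/-- `r` is a (non-skewsymmetric) `r`-matrix from the Belavin–Drinfeld list attached to `T`:
`r = r₀ + ∑_{α > 0} e_{-α} ⊗ e_α + ∑_{α ∈ (Span Γ₁)⁺} ∑_{k ≥ 1} e_{-α} ∧ e_{τ^k(α)}`,
where the last sum is over the pairs `(α, k)` for which `τ^k(α)` is defined. Both sums have
finitely many terms. Every nondegenerate invariant form is `c · tr (x y)` for some `c ≠ 0`. -/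
def IsBDMatrix (r : Matrix ι ι K ⊗[K] Matrix ι ι K) : Prop :=
  ∃ (c : K) (e : (Fin n → ℤ) → Matrix ι ι K) (r₀ : cartan L ⊗[K] cartan L),
    c ≠ 0 ∧ IsRootVectorSystem L d T c e ∧ IsCartanPart L d T c r₀ ∧
    r = TensorProduct.map (cartan L).subtype (cartan L).subtype r₀
      + (∑ᶠ a ∈ {a : Fin n → ℤ | IsPosRoot L d v a}, e (-a) ⊗ₜ[K] e a)
      + ∑ᶠ p ∈ {p : (Fin n → ℤ) × ℕ | IsPosRoot L d v p.1 ∧ 1 ≤ p.2 ∧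
            ∀ j < p.2, T.InSpan (T.push^[j] p.1)},
          wedge (e (-p.1)) (e (T.push^[p.2] p.1))

end Roots

/-! ### Groups -/

section Groups

variable {K : Type*} [Field K] {ι : Type*} [Fintype ι] [DecidableEq ι]

/-- The group of the invertible `X` with `Xᵀ J X = J`. -/
def isometryGroup (J : Matrix ι ι K) : Subgroup (GL ι K) where
  carrier := {X | (X : Matrix ι ι K).transpose * J * (X : Matrix ι ι K) = J}
  one_mem' := by simp
  mul_mem' := by
    intro X Y hX hY
    simp only [Set.mem_ofPred_eq] at hX hY ⊢
    calc ((X * Y : GL ι K) : Matrix ι ι K).transpose * J * ((X * Y : GL ι K) : Matrix ι ι K)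
        = (Y : Matrix ι ι K).transpose *
            ((X : Matrix ι ι K).transpose * J * (X : Matrix ι ι K)) * (Y : Matrix ι ι K) := by
          simp [Matrix.transpose_mul, Matrix.mul_assoc]
      _ = J := by rw [hX, hY]
  inv_mem' := by
    intro X hX
    simp only [Set.mem_ofPred_eq] at hX ⊢
    have h1 : (X : Matrix ι ι K) * ((X⁻¹ : GL ι K) : Matrix ι ι K) = 1 := X.mul_inv
    have h2 : ((X⁻¹ : GL ι K) : Matrix ι ι K).transpose * (X : Matrix ι ι K).transpose = 1 := by
      rw [← Matrix.transpose_mul, h1, Matrix.transpose_one]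
    calc ((X⁻¹ : GL ι K) : Matrix ι ι K).transpose * J * ((X⁻¹ : GL ι K) : Matrix ι ι K)
        = ((X⁻¹ : GL ι K) : Matrix ι ι K).transpose *
            ((X : Matrix ι ι K).transpose * J * (X : Matrix ι ι K)) *
            ((X⁻¹ : GL ι K) : Matrix ι ι K) := by rw [hX]
      _ = (((X⁻¹ : GL ι K) : Matrix ι ι K).transpose * (X : Matrix ι ι K).transpose) * J *
            ((X : Matrix ι ι K) * ((X⁻¹ : GL ι K) : Matrix ι ι K)) := by
          simp only [Matrix.mul_assoc]
      _ = J := by rw [h1, h2, Matrix.one_mul, Matrix.mul_one]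

/-- The isometries of determinant `1`. -/
def specialIsometryGroup (J : Matrix ι ι K) : Subgroup (GL ι K) :=
  isometryGroup J ⊓ (Matrix.GeneralLinearGroup.det : GL ι K →* Kˣ).ker

/-- The split group `SO(2n+1)` over `K`. -/
def SOodd (n : ℕ) (K : Type*) [Field K] : Subgroup (GL (Unit ⊕ Fin n ⊕ Fin n) K) :=
  specialIsometryGroup (LieAlgebra.Orthogonal.JB (Fin n) K)

/-- The group `Sp(2n)` over `K`. -/
def Sp (n : ℕ) (K : Type*) [Field K] : Subgroup (GL (Fin n ⊕ Fin n) K) :=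
  isometryGroup (Matrix.J (Fin n) K)

/-- The split group `SO(2n)` over `K`. -/
def SOeven (n : ℕ) (K : Type*) [Field K] : Subgroup (GL (Fin n ⊕ Fin n) K) :=
  specialIsometryGroup (LieAlgebra.Orthogonal.JD (Fin n) K)

/-- `Ad_X ⊗ Ad_X`, where `Ad_X y = X y X⁻¹`. -/
def adTensor (X : GL ι K) :
    (Matrix ι ι K ⊗[K] Matrix ι ι K) →ₗ[K] (Matrix ι ι K ⊗[K] Matrix ι ι K) :=
  TensorProduct.map
    (LinearMap.mulLeftRight K ((X : Matrix ι ι K), ((X⁻¹ : GL ι K) : Matrix ι ι K)))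
    (LinearMap.mulLeftRight K ((X : Matrix ι ι K), ((X⁻¹ : GL ι K) : Matrix ι ι K)))

theorem adTensor_tmul (X : GL ι K) (y z : Matrix ι ι K) :
    adTensor X (y ⊗ₜ[K] z) =
      ((X : Matrix ι ι K) * y * ((X⁻¹ : GL ι K) : Matrix ι ι K)) ⊗ₜ[K]
        ((X : Matrix ι ι K) * z * ((X⁻¹ : GL ι K) : Matrix ι ι K)) := by
  simp [adTensor]

theorem adTensor_one (r : Matrix ι ι K ⊗[K] Matrix ι ι K) : adTensor (1 : GL ι K) r = r := by
  induction r using TensorProduct.induction_on with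
  | zero => simp
  | tmul y z => simp [adTensor_tmul]
  | add y z hy hz => rw [map_add, hy, hz]

theorem adTensor_mul (X Y : GL ι K) (r : Matrix ι ι K ⊗[K] Matrix ι ι K) :
    adTensor (X * Y) r = adTensor X (adTensor Y r) := by
  induction r using TensorProduct.induction_on with
  | zero => simp
  | tmul y z => simp only [adTensor_tmul, mul_inv_rev, Units.val_mul, mul_assoc]
  | add y z hy hz => simp only [map_add, hy, hz]

/-- The centralizer `C(r)`: all `X` in `G` with `Ad_X r = r`. -/
def centralizer (G : Subgroup (GL ι K)) (r : Matrix ι ι K ⊗[K] Matrix ι ι K) :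
    Subgroup (GL ι K) where
  carrier := {X | X ∈ G ∧ adTensor X r = r}
  one_mem' := ⟨G.one_mem, adTensor_one r⟩
  mul_mem' := fun hX hY => ⟨G.mul_mem hX.1 hY.1, by rw [adTensor_mul, hY.2, hX.2]⟩
  inv_mem' := by
    intro X hX
    refine ⟨G.inv_mem hX.1, ?_⟩
    have h := adTensor_mul X⁻¹ X r
    rw [inv_mul_cancel, adTensor_one, hX.2] at h
    exact h.symm

end Groups

/-! ### Cohomology -/

section Cohomology

variable (F : Type*) [Field F] {K : Type*} [Field K] [Algebra F K]
  {ι : Type*} [Fintype ι] [DecidableEq ι]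

/-- The group `G(F)`: the elements of `G = G(K)` with entries in `F`. -/
def rationalPoints (G : Subgroup (GL ι K)) : Subgroup (GL ι K) :=
  G ⊓ (Matrix.GeneralLinearGroup.map (n := ι) (algebraMap F K)).range

/-- `X ∈ G(K)` is a non-twisted Belavin–Drinfeld cocycle for `r` if `X⁻¹ σ(X) ∈ C(r)` for all
`σ ∈ Gal(K/F)`. -/
def IsCocycle (G : Subgroup (GL ι K)) (r : Matrix ι ι K ⊗[K] Matrix ι ι K) (X : GL ι K) : Prop :=
  X ∈ G ∧ ∀ σ : K ≃ₐ[F] K,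
    X⁻¹ * Matrix.GeneralLinearGroup.map (σ : K →+* K) X ∈ centralizer G r

/-- Equivalence of cocycles: `X₁ = Q X₂ C` with `Q ∈ G(F)` and `C ∈ C(r)`. -/
def cocycleSetoid (G : Subgroup (GL ι K)) (r : Matrix ι ι K ⊗[K] Matrix ι ι K) :
    Setoid {X : GL ι K // IsCocycle F G r X} where
  r X₁ X₂ := ∃ Q ∈ rationalPoints F G, ∃ C ∈ centralizer G r, X₁.1 = Q * X₂.1 * C
  iseqv :=
    { refl := fun _ => ⟨1, Subgroup.one_mem _, 1, Subgroup.one_mem _, by simp⟩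
      symm := by
        rintro X Y ⟨Q, hQ, C, hC, h⟩
        exact ⟨Q⁻¹, Subgroup.inv_mem _ hQ, C⁻¹, Subgroup.inv_mem _ hC, by rw [h]; group⟩
      trans := by
        rintro X Y Z ⟨Q, hQ, C, hC, h⟩ ⟨Q', hQ', C', hC', h'⟩
        exact ⟨Q * Q', Subgroup.mul_mem _ hQ hQ', C' * C, Subgroup.mul_mem _ hC' hC, by
          rw [h, h']; group⟩ }

/-- The non-twisted Belavin–Drinfeld cohomology `H¹_BD(G, r)` over the field `F`, where `G` is the
group of `K`-points and `K` is an algebraic closure of `F`. -/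
def HBD (G : Subgroup (GL ι K)) (r : Matrix ι ι K ⊗[K] Matrix ι ι K) : Type _ :=
  Quotient (cocycleSetoid F G r)

/-- The class of the identity matrix. -/
def HBD.trivialClass (G : Subgroup (GL ι K)) (r : Matrix ι ι K ⊗[K] Matrix ι ι K) : HBD F G r :=
  Quotient.mk (cocycleSetoid F G r)
    ⟨1, G.one_mem, fun σ => by simp⟩

end Cohomology

end

end BelavinDrinfeld

/-! The centralizer C(r) turns out to be a subgroup of the diagonal torus; the rest is Hilbert 90
and a computation in the character lattice.

Apply x ⊗ y ↦ [x, y] to r. The Cartan part dies, and so does every wedge term: [e_{-α}, e_{τ^k(α)}]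
has weight τ^k(α) - α, which is nonzero of height zero, hence not a root. What remains is ∑_{α>0}
[e_{-α}, e_α], a multiple of the element of 𝔥 dual to 2ρ, the sum of the positive roots. An X fixing
r commutes with it, so X_{pq} ≠ 0 only if the weights of the basis vectors p and q pair equally with
2ρ (`exists_diagonal_commute`). In types A, B, C these pairings separate the weights of the standard
representation. In type D they confuse only ε_n and -ε_n, and there the form and the determinant
force X to be diagonal (`SOeven_exists_torus`). A torus element fixes r exactly when α and τ(α)
agree on it for all α ∈ Γ₁ (`IsRootDatum.mem_centralizer_iff`).

For a cocycle X, σ multiplies each column of weight ε_k by a scalar. Nonzero entries of these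
columns form a torus element p that transforms by the same scalars, so X = Qp with Q rational
(`IsCocycle.exists_rational_mul_torus`).

It remains to split p as a rational torus element times an element of C(r). Ratios of the values of
p at simple roots of one string are Galois invariant, so the question is which values of the simple
roots lift to F-points of the torus (`exists_eq_baseMap_mul`). In types A and B the simple roots are
part of a basis of the character lattice, and everything lifts. In type C the obstruction sits at
the long root 2ε_n, which an isometric nilpotent τ never touches. In type D it is α_n - α_{n-1} =
2ε_n. If no string contains both end nodes, the two values can be normalised to 1. If one string
does, the elements of C(r) have last coordinate ±1, the square of the last coordinate of p lies in
F, and its square class is a complete invariant (`exists_HBD_equiv`). Over ℂ((ħ)) the square class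
is the parity of the order. -/

namespace BelavinDrinfeld

noncomputable section

/-! ### Strings, levels and heights for an admissible triple -/

namespace AdmissibleTriple

variable {n m : ℕ} {v : Fin n → Fin m → ℤ} (T : AdmissibleTriple v)

/-- One application of `τ`. -/
def Step (a b : Fin n) : Prop := ∃ h : a ∈ T.Γ₁, (T.τ ⟨a, h⟩ : Fin n) = b

theorem step_tau (i : T.Γ₁) : T.Step i (T.τ i) := ⟨i.2, rfl⟩

variable {T} in
theorem Step.right_unique {a b c : Fin n} (hb : T.Step a b) (hc : T.Step a c) : b = c := by
  obtain ⟨h, rfl⟩ := hb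
  obtain ⟨_, rfl⟩ := hc
  rfl

variable {T} in
theorem Step.left_unique {a b c : Fin n} (hb : T.Step b a) (hc : T.Step c a) : b = c := by
  obtain ⟨h, rfl⟩ := hb
  obtain ⟨h', e⟩ := hc
  have := T.τ.injective (Subtype.ext e)
  exact (congrArg Subtype.val this).symm

variable {T} in
theorem Step.mem_right {a b : Fin n} (h : T.Step a b) : b ∈ T.Γ₂ := by
  obtain ⟨h, rfl⟩ := h
  exact (T.τ _).2

/-- Steps are deterministic, so everything reachable from a point of a cycle leads back to it; but
the exit point in Γ₂ \ Γ₁ given by `nilpotent` has no successor. -/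
theorem not_transGen_step_self (i : Fin n) : ¬ Relation.TransGen T.Step i i := by
  intro hi
  obtain ⟨b, hib, -⟩ := Relation.TransGen.head'_iff.1 hi
  obtain ⟨j, -, hj, hij⟩ := T.nilpotent i hib.1
  have back : ∀ j, T.Reaches i j → T.Reaches j i := by
    intro j hj
    induction hj with
    | refl => exact .refl
    | tail _ hbc ih =>
      obtain ⟨d, hbd, hdi⟩ := Relation.TransGen.head'_iff.1
        ((Relation.reflTransGen_iff_eq_or_transGen.1 ih).elim (fun h => h ▸ hi) id)
      rwa [Step.right_unique hbc hbd]
  rcases Relation.ReflTransGen.cases_head (back j hij) with rfl | ⟨c, hc, -⟩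
  · exact hj hib.1
  · exact hj hc.1

theorem wellFounded_step : WellFounded T.Step := by
  have : Std.Irrefl (Relation.TransGen T.Step) := ⟨T.not_transGen_step_self⟩
  have h := Finite.wellFounded_of_trans_of_irrefl (Relation.TransGen T.Step)
  exact Subrelation.wf (fun h => Relation.TransGen.single h) h

open Classical in
/-- The number of elements reachable from `i`; it decreases along `τ`. -/
def level (i : Fin n) : ℕ := (Finset.univ.filter (T.Reaches i)).card

theorem level_lt (i : T.Γ₁) : T.level (T.τ i) < T.level i := by
  classical
  refine Finset.card_lt_card ((Finset.ssubset_iff_of_subset ?_).2 ⟨i, ?_, ?_⟩)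
  · intro j hj
    simp only [Finset.mem_filter, Finset.mem_univ, true_and] at hj ⊢
    exact Relation.ReflTransGen.head (T.step_tau i) hj
  · exact Finset.mem_filter.2 ⟨Finset.mem_univ _, Relation.ReflTransGen.refl⟩
  · simp only [Finset.mem_filter, Finset.mem_univ, true_and]
    exact fun h => T.not_transGen_step_self _ (Relation.TransGen.head' (T.step_tau i) h)

theorem exists_source (i : Fin n) : ∃ s, s ∉ T.Γ₂ ∧ T.Reaches s i := by
  induction i using T.wellFounded_step.induction with
  | _ i ih =>
    by_cases hi : i ∈ T.Γ₂
    · have hs : T.Step (T.τ.symm ⟨i, hi⟩) i := ⟨(T.τ.symm ⟨i, hi⟩).2, by simp⟩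
      obtain ⟨s, hs2, hsi⟩ := ih _ hs
      exact ⟨s, hs2, hsi.tail hs⟩
    · exact ⟨i, hi, .refl⟩

theorem source_unique {i s s' : Fin n} (hs : s ∉ T.Γ₂) (hs' : s' ∉ T.Γ₂) (h : T.Reaches s i)
    (h' : T.Reaches s' i) : s = s' := by
  induction h with
  | refl =>
    rcases Relation.ReflTransGen.cases_tail h' with h | ⟨c, -, hc⟩
    · exact h
    · exact absurd (Step.mem_right (T := T) hc) hs
  | tail _ hbc ih =>
    rcases Relation.ReflTransGen.cases_tail h' with h | ⟨c, hc, hc'⟩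
    · exact absurd (h ▸ Step.mem_right hbc) hs'
    · exact ih (Step.left_unique (T := T) hbc hc' ▸ hc)

/-- The first element of the string through `i`. -/
def source (i : Fin n) : Fin n := (T.exists_source i).choose

theorem source_notMem (i : Fin n) : T.source i ∉ T.Γ₂ := (T.exists_source i).choose_spec.1

theorem reaches_source (i : Fin n) : T.Reaches (T.source i) i := (T.exists_source i).choose_spec.2

theorem source_eq {s i : Fin n} (hs : s ∉ T.Γ₂) (h : T.Reaches s i) : T.source i = s :=
  T.source_unique (T.source_notMem i) hs (T.reaches_source i) h

theorem source_tau (i : T.Γ₁) : T.source (T.τ i) = T.source i :=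
  T.source_eq (T.source_notMem i) ((T.reaches_source i).tail (T.step_tau i))

/-- The condition `i ≠ j` matters: a simple root outside Γ₁ ∪ Γ₂ is its own source but lies in no
string. For distinct elements one of the two paths is nonempty, which puts the common source in Γ₁.
-/
theorem sameString_iff {i j : Fin n} (hij : i ≠ j) :
    T.SameString i j ↔ T.source i = T.source j := by
  constructor
  · rintro ⟨s, -, hs, hi, hj⟩
    rw [T.source_eq hs hi, T.source_eq hs hj]
  · intro h
    have hi := T.reaches_source i
    have hj := T.reaches_source j
    rw [← h] at hj
    refine ⟨T.source i, ?_, T.source_notMem i, hi, hj⟩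
    rcases Relation.ReflTransGen.cases_head hi with hi' | ⟨c, hc, -⟩
    · rcases Relation.ReflTransGen.cases_head hj with hj' | ⟨c, hc, -⟩
      · exact absurd (hi'.symm.trans hj') hij
      · exact hc.1
    · exact hc.1

theorem tau_ne (i : T.Γ₁) : (T.τ i : Fin n) ≠ i := by
  intro h
  have := T.level_lt i
  rw [h] at this
  exact lt_irrefl _ this

theorem sum_push {M : Type*} [AddCommGroup M] (a : Fin n → ℤ) (g : Fin n → M) :
    ∑ j, T.push a j • g j = ∑ i : T.Γ₁, a i • g (T.τ i) := by
  classical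
  have h1 : ∑ j, T.push a j • g j = ∑ j ∈ T.Γ₂, T.push a j • g j := by
    refine (Finset.sum_subset (Finset.subset_univ _) fun j _ hj => ?_).symm
    simp [push, hj]
  rw [h1, ← Finset.sum_coe_sort, ← T.τ.sum_comp]
  refine Finset.sum_congr rfl fun i _ => ?_
  simp [push]

variable {T} in
theorem InSpan.sum_eq {M : Type*} [AddCommGroup M] {a : Fin n → ℤ} (ha : T.InSpan a)
    (g : Fin n → M) : ∑ j, a j • g j = ∑ i : T.Γ₁, a i • g i := by
  rw [Finset.sum_coe_sort T.Γ₁ (fun i => a i • g i)]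
  refine (Finset.sum_subset (Finset.subset_univ _) fun j _ hj => ?_).symm
  have : a j = 0 := by
    by_contra h
    exact hj (ha j h)
  simp [this]

theorem push_single (i : T.Γ₁) (x : ℤ) :
    T.push (Pi.single (i : Fin n) x) = Pi.single (T.τ i : Fin n) x := by
  ext j
  simp only [push, Pi.single_apply]
  by_cases hj : j ∈ T.Γ₂
  · simp only [hj, dite_true]
    congr 1
    rw [← Subtype.ext_iff, Equiv.symm_apply_eq, Subtype.ext_iff]
  · simp only [hj, dite_false]
    rw [if_neg]
    rintro rfl
    exact hj (T.τ i).2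

theorem push_nonneg {a : Fin n → ℤ} (ha : 0 ≤ a) : 0 ≤ T.push a := by
  intro j
  simp only [push, Pi.zero_apply]
  split_ifs
  · exact ha _
  · exact le_rfl

theorem push_tau (a : Fin n → ℤ) (i : T.Γ₁) : T.push a (T.τ i) = a i := by
  simp [push]

theorem inSpan_single (i : T.Γ₁) (x : ℤ) : T.InSpan (Pi.single (i : Fin n) x) := by
  intro j hj
  by_contra h
  refine hj (Pi.single_eq_of_ne ?_ _)
  rintro rfl
  exact h i.2

/-- The sum of the coordinates weighted by the levels of the simple roots. -/
def totalLevel (a : Fin n → ℤ) : ℤ := ∑ i, a i • (T.level i : ℤ)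

/-- A quantity that strictly decreases along τ on nonnegative vectors; it is what rules out τ^k(α) =
α for k ≥ 1. -/
theorem totalLevel_push_lt {a : Fin n → ℤ} (ha : T.InSpan a) (h0 : 0 ≤ a) (hne : a ≠ 0) :
    T.totalLevel (T.push a) < T.totalLevel a := by
  rw [totalLevel, totalLevel, sum_push, ha.sum_eq]
  obtain ⟨i, hi⟩ := Function.ne_iff.1 hne
  refine Finset.sum_lt_sum (fun j _ => ?_) ⟨⟨i, ha i hi⟩, Finset.mem_univ _, ?_⟩
  · exact mul_le_mul_of_nonneg_left (by exact_mod_cast (T.level_lt j).le) (h0 _)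
  · exact mul_lt_mul_of_pos_left (by exact_mod_cast T.level_lt ⟨i, ha i hi⟩)
      (lt_of_le_of_ne (h0 i) (Ne.symm hi))

variable {T} in
theorem InSpan.push_ne_zero {a : Fin n → ℤ} (ha : T.InSpan a) (hne : a ≠ 0) : T.push a ≠ 0 := by
  obtain ⟨i, hi⟩ := Function.ne_iff.1 hne
  intro h
  have := T.push_tau a ⟨i, ha i hi⟩
  rw [h] at this
  exact hi this.symm

theorem push_iterate_nonneg {a : Fin n → ℤ} (h0 : 0 ≤ a) (k : ℕ) : 0 ≤ T.push^[k] a := by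
  induction k with
  | zero => exact h0
  | succ k ih => rw [Function.iterate_succ_apply']; exact T.push_nonneg ih

theorem push_iterate_ne_zero {a : Fin n → ℤ} (hne : a ≠ 0) (k : ℕ)
    (hs : ∀ j < k, T.InSpan (T.push^[j] a)) : T.push^[k] a ≠ 0 := by
  induction k with
  | zero => exact hne
  | succ k ih =>
    rw [Function.iterate_succ_apply']
    exact (hs k (Nat.lt_succ_self k)).push_ne_zero (ih fun j hj => hs j (hj.trans k.lt_succ_self))

theorem totalLevel_push_iterate_lt {a : Fin n → ℤ} (h0 : 0 ≤ a) (hne : a ≠ 0) {k : ℕ}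
    (hk : 1 ≤ k) (hs : ∀ j < k, T.InSpan (T.push^[j] a)) :
    T.totalLevel (T.push^[k] a) < T.totalLevel a := by
  induction k, hk using Nat.le_induction with
  | base => exact T.totalLevel_push_lt (hs 0 one_pos) h0 hne
  | succ k _ ih =>
    rw [Function.iterate_succ_apply']
    have hs' : ∀ j < k, T.InSpan (T.push^[j] a) := fun j hj => hs j (hj.trans k.lt_succ_self)
    exact (T.totalLevel_push_lt (hs k k.lt_succ_self) (T.push_iterate_nonneg h0 k)
      (T.push_iterate_ne_zero hne k hs')).trans (ih hs')

/-- Every application of τ lowers the level of a simple root in the support. This bounds k, so only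
finitely many pairs (α, k) enter r. -/
theorem le_level_of_inSpan_iterate {k : ℕ} {a : Fin n → ℤ} {i : Fin n} (hi : a i ≠ 0)
    (hs : ∀ j < k, T.InSpan (T.push^[j] a)) : k ≤ T.level i := by
  induction k generalizing a i with
  | zero => exact Nat.zero_le _
  | succ k ih =>
    have hi' : i ∈ T.Γ₁ := hs 0 (Nat.succ_pos k) i hi
    have h := ih (a := T.push a) (i := T.τ ⟨i, hi'⟩) (by rwa [push_tau])
      (fun j hj => by
        have := hs (j + 1) (Nat.succ_lt_succ hj)
        rwa [Function.iterate_succ_apply] at this)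
    exact Nat.succ_le_of_lt (h.trans_lt (T.level_lt ⟨i, hi'⟩))

theorem level_le (i : Fin n) : T.level i ≤ n := by
  classical
  exact (Finset.card_le_univ _).trans_eq (Fintype.card_fin n)

/-- τ permutes simple roots, so it preserves heights; hence τ^k(α) - α has height zero. -/
theorem sum_push_iterate {a : Fin n → ℤ} (k : ℕ) (hs : ∀ j < k, T.InSpan (T.push^[j] a)) :
    ∑ i, T.push^[k] a i = ∑ i, a i := by
  induction k with
  | zero => rfl
  | succ k ih =>
    rw [← ih fun j hj => hs j (hj.trans k.lt_succ_self), Function.iterate_succ_apply']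
    have h1 := T.sum_push (T.push^[k] a) (fun _ => (1 : ℤ))
    have h2 := (hs k k.lt_succ_self).sum_eq (fun _ => (1 : ℤ))
    simp only [smul_eq_mul, mul_one] at h1 h2
    rw [h1, h2]

end AdmissibleTriple

/-! ### Integer combinations of the simple roots -/

/-- The vector `∑ a_i v_i`. -/
def comb {n m : ℕ} (v : Fin n → Fin m → ℤ) (a : Fin n → ℤ) : Fin m → ℤ := ∑ i, a i • v i

section Comb

variable {n m : ℕ} (v : Fin n → Fin m → ℤ)

theorem comb_add (a b : Fin n → ℤ) : comb v (a + b) = comb v a + comb v b := by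
  simp [comb, add_smul, Finset.sum_add_distrib]

theorem comb_neg (a : Fin n → ℤ) : comb v (-a) = -comb v a := by
  simp [comb]

@[simp] theorem comb_zero : comb v 0 = 0 := by
  simp [comb]

@[simp] theorem comb_single (i : Fin n) : comb v (Pi.single i 1) = v i := by
  simp [comb, Pi.single_apply]

theorem comb_dotProduct (a : Fin n → ℤ) (u : Fin m → ℤ) :
    comb v a ⬝ᵥ u = ∑ i, a i * (v i ⬝ᵥ u) := by
  simp only [comb, sum_dotProduct, smul_dotProduct, smul_eq_mul]

/-- The family ω is dual to the simple roots up to nonzero scalars, so pairing with ω i isolates the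
i-th coefficient. -/
theorem comb_injective_of_dual (ω : Fin n → Fin m → ℤ)
    (h : ∀ i j, v j ⬝ᵥ ω i ≠ 0 ↔ i = j) : Function.Injective (comb v) := by
  intro a b hab
  have h0 : comb v (a - b) = 0 := by rw [sub_eq_add_neg, comb_add, comb_neg, hab, add_neg_cancel]
  ext i
  have h1 := comb_dotProduct v (a - b) (ω i)
  rw [h0, zero_dotProduct, Finset.sum_eq_single i] at h1
  · have h2 := (h i i).2 rfl
    have h3 := (mul_eq_zero.1 h1.symm).resolve_right h2
    simpa [sub_eq_zero] using h3
  · intro j _ hj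
    have h2 : v j ⬝ᵥ ω i = 0 := by
      by_contra hne
      exact hj ((h i j).1 hne).symm
    rw [h2, mul_zero]
  · simp

/-- The isometry of τ extends bilinearly to the span of Γ₁. Since the roots are essentially
recognised by their norm, this is why τ carries roots to roots. -/
theorem comb_push_dotProduct_self (T : AdmissibleTriple v) {a : Fin n → ℤ} (ha : T.InSpan a) :
    comb v (T.push a) ⬝ᵥ comb v (T.push a) = comb v a ⬝ᵥ comb v a := by
  have h1 : comb v (T.push a) = ∑ i : T.Γ₁, a i • v (T.τ i) := T.sum_push a v
  have h2 : comb v a = ∑ i : T.Γ₁, a i • v i := ha.sum_eq v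
  rw [h1, h2]
  simp only [sum_dotProduct, dotProduct_sum, smul_dotProduct, dotProduct_smul, T.isometric]

end Comb

/-! ### Characters of the torus -/

section Characters

variable {K : Type*} [Field K] {m n : ℕ}

/-- The character `∏ t_k ^ u_k`. -/
def chi (t : Fin m → Kˣ) (u : Fin m → ℤ) : Kˣ := ∏ k, t k ^ u k

theorem chi_add (t : Fin m → Kˣ) (u u' : Fin m → ℤ) : chi t (u + u') = chi t u * chi t u' := by
  simp [chi, zpow_add, Finset.prod_mul_distrib]

theorem chi_neg (t : Fin m → Kˣ) (u : Fin m → ℤ) : chi t (-u) = (chi t u)⁻¹ := by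
  simp [chi]

theorem chi_sub (t : Fin m → Kˣ) (u u' : Fin m → ℤ) : chi t (u - u') = chi t u / chi t u' := by
  rw [sub_eq_add_neg, chi_add, chi_neg, div_eq_mul_inv]

@[simp] theorem chi_zero (t : Fin m → Kˣ) : chi t 0 = 1 := by
  simp [chi]

theorem chi_mul (t t' : Fin m → Kˣ) (u : Fin m → ℤ) : chi (t * t') u = chi t u * chi t' u := by
  simp [chi, mul_zpow, Finset.prod_mul_distrib]

@[simp] theorem chi_one (u : Fin m → ℤ) : chi (1 : Fin m → Kˣ) u = 1 := by
  simp [chi]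

theorem chi_inv (t : Fin m → Kˣ) (u : Fin m → ℤ) : chi t⁻¹ u = (chi t u)⁻¹ := by
  simp [chi]

theorem chi_single (t : Fin m → Kˣ) (k : Fin m) (x : ℤ) : chi t (Pi.single k x) = t k ^ x := by
  rw [chi, Finset.prod_eq_single k]
  · simp
  · intro j _ hj
    simp [hj]
  · simp

theorem map_chi {K' : Type*} [Field K'] (f : K →* K') (t : Fin m → Kˣ) (u : Fin m → ℤ) :
    Units.map f (chi t u) = chi (fun k => Units.map f (t k)) u := by
  simp [chi]

/-- The character group as an additive homomorphism in `u`. -/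
def chiHom (t : Fin m → Kˣ) : (Fin m → ℤ) →+ Additive Kˣ where
  toFun u := Additive.ofMul (chi t u)
  map_zero' := by simp
  map_add' u u' := by rw [chi_add, ofMul_mul]

theorem chi_comb_push {v : Fin n → Fin m → ℤ} (T : AdmissibleTriple v) {t : Fin m → Kˣ}
    (ht : ∀ i : T.Γ₁, chi t (v i) = chi t (v (T.τ i))) {a : Fin n → ℤ} (ha : T.InSpan a) :
    chi t (comb v (T.push a)) = chi t (comb v a) := by
  have h1 : comb v (T.push a) = ∑ i : T.Γ₁, a i • v (T.τ i) := T.sum_push a v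
  have h2 : comb v a = ∑ i : T.Γ₁, a i • v i := ha.sum_eq v
  have h3 : chiHom t (comb v (T.push a)) = chiHom t (comb v a) := by
    rw [h1, h2, map_sum, map_sum]
    refine Finset.sum_congr rfl fun i _ => ?_
    rw [map_zsmul, map_zsmul]
    congr 1
    exact congrArg Additive.ofMul (ht i).symm
  exact Additive.ofMul.injective h3

theorem chi_comb_push_iterate {v : Fin n → Fin m → ℤ} (T : AdmissibleTriple v) {t : Fin m → Kˣ}
    (ht : ∀ i : T.Γ₁, chi t (v i) = chi t (v (T.τ i))) {a : Fin n → ℤ} (k : ℕ)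
    (hs : ∀ j < k, T.InSpan (T.push^[j] a)) :
    chi t (comb v (T.push^[k] a)) = chi t (comb v a) := by
  induction k with
  | zero => rfl
  | succ k ih =>
    rw [Function.iterate_succ_apply', chi_comb_push T ht (hs k k.lt_succ_self),
      ih fun j hj => hs j (hj.trans k.lt_succ_self)]

end Characters

/-! ### The torus -/

section Torus

variable {K : Type*} [Field K] {ι : Type*} [Fintype ι] [DecidableEq ι] {m : ℕ}
  (w : ι → Fin m → ℤ)

/-- The torus acting with the weights `w p` on the standard basis. -/
def torus : (Fin m → Kˣ) →* GL ι K where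
  toFun t := ⟨Matrix.diagonal fun p => (chi t (w p) : K),
    Matrix.diagonal fun p => ((chi t (w p))⁻¹ : Kˣ),
    by simp [Matrix.diagonal_mul_diagonal], by simp [Matrix.diagonal_mul_diagonal]⟩
  map_one' := by ext; simp
  map_mul' t t' := by
    refine Units.ext ?_
    simp [Matrix.diagonal_mul_diagonal, chi_mul]

@[simp] theorem coe_torus (t : Fin m → Kˣ) :
    (torus w t : Matrix ι ι K) = Matrix.diagonal fun p => (chi t (w p) : K) := rfl

@[simp] theorem coe_torus_inv (t : Fin m → Kˣ) :
    (((torus w t)⁻¹ : GL ι K) : Matrix ι ι K)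
      = Matrix.diagonal fun p => (((chi t (w p))⁻¹ : Kˣ) : K) := rfl

theorem map_torus {K' : Type*} [Field K'] (f : K →+* K') (t : Fin m → Kˣ) :
    Matrix.GeneralLinearGroup.map f (torus w t)
      = torus w (fun k => Units.map (f : K →* K') (t k)) := by
  refine Units.ext ?_
  ext p q
  by_cases h : p = q
  · subst h
    have := congrArg Units.val (map_chi (f : K →* K') t (w p))
    simpa using this
  · simp [h]

theorem torus_conj_apply (t : Fin m → Kˣ) (y : Matrix ι ι K) (p q : ι) :
    ((torus w t : Matrix ι ι K) * y * (((torus w t)⁻¹ : GL ι K) : Matrix ι ι K)) p q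
      = chi t (w p - w q) * y p q := by
  rw [coe_torus, coe_torus_inv, Matrix.mul_diagonal, Matrix.diagonal_mul, chi_sub,
    div_eq_mul_inv, Units.val_mul]
  ring

/-- The product of two matrix entries, as a functional on tensors. -/
def entryPair (p q p' q' : ι) : Matrix ι ι K ⊗[K] Matrix ι ι K →ₗ[K] K :=
  (TensorProduct.lid K K).toLinearMap ∘ₗ
    TensorProduct.map (Matrix.entryLinearMap K K p q) (Matrix.entryLinearMap K K p' q')

omit [Fintype ι] [DecidableEq ι] in
@[simp] theorem entryPair_tmul (p q p' q' : ι) (y z : Matrix ι ι K) :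
    entryPair p q p' q' (y ⊗ₜ[K] z) = y p q * z p' q' := by
  simp [entryPair]

theorem entryPair_adTensor_torus (t : Fin m → Kˣ) (p q p' q' : ι)
    (r : Matrix ι ι K ⊗[K] Matrix ι ι K) :
    entryPair p q p' q' (adTensor (torus w t) r)
      = chi t (w p - w q) * chi t (w p' - w q') * entryPair p q p' q' r := by
  induction r using TensorProduct.induction_on with
  | zero => simp
  | tmul y z =>
    rw [adTensor_tmul, entryPair_tmul, entryPair_tmul, torus_conj_apply, torus_conj_apply]
    ring
  | add y z hy hz => simp only [map_add, hy, hz, mul_add]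

end Torus

/-! ### The commutator of the two tensor factors -/

section Commutator

variable {K : Type*} [Field K] {ι : Type*} [Fintype ι] [DecidableEq ι]

/-- The linear map `x ⊗ y ↦ x y - y x`. -/
def commMap : Matrix ι ι K ⊗[K] Matrix ι ι K →ₗ[K] Matrix ι ι K :=
  LinearMap.mul' K (Matrix ι ι K) -
    LinearMap.mul' K (Matrix ι ι K) ∘ₗ (TensorProduct.comm K _ _).toLinearMap

@[simp] theorem commMap_tmul (x y : Matrix ι ι K) : commMap (x ⊗ₜ[K] y) = ⁅x, y⁆ := by
  simp [commMap, LieRing.of_associative_ring_bracket]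

/-- Equivariance: any X fixing r commutes with the matrix `commMap r`. -/
theorem commMap_adTensor (X : GL ι K) (r : Matrix ι ι K ⊗[K] Matrix ι ι K) :
    commMap (adTensor X r)
      = (X : Matrix ι ι K) * commMap r * ((X⁻¹ : GL ι K) : Matrix ι ι K) := by
  induction r using TensorProduct.induction_on with
  | zero => simp
  | tmul y z =>
    have h : ((X⁻¹ : GL ι K) : Matrix ι ι K) * (X : Matrix ι ι K) = 1 := X.inv_mul
    have key : ∀ y z : Matrix ι ι K, ((X : Matrix ι ι K) * y * ((X⁻¹ : GL ι K) : Matrix ι ι K)) *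
        ((X : Matrix ι ι K) * z * ((X⁻¹ : GL ι K) : Matrix ι ι K)) =
        (X : Matrix ι ι K) * (y * z) * ((X⁻¹ : GL ι K) : Matrix ι ι K) := by
      intro y z
      calc _ = (X : Matrix ι ι K) * y * (((X⁻¹ : GL ι K) : Matrix ι ι K) * (X : Matrix ι ι K)) * z
              * ((X⁻¹ : GL ι K) : Matrix ι ι K) := by simp only [Matrix.mul_assoc]
        _ = _ := by rw [h, Matrix.mul_one]; simp only [Matrix.mul_assoc]
    rw [adTensor_tmul, commMap_tmul, commMap_tmul, LieRing.of_associative_ring_bracket,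
      LieRing.of_associative_ring_bracket, key, key, Matrix.mul_sub, Matrix.sub_mul]
  | add y z hy hz => simp only [map_add, hy, hz, Matrix.mul_add, Matrix.add_mul]

theorem commMap_wedge (x y : Matrix ι ι K) : commMap (wedge x y) = ⁅x, y⁆ + ⁅x, y⁆ := by
  rw [wedge, map_sub, commMap_tmul, commMap_tmul, ← lie_skew x y, sub_eq_add_neg]

end Commutator

/-! ### The roots and the `r`-matrix -/

section RootData

variable {K : Type*} [Field K] {ι : Type*} [Fintype ι] [DecidableEq ι]
  (L : LieSubalgebra K (Matrix ι ι K)) {n m : ℕ} (d : Fin m → ι) (v : Fin n → Fin m → ℤ)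

omit [Fintype ι] [DecidableEq ι] in
theorem weight_apply (a : Fin n → ℤ) (H : Matrix ι ι K) :
    weight d v a H = ∑ k, (comb v a k : K) * H (d k) (d k) := by
  simp only [weight, comb, LinearMap.sum_apply, LinearMap.smul_apply, Finset.sum_apply,
    Pi.smul_apply, smul_eq_mul, Matrix.entryLinearMap_apply, Int.cast_sum, Int.cast_mul,
    Finset.mul_sum, Finset.sum_mul]
  rw [Finset.sum_comm]
  refine Finset.sum_congr rfl fun k _ => Finset.sum_congr rfl fun i _ => ?_
  ring

omit [Fintype ι] [DecidableEq ι] in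
theorem weight_add (a b : Fin n → ℤ) (H : Matrix ι ι K) :
    weight d v (a + b) H = weight d v a H + weight d v b H := by
  simp [weight_apply, comb_add, add_mul, Finset.sum_add_distrib]

variable {L d v}

theorem InWeightSpace.lie {a b : Fin n → ℤ} {x y : Matrix ι ι K} (hx : InWeightSpace L d v a x)
    (hy : InWeightSpace L d v b y) : InWeightSpace L d v (a + b) ⁅x, y⁆ := by
  refine ⟨L.lie_mem hx.1 hy.1, fun H hH => ?_⟩
  rw [leibniz_lie, hx.2 H hH, hy.2 H hH, smul_lie, lie_smul, weight_add, add_smul]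

theorem lie_eq_zero_of_mem_cartan {H H' : Matrix ι ι K} (h : H ∈ cartan L) (h' : H' ∈ cartan L) :
    ⁅H, H'⁆ = 0 := by
  rw [LieRing.of_associative_ring_bracket, ← h.2.diagonal_diag, ← h'.2.diagonal_diag,
    Matrix.diagonal_mul_diagonal, Matrix.diagonal_mul_diagonal, sub_eq_zero]
  simp only [mul_comm]

/-- Invariance of the trace form. With the normalisation (e_α, e_{-α}) = 1 it identifies [e_{-α},
e_α] with minus the element of 𝔥 dual to α. -/
theorem trace_lie_mul {a : Fin n → ℤ} {x y H : Matrix ι ι K} (hx : InWeightSpace L d v a x)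
    (hH : H ∈ cartan L) : (⁅y, x⁆ * H).trace = -(weight d v a H * (x * y).trace) := by
  have h := hx.2 H hH
  rw [LieRing.of_associative_ring_bracket] at h
  have h1 : (⁅y, x⁆ * H).trace = (y * (x * H - H * x)).trace := by
    rw [LieRing.of_associative_ring_bracket, Matrix.sub_mul, Matrix.mul_sub, Matrix.trace_sub,
      Matrix.trace_sub, Matrix.mul_assoc, ← Matrix.mul_assoc y H x, Matrix.mul_assoc x,
      Matrix.trace_mul_comm x]
  rw [h1, ← neg_sub, h, Matrix.mul_neg, Matrix.trace_neg, Matrix.mul_smul, Matrix.trace_smul,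
    Matrix.trace_mul_comm y x, smul_eq_mul]

variable (L d v)

/-- The root data of a Lie algebra of matrices: `w p` is the weight of the standard basis vector
at `p`, and `P` is the set of the positive roots, in the coordinates `ε_k`. -/
structure IsRootDatum (w : ι → Fin m → ℤ) (P : Finset (Fin m → ℤ)) : Prop where
  comb_injective : Function.Injective (comb v)
  exists_comb_eq : ∀ u ∈ P, ∃ b, 0 ≤ b ∧ comb v b = u
  zero_notMem : 0 ∉ P
  isRoot_iff : ∀ a, IsRoot L d v a ↔ comb v a ∈ P ∨ -comb v a ∈ P
  isRoot_single : ∀ i, IsRoot L d v (Pi.single i 1)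
  weight_injective : Function.Injective w
  homogeneous : ∀ a x p q, InWeightSpace L d v a x → x p q ≠ 0 → w p - w q = comb v a

variable {L d v} {w : ι → Fin m → ℤ} {P : Finset (Fin m → ℤ)} (R : IsRootDatum L d v w P)
include R

namespace IsRootDatum

/-- If a ≥ 0 and -a were in P, then -a would be nonnegative as well and a = 0. -/
theorem isPosRoot_iff (a : Fin n → ℤ) : IsPosRoot L d v a ↔ comb v a ∈ P := by
  constructor
  · rintro ⟨ha, h0⟩
    rcases (R.isRoot_iff a).1 ha with h | h
    · exact h
    · obtain ⟨b, hb, hba⟩ := R.exists_comb_eq _ h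
      rw [← comb_neg] at hba
      have hb' := R.comb_injective hba
      have : a = 0 := le_antisymm (by rw [hb'] at hb; simpa using hb) h0
      exact absurd this ha.1
  · intro h
    refine ⟨(R.isRoot_iff a).2 (.inl h), ?_⟩
    obtain ⟨b, hb, hba⟩ := R.exists_comb_eq _ h
    rwa [← R.comb_injective hba]

theorem isRoot_neg {a : Fin n → ℤ} (h : IsRoot L d v a) : IsRoot L d v (-a) := by
  rw [R.isRoot_iff] at h ⊢
  rw [comb_neg, neg_neg]
  exact h.symm

theorem nonneg_or_nonpos {a : Fin n → ℤ} (h : IsRoot L d v a) : 0 ≤ a ∨ a ≤ 0 := by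
  rcases (R.isRoot_iff a).1 h with h | h
  · exact .inl ((R.isPosRoot_iff a).2 h).2
  · rw [← comb_neg] at h
    exact .inr (by simpa using ((R.isPosRoot_iff _).2 h).2)

theorem finite_posRoots : {a | IsPosRoot L d v a}.Finite := by
  refine Set.Finite.of_finite_image (f := comb v) (P.finite_toSet.subset ?_)
    R.comb_injective.injOn
  rintro _ ⟨a, ha, rfl⟩
  exact (R.isPosRoot_iff a).1 ha

theorem isPosRoot_single (i : Fin n) : IsPosRoot L d v (Pi.single i 1) :=
  ⟨R.isRoot_single i, Pi.single_nonneg.2 zero_le_one⟩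

/-- Needed to turn the `finsum` in `IsBDMatrix` into a genuine finite sum; on an infinite support it
would default to zero. -/
theorem finite_wedgePairs (T : AdmissibleTriple v) :
    {p : (Fin n → ℤ) × ℕ | IsPosRoot L d v p.1 ∧ 1 ≤ p.2 ∧
      ∀ j < p.2, T.InSpan (T.push^[j] p.1)}.Finite := by
  refine (R.finite_posRoots.prod (Set.finite_Iic n)).subset ?_
  rintro ⟨a, k⟩ ⟨ha, -, hs⟩
  obtain ⟨i, hi⟩ := Function.ne_iff.1 ha.1.1
  exact ⟨ha, (T.le_level_of_inSpan_iterate hi hs).trans (T.level_le i)⟩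

omit R in
theorem isPosRoot_push_iterate {T : AdmissibleTriple v}
    (hpush : ∀ a, IsRoot L d v a → T.InSpan a → IsRoot L d v (T.push a)) {a : Fin n → ℤ}
    (ha : IsPosRoot L d v a) (k : ℕ) (hs : ∀ j < k, T.InSpan (T.push^[j] a)) :
    IsPosRoot L d v (T.push^[k] a) := by
  refine ⟨?_, T.push_iterate_nonneg ha.2 k⟩
  induction k with
  | zero => exact ha.1
  | succ k ih =>
    rw [Function.iterate_succ_apply']
    exact hpush _ (ih fun j hj => hs j (hj.trans k.lt_succ_self)) (hs k k.lt_succ_self)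

/-- All coordinates of a root have one sign, whereas b - a is nonzero with coordinate sum zero; so
it is not a root and its weight space vanishes. -/
theorem lie_eq_zero {a b : Fin n → ℤ} {x y : Matrix ι ι K} (hx : InWeightSpace L d v (-a) x)
    (hy : InWeightSpace L d v b y) (hne : b ≠ a) (hsum : ∑ i, b i = ∑ i, a i) : ⁅x, y⁆ = 0 := by
  by_contra h0
  have hw := hx.lie hy
  have hz : -a + b ≠ 0 := fun h => hne (by rwa [neg_add_eq_zero, eq_comm] at h)
  have hs : ∑ i, (-a + b) i = 0 := by
    simp [Finset.sum_add_distrib, hsum]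
  rcases R.nonneg_or_nonpos ⟨hz, _, h0, hw⟩ with h | h
  · exact hz (funext fun i =>
      (Finset.sum_eq_zero_iff_of_nonneg fun i _ => h i).1 hs i (Finset.mem_univ i))
  · exact hz (funext fun i =>
      (Finset.sum_eq_zero_iff_of_nonpos fun i _ => h i).1 hs i (Finset.mem_univ i))

theorem sum_posRoots {M : Type*} [AddCommMonoid M] (g : (Fin m → ℤ) → M) :
    ∑ a ∈ R.finite_posRoots.toFinset, g (comb v a) = ∑ u ∈ P, g u := by
  refine Finset.sum_nbij (comb v) ?_ R.comb_injective.injOn ?_ fun _ _ => rfl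
  · intro a ha
    rw [Set.Finite.mem_toFinset] at ha
    exact (R.isPosRoot_iff a).1 ha
  · intro u hu
    obtain ⟨b, -, rfl⟩ := R.exists_comb_eq u hu
    refine ⟨b, ?_, rfl⟩
    rw [Finset.mem_coe, Set.Finite.mem_toFinset]
    exact (R.isPosRoot_iff b).2 hu

/-- The commutator of the tensor factors maps `r` to (a multiple of) the dual of the sum of the
positive roots, so that every `X` fixing `r` commutes with it. -/
theorem exists_diagonal_commute {T : AdmissibleTriple v}
    (hpush : ∀ a, IsRoot L d v a → T.InSpan a → IsRoot L d v (T.push a))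
    {r : Matrix ι ι K ⊗[K] Matrix ι ι K} (hr : IsBDMatrix L d T r) :
    ∃ (c : K) (z : ι → K), c ≠ 0 ∧ Matrix.diagonal z ∈ cartan L ∧
      (∀ X : GL ι K, adTensor X r = r → ∀ p q, (X : Matrix ι ι K) p q ≠ 0 → z p = z q) ∧
      ∀ H ∈ cartan L, c * ∑ p, z p * H p p = ∑ u ∈ P, ∑ k, (u k : K) * H (d k) (d k) := by
  obtain ⟨c, e, r₀, hc, he, -, rfl⟩ := hr
  -- This will be the image of r under `commMap`, proportional to the dual of 2ρ.
  set Z : Matrix ι ι K := ∑ a ∈ R.finite_posRoots.toFinset, ⁅e (-a), e a⁆ with hZ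
  have hroot : ∀ a ∈ R.finite_posRoots.toFinset, IsRoot L d v a := by
    intro a ha
    rw [Set.Finite.mem_toFinset] at ha
    exact ha.1
  have hr₀ : commMap (TensorProduct.map (cartan L).subtype (cartan L).subtype r₀) = 0 := by
    induction r₀ using TensorProduct.induction_on with
    | zero => simp
    | tmul x y => simpa using lie_eq_zero_of_mem_cartan x.2 y.2
    | add x y hx hy => rw [map_add, map_add, hx, hy, add_zero]
  have hcomm : ∀ r', r' = TensorProduct.map (cartan L).subtype (cartan L).subtype r₀
      + (∑ᶠ a ∈ {a : Fin n → ℤ | IsPosRoot L d v a}, e (-a) ⊗ₜ[K] e a)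
      + ∑ᶠ p ∈ {p : (Fin n → ℤ) × ℕ | IsPosRoot L d v p.1 ∧ 1 ≤ p.2 ∧
            ∀ j < p.2, T.InSpan (T.push^[j] p.1)},
          wedge (e (-p.1)) (e (T.push^[p.2] p.1)) → commMap r' = Z := by
    rintro r' rfl
    rw [finsum_mem_eq_finite_toFinset_sum _ R.finite_posRoots,
      finsum_mem_eq_finite_toFinset_sum _ (R.finite_wedgePairs T), map_add, map_add, hr₀, map_sum,
      map_sum, zero_add]
    have : ∑ p ∈ (R.finite_wedgePairs T).toFinset,
        commMap (wedge (e (-p.1)) (e (T.push^[p.2] p.1))) = 0 := by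
      refine Finset.sum_eq_zero fun p hp => ?_
      obtain ⟨ha, hk, hs⟩ := (R.finite_wedgePairs T).mem_toFinset.1 hp
      have hb := isPosRoot_push_iterate hpush ha p.2 hs
      rw [commMap_wedge, R.lie_eq_zero (he.mem _ (R.isRoot_neg ha.1)) (he.mem _ hb.1) ?_
        (T.sum_push_iterate p.2 hs), add_zero]
      intro h
      have := T.totalLevel_push_iterate_lt ha.2 ha.1.1 hk hs
      rw [h] at this
      exact lt_irrefl _ this
    rw [this, add_zero, hZ]
    exact Finset.sum_congr rfl fun a _ => commMap_tmul _ _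
  -- Every summand has weight zero, and different basis vectors have different weights, so only
  -- diagonal entries survive.
  have hZd : Z = Matrix.diagonal Z.diag := by
    refine (Matrix.IsDiag.diagonal_diag fun p q hpq => ?_).symm
    change Z p q = 0
    rw [hZ, Matrix.sum_apply]
    refine Finset.sum_eq_zero fun a ha => ?_
    by_contra h0
    have hw := (he.mem _ (R.isRoot_neg (hroot a ha))).lie (he.mem _ (hroot a ha))
    have := R.homogeneous _ _ p q hw h0
    rw [neg_add_cancel, comb_zero, sub_eq_zero] at this
    exact hpq (R.weight_injective this)
  -- The sign comes from the order of the bracket: [e_{-α}, e_α] pairs with H to -α(H).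
  refine ⟨-c, Z.diag, neg_ne_zero.2 hc, ⟨?_, Matrix.isDiag_diagonal _⟩,
    fun X hX p q hpq => ?_, fun H hH => ?_⟩
  · rw [← hZd, hZ]
    exact sum_mem fun a ha => L.lie_mem (he.mem _ (R.isRoot_neg (hroot a ha))).1
      (he.mem _ (hroot a ha)).1
  · have h1 := commMap_adTensor X (TensorProduct.map (cartan L).subtype (cartan L).subtype r₀
      + (∑ᶠ a ∈ {a : Fin n → ℤ | IsPosRoot L d v a}, e (-a) ⊗ₜ[K] e a)
      + ∑ᶠ p ∈ {p : (Fin n → ℤ) × ℕ | IsPosRoot L d v p.1 ∧ 1 ≤ p.2 ∧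
            ∀ j < p.2, T.InSpan (T.push^[j] p.1)},
          wedge (e (-p.1)) (e (T.push^[p.2] p.1)))
    rw [hX, hcomm _ rfl] at h1
    have h2 : Z * (X : Matrix ι ι K) = (X : Matrix ι ι K) * Z := by
      conv_lhs => rw [h1]
      rw [Matrix.mul_assoc, show ((X⁻¹ : GL ι K) : Matrix ι ι K) * (X : Matrix ι ι K) = 1 from
        X.inv_mul, Matrix.mul_one]
    have h3 := congrFun (congrFun h2 p) q
    rw [hZd, Matrix.diagonal_mul, Matrix.mul_diagonal, mul_comm] at h3
    exact mul_left_cancel₀ hpq h3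
  · have h1 : ∑ p, Z.diag p * H p p = (Z * H).trace := by
      conv_rhs => rw [hZd]
      simp [Matrix.trace, Matrix.diagonal_mul]
    rw [h1, ← R.sum_posRoots fun u => ∑ k, (u k : K) * H (d k) (d k), hZ, Finset.sum_mul,
      Matrix.trace_sum, Finset.mul_sum]
    refine Finset.sum_congr rfl fun a ha => ?_
    rw [trace_lie_mul (he.mem _ (hroot a ha)) hH, ← weight_apply]
    have := he.form_eq_one a (hroot a ha)
    linear_combination weight d v a H * this

theorem lie_torus_conj {a : Fin n → ℤ} {x : Matrix ι ι K} (hx : InWeightSpace L d v a x)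
    (t : Fin m → Kˣ) :
    (torus w t : Matrix ι ι K) * x * (((torus w t)⁻¹ : GL ι K) : Matrix ι ι K)
      = (chi t (comb v a) : K) • x := by
  ext p q
  rw [torus_conj_apply, Matrix.smul_apply, smul_eq_mul]
  by_cases h : x p q = 0
  · simp [h]
  · rw [R.homogeneous _ _ _ _ hx h]

/-- Apart from its Cartan part, r is a sum of weight vectors for the characters τ^k(α) - α with k ≥
0, and all of these are trivial on t. -/
theorem adTensor_torus_eq {T : AdmissibleTriple v}
    (hpush : ∀ a, IsRoot L d v a → T.InSpan a → IsRoot L d v (T.push a))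
    {r : Matrix ι ι K ⊗[K] Matrix ι ι K} (hr : IsBDMatrix L d T r) (t : Fin m → Kˣ)
    (ht : ∀ i : T.Γ₁, chi t (v i) = chi t (v (T.τ i))) : adTensor (torus w t) r = r := by
  obtain ⟨c, e, r₀, hc, he, -, rfl⟩ := hr
  have key : ∀ a b, IsRoot L d v a → IsRoot L d v b → chi t (comb v b) = chi t (comb v a) →
      adTensor (torus w t) (e (-a) ⊗ₜ[K] e b) = e (-a) ⊗ₜ[K] e b ∧
      adTensor (torus w t) (e b ⊗ₜ[K] e (-a)) = e b ⊗ₜ[K] e (-a) := by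
    intro a b ha hb hab
    have h1 := R.lie_torus_conj (he.mem _ (R.isRoot_neg ha)) t
    have h2 := R.lie_torus_conj (he.mem _ hb) t
    rw [adTensor_tmul, adTensor_tmul, h1, h2, comb_neg, chi_neg, hab]
    constructor <;> rw [TensorProduct.smul_tmul_smul] <;> simp
  have hr₀ : adTensor (torus w t)
      (TensorProduct.map (cartan L).subtype (cartan L).subtype r₀) =
        TensorProduct.map (cartan L).subtype (cartan L).subtype r₀ := by
    have hdiag : ∀ H ∈ cartan L, (torus w t : Matrix ι ι K) * H *
        (((torus w t)⁻¹ : GL ι K) : Matrix ι ι K) = H := by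
      intro H hH
      ext p q
      rw [torus_conj_apply]
      by_cases h : p = q
      · simp [h]
      · simp [hH.2 h]
    induction r₀ using TensorProduct.induction_on with
    | zero => simp
    | tmul x y =>
      rw [TensorProduct.map_tmul, Submodule.coe_subtype, adTensor_tmul, hdiag _ x.2, hdiag _ y.2]
    | add x y hx hy => rw [map_add, map_add, hx, hy]
  rw [finsum_mem_eq_finite_toFinset_sum _ R.finite_posRoots,
    finsum_mem_eq_finite_toFinset_sum _ (R.finite_wedgePairs T), map_add, map_add, hr₀, map_sum,
    map_sum]
  congr 1
  · congr 1
    refine Finset.sum_congr rfl fun a ha => ?_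
    rw [Set.Finite.mem_toFinset] at ha
    exact (key a a ha.1 ha.1 rfl).1
  · refine Finset.sum_congr rfl fun p hp => ?_
    obtain ⟨ha, hk, hs⟩ := (R.finite_wedgePairs T).mem_toFinset.1 hp
    have hb := isPosRoot_push_iterate hpush ha p.2 hs
    have := key _ _ ha.1 hb.1 (chi_comb_push_iterate T ht p.2 hs)
    rw [wedge, map_sub, this.1, this.2]

/-- Different root vectors have disjoint supports, so a pair of matrix entries where e_{-α} and
e_{τ(α)} do not vanish sees only the term e_{-α} ⊗ e_{τ(α)} of r. Its coefficient is nonzero and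
gets multiplied by the character τ(α) - α, which must therefore be 1. -/
theorem chi_eq_of_adTensor_torus_eq {T : AdmissibleTriple v}
    (hpush : ∀ a, IsRoot L d v a → T.InSpan a → IsRoot L d v (T.push a))
    {r : Matrix ι ι K ⊗[K] Matrix ι ι K} (hr : IsBDMatrix L d T r) (t : Fin m → Kˣ)
    (h : adTensor (torus w t) r = r) (i : T.Γ₁) : chi t (v i) = chi t (v (T.τ i)) := by
  obtain ⟨c, e, r₀, hc, he, -, hr⟩ := hr
  have hne : ∀ a, IsRoot L d v a → ∃ p q, e a p q ≠ 0 := by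
    intro a ha
    by_contra! h0
    have h1 := he.form_eq_one a ha
    rw [show e a = 0 from Matrix.ext h0] at h1
    simp at h1
  have hvanish : ∀ a b p q, IsRoot L d v a → e a p q ≠ 0 → w p - w q = comb v b → a = b := by
    intro a b p q ha h1 h2
    exact R.comb_injective ((R.homogeneous _ _ _ _ (he.mem a ha) h1).symm.trans h2)
  set α : Fin n → ℤ := Pi.single (i : Fin n) 1 with hα
  set β : Fin n → ℤ := Pi.single (T.τ i : Fin n) 1 with hβ
  have hαp : IsPosRoot L d v α := R.isPosRoot_single i
  have hβp : IsPosRoot L d v β := R.isPosRoot_single (T.τ i)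
  have hαβ : T.push α = β := T.push_single i 1
  have hβα : β ≠ α := by
    intro h
    have h1 := congrFun h (i : Fin n)
    rw [hα, hβ, Pi.single_eq_same, Pi.single_eq_of_ne (T.tau_ne i).symm] at h1
    exact zero_ne_one h1
  obtain ⟨p, q, hpq⟩ := hne _ (R.isRoot_neg hαp.1)
  obtain ⟨p', q', hpq'⟩ := hne _ hβp.1
  have hw := R.homogeneous _ _ _ _ (he.mem _ (R.isRoot_neg hαp.1)) hpq
  have hw' := R.homogeneous _ _ _ _ (he.mem _ hβp.1) hpq'
  have hentry : entryPair p q p' q' r = e (-α) p q * e β p' q' := by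
    rw [hr, finsum_mem_eq_finite_toFinset_sum _ R.finite_posRoots,
      finsum_mem_eq_finite_toFinset_sum _ (R.finite_wedgePairs T), map_add, map_add, map_sum,
      map_sum]
    have h1 : entryPair p q p' q'
        (TensorProduct.map (cartan L).subtype (cartan L).subtype r₀) = 0 := by
      have hne : p ≠ q := by
        rintro rfl
        rw [sub_self, ← comb_zero v] at hw
        exact hαp.1.1 (neg_eq_zero.1 (R.comb_injective hw).symm)
      clear hr
      induction r₀ using TensorProduct.induction_on with
      | zero => simp
      | tmul x y =>
        rw [TensorProduct.map_tmul, entryPair_tmul, Submodule.coe_subtype, x.2.2 hne, zero_mul]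
      | add x y hx hy => rw [map_add, map_add, hx, hy, add_zero]
    have h2 : ∑ a ∈ R.finite_posRoots.toFinset, entryPair p q p' q' (e (-a) ⊗ₜ[K] e a) = 0 := by
      refine Finset.sum_eq_zero fun a ha => ?_
      rw [Set.Finite.mem_toFinset] at ha
      rw [entryPair_tmul]
      by_contra h0
      have h3 := hvanish _ _ _ _ (R.isRoot_neg ha.1) (left_ne_zero_of_mul h0) hw
      have h4 := hvanish _ _ _ _ ha.1 (right_ne_zero_of_mul h0) hw'
      exact hβα (h4.symm.trans (neg_injective h3))
    have h3 : ∑ x ∈ (R.finite_wedgePairs T).toFinset,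
        entryPair p q p' q' (wedge (e (-x.1)) (e (T.push^[x.2] x.1)))
          = entryPair p q p' q' (wedge (e (-α)) (e β)) := by
      rw [Finset.sum_eq_single (α, 1)]
      · simp [hαβ]
      · rintro ⟨a, k⟩ hak hne
        obtain ⟨ha, hk, hs⟩ := (R.finite_wedgePairs T).mem_toFinset.1 hak
        have hb := isPosRoot_push_iterate hpush ha k hs
        rw [wedge, map_sub, entryPair_tmul, entryPair_tmul]
        simp only at ha hk hs hb ⊢
        -- In the reversed half of the wedge a positive root would have to equal -α.
        have t2 : e (T.push^[k] a) p q = 0 := by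
          by_contra h0
          have h5 := hvanish _ _ _ _ hb.1 h0 hw
          have h6 := hb.2
          rw [h5] at h6
          exact hαp.1.1 (le_antisymm (by simpa using h6) hαp.2)
        have t1 : e (-a) p q * e (T.push^[k] a) p' q' = 0 := by
          by_contra h0
          have h3 := neg_injective (hvanish _ _ _ _ (R.isRoot_neg ha.1) (left_ne_zero_of_mul h0) hw)
          have h4 := hvanish _ _ _ _ hb.1 (right_ne_zero_of_mul h0) hw'
          subst h3
          obtain ⟨k, rfl⟩ := Nat.exists_eq_add_of_le' hk
          -- A further application of τ would bring τ(α) back to itself, against the decrease of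
          -- `totalLevel`.
          rcases Nat.eq_zero_or_pos k with rfl | hk0
          · exact hne rfl
          · rw [Function.iterate_succ_apply, hαβ] at h4
            have := T.totalLevel_push_iterate_lt hβp.2 hβp.1.1 hk0 (fun j hj => by
              have := hs (j + 1) (Nat.succ_lt_succ hj)
              rwa [Function.iterate_succ_apply, hαβ] at this)
            rw [h4] at this
            exact lt_irrefl _ this
        rw [t1, t2, zero_mul, sub_zero]
      · intro hmem
        refine absurd ((R.finite_wedgePairs T).mem_toFinset.2 ⟨hαp, le_rfl, fun j hj => ?_⟩) hmem
        obtain rfl : j = 0 := Nat.lt_one_iff.1 hj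
        exact T.inSpan_single i 1
    have h4 : e β p q = 0 := by
      by_contra h0
      have h5 := hvanish _ _ _ _ hβp.1 h0 hw
      have h6 := hβp.2
      rw [h5] at h6
      exact hαp.1.1 (le_antisymm (by simpa using h6) hαp.2)
    rw [h1, h2, h3, wedge, map_sub, entryPair_tmul, entryPair_tmul, h4]
    ring
  have h5 := entryPair_adTensor_torus w t p q p' q' r
  rw [h, hw, hw', comb_neg, chi_neg, hα, hβ, comb_single, comb_single] at h5
  have h6 : entryPair p q p' q' r ≠ 0 := by
    rw [hentry]
    exact mul_ne_zero hpq hpq'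
  have h7 := mul_right_cancel₀ h6 ((one_mul _).trans h5)
  have h8 : (chi t (v i))⁻¹ * chi t (v (T.τ i)) = 1 := Units.ext (by simpa using h7.symm)
  exact inv_mul_eq_one.1 h8

end IsRootDatum

end RootData

/-! ### Cocycles with values in a subgroup of the torus -/

section TorusCocycles

variable {F K : Type*} [Field F] [Field K] [Algebra F K] {m n : ℕ}

/-- The action of the Galois group on the torus. -/
def galMap (σ : K ≃ₐ[F] K) (t : Fin m → Kˣ) : Fin m → Kˣ :=
  fun k => Units.map ((σ : K →+* K) : K →* K) (t k)

/-- The inclusion of the `F`-points of the torus. -/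
def baseMap (K : Type*) [Field K] [Algebra F K] (f : Fin m → Fˣ) : Fin m → Kˣ :=
  fun k => Units.map (algebraMap F K : F →* K) (f k)

theorem galMap_mul (σ : K ≃ₐ[F] K) (t t' : Fin m → Kˣ) :
    galMap σ (t * t') = galMap σ t * galMap σ t' := by
  ext; simp [galMap]

theorem galMap_inv (σ : K ≃ₐ[F] K) (t : Fin m → Kˣ) : galMap σ t⁻¹ = (galMap σ t)⁻¹ := by
  ext; simp [galMap]

theorem galMap_chi (σ : K ≃ₐ[F] K) (t : Fin m → Kˣ) (u : Fin m → ℤ) :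
    Units.map ((σ : K →+* K) : K →* K) (chi t u) = chi (galMap σ t) u := map_chi _ _ _

theorem baseMap_chi (f : Fin m → Fˣ) (u : Fin m → ℤ) :
    chi (baseMap K f) u = Units.map (algebraMap F K : F →* K) (chi f u) := (map_chi _ _ _).symm

theorem units_map_algebraMap_injective :
    Function.Injective (Units.map (algebraMap F K : F →* K)) :=
  Units.map_injective (algebraMap F K).injective

theorem exists_units_map_eq [IsGalois F K] {x : Kˣ}
    (hx : ∀ σ : K ≃ₐ[F] K, Units.map ((σ : K →+* K) : K →* K) x = x) :
    ∃ y : Fˣ, Units.map (algebraMap F K : F →* K) y = x := by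
  obtain ⟨y, hy⟩ := (InfiniteGalois.mem_range_algebraMap_iff_fixed (k := F) (x : K)).2
    fun σ => congrArg Units.val (hx σ)
  have hy0 : y ≠ 0 := by
    rintro rfl
    exact x.ne_zero (by rw [← hy, map_zero])
  exact ⟨Units.mk0 y hy0, Units.ext hy⟩

variable (F) in
/-- The elements `p` of the torus such that `p⁻¹ σ(p)` lies in `S` for all `σ`. -/
def IsTorusCocycle (S : Subgroup (Fin m → Kˣ)) (p : Fin m → Kˣ) : Prop :=
  ∀ σ : K ≃ₐ[F] K, p⁻¹ * galMap σ p ∈ S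

theorem IsTorusCocycle.div {S : Subgroup (Fin m → Kˣ)} {p q : Fin m → Kˣ}
    (hp : IsTorusCocycle F S p) (hq : IsTorusCocycle F S q) :
    IsTorusCocycle F S (p * q⁻¹) := by
  intro σ
  have := S.mul_mem (hp σ) (S.inv_mem (hq σ))
  convert this using 1
  rw [galMap_mul, galMap_inv]
  ext
  simp only [Pi.mul_apply, Pi.inv_apply, Units.val_mul, mul_inv_rev, inv_inv]
  ring

end TorusCocycles

/-! ### Galois descent for invertible matrices -/

section Rational

variable (F : Type*) [Field F] {K : Type*} [Field K] [Algebra F K]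
  {ι : Type*} [Fintype ι] [DecidableEq ι]

theorem exists_map_eq_of_fixed [IsGalois F K] {Q : GL ι K}
    (hQ : ∀ σ : K ≃ₐ[F] K, Matrix.GeneralLinearGroup.map (σ : K →+* K) Q = Q) :
    ∃ Q₀ : GL ι F, Matrix.GeneralLinearGroup.map (algebraMap F K) Q₀ = Q := by
  have h : ∀ i j, ∃ y, algebraMap F K y = (Q : Matrix ι ι K) i j := by
    intro i j
    refine (InfiniteGalois.mem_range_algebraMap_iff_fixed (k := F) _).2 fun σ => ?_
    have h1 : (Matrix.GeneralLinearGroup.map (σ : K →+* K) Q : Matrix ι ι K) i j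
      = (Q : Matrix ι ι K) i j := by rw [hQ σ]
    simpa using h1
  choose y hy using h
  have hm : (Matrix.of y).map (algebraMap F K) = (Q : Matrix ι ι K) := by
    ext i j
    exact hy i j
  have hdet : (Matrix.of y).det ≠ 0 := by
    intro h0
    have h1 : algebraMap F K (Matrix.of y).det = (Q : Matrix ι ι K).det := by
      rw [RingHom.map_det, ← hm]
      rfl
    rw [h0, map_zero] at h1
    exact (Matrix.isUnits_det_units Q).ne_zero h1.symm
  refine ⟨Matrix.GeneralLinearGroup.mkOfDetNeZero (Matrix.of y) hdet, Units.ext ?_⟩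
  exact hm

end Rational

/-! ### Reduction of the cohomology to torus cocycles -/

section Cohomology

variable {F : Type*} [Field F] {K : Type*} [Field K] [Algebra F K]
  {ι : Type*} [Fintype ι] [DecidableEq ι] {m : ℕ} {w : ι → Fin m → ℤ} {d : Fin m → ι}
  {G : Subgroup (GL ι K)} {r : Matrix ι ι K ⊗[K] Matrix ι ι K} {S : Subgroup (Fin m → Kˣ)}

theorem torus_baseMap_mem (hG : ∀ t, torus w t ∈ G) (f : Fin m → Fˣ) :
    torus w (baseMap K f) ∈ rationalPoints F G :=
  ⟨hG _, torus w f, map_torus w (algebraMap F K) f⟩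

theorem isCocycle_torus (hG : ∀ t, torus w t ∈ G)
    (hC : ∀ X, X ∈ centralizer G r ↔ ∃ t ∈ S, torus w t = X) {p : Fin m → Kˣ}
    (hp : IsTorusCocycle F S p) : IsCocycle F G r (torus w p) := by
  refine ⟨hG p, fun σ => ?_⟩
  rw [map_torus, ← map_inv, ← map_mul]
  exact (hC _).2 ⟨_, hp σ, rfl⟩

/-- An explicit Hilbert 90. As w (d k) = ε_k, σ multiplies column d k of X by the coordinate k of
δ(σ); any nonzero entry of that column can serve as p_k. Then σ(p) = p δ(σ), and X p⁻¹ is Galois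
invariant. -/
theorem IsCocycle.exists_rational_mul_torus [IsGalois F K]
    (hd : ∀ k, w (d k) = Pi.single k 1) (hG : ∀ t, torus w t ∈ G)
    (hC : ∀ X, X ∈ centralizer G r ↔ ∃ t ∈ S, torus w t = X) {X : GL ι K}
    (hX : IsCocycle F G r X) :
    ∃ Q ∈ rationalPoints F G, ∃ p, IsTorusCocycle F S p ∧ X = Q * torus w p := by
  choose δ hδS hδ using fun σ => (hC _).1 (hX.2 σ)
  have hσ : ∀ σ : K ≃ₐ[F] K, Matrix.GeneralLinearGroup.map (σ : K →+* K) X = X * torus w (δ σ) := by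
    intro σ
    rw [hδ, mul_inv_cancel_left]
  have hentry : ∀ (σ : K ≃ₐ[F] K) i k, σ ((X : Matrix ι ι K) i (d k))
      = (X : Matrix ι ι K) i (d k) * (δ σ k : K) := by
    intro σ i k
    have h1 : (Matrix.GeneralLinearGroup.map (σ : K →+* K) X : Matrix ι ι K) i (d k)
      = ((X * torus w (δ σ) : GL ι K) : Matrix ι ι K) i (d k) := by rw [hσ]
    simpa [hd, chi_single] using h1
  have hcol : ∀ k, ∃ i, (X : Matrix ι ι K) i (d k) ≠ 0 := by
    intro k
    by_contra! h0
    exact (Matrix.isUnits_det_units X).ne_zero (Matrix.det_eq_zero_of_column_eq_zero (d k) h0)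
  choose i hi using hcol
  set p : Fin m → Kˣ := fun k => Units.mk0 _ (hi k) with hp
  have hgal : ∀ σ : K ≃ₐ[F] K, galMap σ p = p * δ σ := by
    intro σ
    ext k
    exact hentry σ (i k) k
  refine ⟨X * (torus w p)⁻¹, ⟨G.mul_mem hX.1 (G.inv_mem (hG p)), ?_⟩, p, fun σ => ?_, ?_⟩
  · refine exists_map_eq_of_fixed F fun σ => ?_
    have h1 : Matrix.GeneralLinearGroup.map (σ : K →+* K) (torus w p)
        = torus w p * torus w (δ σ) := by
      rw [map_torus, ← map_mul, ← hgal]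
      rfl
    rw [map_mul, map_inv, h1, hσ, mul_inv_rev]
    group
  · rw [hgal, inv_mul_cancel_left]
    exact hδS σ
  · rw [inv_mul_cancel_right]

/-- If the torus cocycles split, the cohomology is trivial. -/
theorem card_HBD_eq_one [IsGalois F K] (hd : ∀ k, w (d k) = Pi.single k 1)
    (hG : ∀ t, torus w t ∈ G)
    (hC : ∀ X, X ∈ centralizer G r ↔ ∃ t ∈ S, torus w t = X)
    (hsplit : ∀ p, IsTorusCocycle F S p → ∃ f : Fin m → Fˣ, ∃ s ∈ S, p = baseMap K f * s) :
    Nat.card (HBD F G r) = 1 := by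
  rw [Nat.card_eq_one_iff_unique]
  refine ⟨⟨fun a b => ?_⟩, ⟨HBD.trivialClass F G r⟩⟩
  have key : ∀ a : HBD F G r, a = HBD.trivialClass F G r := by
    intro a
    induction a using Quotient.inductionOn with
    | h X =>
      refine Quotient.sound ?_
      obtain ⟨Q, hQ, p, hp, hX⟩ := X.2.exists_rational_mul_torus hd hG hC
      obtain ⟨f, s, hs, rfl⟩ := hsplit p hp
      refine ⟨Q * torus w (baseMap K f), mul_mem hQ (torus_baseMap_mem hG f), torus w s,
        (hC _).2 ⟨s, hs, rfl⟩, ?_⟩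
      rw [hX, map_mul, mul_one, mul_assoc]
  rw [key a, key b]

variable (F) in
/-- The discriminant class of a cocycle: `X = Q · t` with `Q` rational and `t_N² = x`. -/
def HasDiscriminant (w : ι → Fin m → ℤ) (G : Subgroup (GL ι K)) (S : Subgroup (Fin m → Kˣ))
    (N : Fin m) (X : GL ι K) (y : Fˣ ⧸ (powMonoidHom 2 : Fˣ →* Fˣ).range) : Prop :=
  ∃ Q ∈ rationalPoints F G, ∃ p, IsTorusCocycle F S p ∧ X = Q * torus w p ∧
    ∃ x : Fˣ, Units.map (algebraMap F K : F →* K) x = p N ^ 2 ∧ y = QuotientGroup.mk x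

/-- The torus element p (p' s)⁻¹ is rational, so its coordinate N lies in F. Since s_N² = 1, the
squares of p_N and p'_N differ by the square of an element of F. -/
theorem HasDiscriminant.eq_of_equiv (hd : ∀ k, w (d k) = Pi.single k 1)
    {N : Fin m} (hS : ∀ s ∈ S, s N ^ 2 = 1) {X X' : GL ι K}
    {y y' : Fˣ ⧸ (powMonoidHom 2 : Fˣ →* Fˣ).range} (h : HasDiscriminant F w G S N X y)
    (h' : HasDiscriminant F w G S N X' y')
    (hXX' : ∃ Q ∈ rationalPoints F G, ∃ s ∈ S, X = Q * X' * torus w s) : y = y' := by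
  obtain ⟨Q₁, hQ₁, p, -, rfl, x, hx, rfl⟩ := h
  obtain ⟨Q₂, hQ₂, p', -, rfl, x', hx', rfl⟩ := h'
  obtain ⟨Q, hQ, s, hs, hXX'⟩ := hXX'
  have h1 : torus w (p * (p' * s)⁻¹) = Q₁⁻¹ * Q * Q₂ := by
    rw [map_mul, map_inv, map_mul, mul_inv_eq_iff_eq_mul]
    have := congrArg (Q₁⁻¹ * ·) hXX'
    simp only [inv_mul_cancel_left] at this
    rw [this]
    group
  obtain ⟨Q₀, hQ₀⟩ := (mul_mem (mul_mem (inv_mem hQ₁) hQ) hQ₂).2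
  rw [← h1] at hQ₀
  have h2 : algebraMap F K ((Q₀ : Matrix ι ι F) (d N) (d N)) = ((p * (p' * s)⁻¹) N : Kˣ) := by
    have h3 : (Matrix.GeneralLinearGroup.map (algebraMap F K) Q₀ : Matrix ι ι K) (d N) (d N)
      = (torus w (p * (p' * s)⁻¹) : Matrix ι ι K) (d N) (d N) := by rw [hQ₀]
    rw [coe_torus, Matrix.diagonal_apply_eq, hd, chi_single, zpow_one] at h3
    exact h3
  have hne : (Q₀ : Matrix ι ι F) (d N) (d N) ≠ 0 := by
    intro h0
    rw [h0, map_zero] at h2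
    exact Units.ne_zero _ h2.symm
  have h3 : Units.map (algebraMap F K : F →* K) (Units.mk0 _ hne) = p N * (p' N * s N)⁻¹ :=
    Units.ext h2
  rw [QuotientGroup.eq]
  refine ⟨(Units.mk0 _ hne)⁻¹, ?_⟩
  apply units_map_algebraMap_injective (K := K)
  rw [powMonoidHom_apply, map_pow, map_inv, h3, map_mul, map_inv, hx, hx']
  have h5 := hS s hs
  rw [mul_inv_rev, inv_inv, mul_pow, inv_pow, mul_pow, h5, mul_one, mul_comm]

/-- Equal square classes make p_N / p'_N rational, and then the quotient cocycle p p'⁻¹ splits by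
`hsplit`. -/
theorem HasDiscriminant.equiv {N : Fin m} (hG : ∀ t, torus w t ∈ G)
    (hsplit : ∀ p, IsTorusCocycle F S p →
      (∃ x : Fˣ, Units.map (algebraMap F K : F →* K) x = p N) →
      ∃ f : Fin m → Fˣ, ∃ s ∈ S, p = baseMap K f * s) {X X' : GL ι K}
    {y : Fˣ ⧸ (powMonoidHom 2 : Fˣ →* Fˣ).range} (h : HasDiscriminant F w G S N X y)
    (h' : HasDiscriminant F w G S N X' y) :
    ∃ Q ∈ rationalPoints F G, ∃ s ∈ S, X = Q * X' * torus w s := by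
  obtain ⟨Q₁, hQ₁, p, hp, rfl, x, hx, rfl⟩ := h
  obtain ⟨Q₂, hQ₂, p', hp', rfl, x', hx', hxx'⟩ := h'
  obtain ⟨z, hz⟩ := QuotientGroup.eq.1 hxx'
  have hz' : x' = x * z ^ 2 := by
    rw [powMonoidHom_apply] at hz
    rw [hz, mul_inv_cancel_left]
  -- Here z² = x' / x, so p_N / p'_N is z⁻¹ up to sign; either sign is rational.
  have h1 : (p N * (p' N)⁻¹ * Units.map (algebraMap F K : F →* K) z) ^ 2 = 1 := by
    rw [mul_pow, mul_pow, inv_pow, ← hx, ← hx', hz', map_mul, map_pow, mul_inv_rev, mul_left_comm,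
      mul_inv_cancel, mul_one, inv_mul_cancel]
  have h2 : ∃ x : Fˣ, Units.map (algebraMap F K : F →* K) x = (p * p'⁻¹) N := by
    have h1' : p N * (p' N)⁻¹ * Units.map (algebraMap F K : F →* K) z = 1 ∨
        p N * (p' N)⁻¹ * Units.map (algebraMap F K : F →* K) z = -1 := by
      rw [sq] at h1
      rcases mul_self_eq_one_iff.1 (congrArg Units.val h1) with h | h
      · exact .inl (Units.ext h)
      · exact .inr (Units.ext h)
    rcases h1' with h | h
    · exact ⟨z⁻¹, by rw [map_inv]; exact (eq_inv_of_mul_eq_one_left h).symm⟩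
    · refine ⟨-z⁻¹, ?_⟩
      rw [Pi.mul_apply, Pi.inv_apply, ← mul_inv_eq_iff_eq_mul.2 (Eq.symm h)]
      ext
      simp
  obtain ⟨f, s, hs, hps⟩ := hsplit _ (hp.div hp') h2
  refine ⟨Q₁ * torus w (baseMap K f) * Q₂⁻¹,
    mul_mem (mul_mem hQ₁ (torus_baseMap_mem hG f)) (inv_mem hQ₂), s, hs, ?_⟩
  have h3 : p = baseMap K f * p' * s := by
    rw [mul_inv_eq_iff_eq_mul.1 hps]
    ac_rfl
  rw [h3, map_mul, map_mul]
  group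

/-- The cohomology of a disconnected centralizer, on which the coordinate `N` takes the values
`±1`, is parametrized by the square classes. -/
theorem exists_HBD_equiv [IsGalois F K] [IsAlgClosed K] (hd : ∀ k, w (d k) = Pi.single k 1)
    (hG : ∀ t, torus w t ∈ G)
    (hC : ∀ X, X ∈ centralizer G r ↔ ∃ t ∈ S, torus w t = X) {N : Fin m}
    (hS : ∀ s ∈ S, s N ^ 2 = 1)
    (hsplit : ∀ p, IsTorusCocycle F S p →
      (∃ x : Fˣ, Units.map (algebraMap F K : F →* K) x = p N) →
      ∃ f : Fin m → Fˣ, ∃ s ∈ S, p = baseMap K f * s)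
    (hsurj : ∀ (x : Fˣ) (y : Kˣ), y ^ 2 = Units.map (algebraMap F K : F →* K) x →
      ∃ p, IsTorusCocycle F S p ∧ p N = y) :
    ∃ φ : HBD F G r ≃ Fˣ ⧸ (powMonoidHom 2 : Fˣ →* Fˣ).range,
      φ (HBD.trivialClass F G r) = 1 := by
  have hex : ∀ X : {X // IsCocycle F G r X}, ∃ y, HasDiscriminant F w G S N X.1 y := by
    intro X
    obtain ⟨Q, hQ, p, hp, hX⟩ := X.2.exists_rational_mul_torus hd hG hC
    obtain ⟨x, hx⟩ : ∃ x : Fˣ, Units.map (algebraMap F K : F →* K) x = p N ^ 2 := by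
      refine exists_units_map_eq fun σ => ?_
      have h1 := hS _ (hp σ)
      rw [Pi.mul_apply, mul_pow, Pi.inv_apply, inv_pow, inv_mul_eq_one] at h1
      rw [map_pow]
      exact h1.symm
    exact ⟨_, Q, hQ, p, hp, hX, x, hx, rfl⟩
  choose y hy using hex
  have hrel : ∀ X X' : {X // IsCocycle F G r X}, cocycleSetoid F G r X X' ↔
      ∃ Q ∈ rationalPoints F G, ∃ s ∈ S, X.1 = Q * X'.1 * torus w s := by
    intro X X'
    constructor
    · rintro ⟨Q, hQ, C, hCr, h⟩
      obtain ⟨s, hs, rfl⟩ := (hC C).1 hCr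
      exact ⟨Q, hQ, s, hs, h⟩
    · rintro ⟨Q, hQ, s, hs, h⟩
      exact ⟨Q, hQ, _, (hC _).2 ⟨s, hs, rfl⟩, h⟩
  -- The class y is chosen separately for each cocycle; `eq_of_equiv` makes it independent of the
  -- decomposition and of the representative.
  let φ : HBD F G r → Fˣ ⧸ (powMonoidHom 2 : Fˣ →* Fˣ).range :=
    Quotient.lift y fun X X' h => (hy X).eq_of_equiv hd hS (hy X') ((hrel X X').1 h)
  have hφ : Function.Bijective φ := by
    constructor
    · intro a b
      induction a using Quotient.inductionOn with
      | h X =>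
        induction b using Quotient.inductionOn with
        | h X' =>
          intro h
          refine Quotient.sound ((hrel X X').2 ((hy X).equiv hG hsplit ?_))
          have h' : y X = y X' := h
          rw [h']
          exact hy X'
    · intro z
      induction z using QuotientGroup.induction_on with
      | H x =>
        obtain ⟨s, hs⟩ := IsAlgClosed.exists_pow_nat_eq (algebraMap F K x) (n := 2) two_pos
        have hs0 : s ≠ 0 := by
          rintro rfl
          rw [zero_pow two_ne_zero, eq_comm, map_eq_zero] at hs
          exact x.ne_zero hs
        obtain ⟨p, hp, hpN⟩ := hsurj x (Units.mk0 s hs0) (Units.ext (by simpa using hs))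
        refine ⟨Quotient.mk _ ⟨torus w p, isCocycle_torus hG hC hp⟩, ?_⟩
        refine (hy _).eq_of_equiv hd hS (X' := torus w p) ⟨1, one_mem _, p, hp, ?_, x, ?_, rfl⟩
          ⟨1, one_mem _, 1, one_mem _, ?_⟩
        · simp
        · rw [hpN]
          exact Units.ext (by simpa using hs.symm)
        · simp
  refine ⟨Equiv.ofBijective φ hφ, ?_⟩
  refine (hy _).eq_of_equiv hd hS (X' := 1) ⟨1, one_mem _, 1, fun σ => ?_, ?_, 1, ?_, rfl⟩
    ⟨1, one_mem _, 1, one_mem _, ?_⟩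
  · have : galMap σ (1 : Fin m → Kˣ) = 1 := by ext; simp [galMap]
    rw [this, inv_one, one_mul]
    exact one_mem _
  · simp
  · simp
  · simp

end Cohomology

/-! ### The subgroup of the torus attached to an admissible triple -/

section TripleSubgroup

variable {F K : Type*} [Field F] [Field K] [Algebra F K] {m n : ℕ} {v : Fin n → Fin m → ℤ}

/-- The elements of the torus on which the characters `α` and `τ(α)` agree for `α ∈ Γ₁`. -/
def AdmissibleTriple.torusSubgroup (T : AdmissibleTriple v) (K : Type*) [Field K] :
    Subgroup (Fin m → Kˣ) where
  carrier := {t | ∀ i : T.Γ₁, chi t (v i) = chi t (v (T.τ i))}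
  one_mem' := fun i => by simp
  mul_mem' := fun hs ht i => by rw [chi_mul, chi_mul, hs i, ht i]
  inv_mem' := fun ht i => by rw [chi_inv, chi_inv, ht i]

theorem AdmissibleTriple.chi_eq_of_reaches (T : AdmissibleTriple v) {t : Fin m → Kˣ}
    (ht : t ∈ T.torusSubgroup K) {i j : Fin n} (h : T.Reaches i j) :
    chi t (v j) = chi t (v i) := by
  induction h with
  | refl => rfl
  | tail _ hbc ih =>
    obtain ⟨hb, rfl⟩ := hbc
    rw [← ih, ht ⟨_, hb⟩]

theorem AdmissibleTriple.chi_eq_of_source_eq (T : AdmissibleTriple v) {t : Fin m → Kˣ}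
    (ht : t ∈ T.torusSubgroup K) {i j : Fin n} (h : T.source i = T.source j) :
    chi t (v i) = chi t (v j) := by
  rw [T.chi_eq_of_reaches ht (T.reaches_source i), T.chi_eq_of_reaches ht (T.reaches_source j), h]

/-- The map ρ chooses a representative in each string. The values of p at α_i and α_{ρ i} change by
the same factor under σ, so their ratio g_i is rational. If f realises g, then p f⁻¹ takes at α_i
the value of p at α_{ρ i}, which is constant along τ. The premise inside `hlift` yields g_i = 1
whenever ρ i = i. -/
theorem AdmissibleTriple.exists_eq_baseMap_mul [IsGalois F K] (T : AdmissibleTriple v)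
    {p : Fin m → Kˣ} (hp : IsTorusCocycle F (T.torusSubgroup K) p) (ρ : Fin n → Fin n)
    (hρ : ∀ i, T.source (ρ i) = T.source i) (hτ : ∀ i : T.Γ₁, ρ (T.τ i) = ρ i)
    (hlift : ∀ g : Fin n → Fˣ,
      (∀ i, chi p (v i) = Units.map (algebraMap F K : F →* K) (g i) * chi p (v (ρ i))) →
      ∃ f : Fin m → Fˣ, ∀ i, chi f (v i) = g i) :
    ∃ f : Fin m → Fˣ, ∃ s ∈ T.torusSubgroup K, p = baseMap K f * s := by
  have hg : ∀ i, ∃ g : Fˣ,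
      Units.map (algebraMap F K : F →* K) g = chi p (v i) * (chi p (v (ρ i)))⁻¹ := by
    intro i
    refine exists_units_map_eq fun σ => ?_
    have h1 := T.chi_eq_of_source_eq (hp σ) (hρ i).symm
    rw [chi_mul, chi_mul, chi_inv, chi_inv] at h1
    rw [map_mul, map_inv, galMap_chi, galMap_chi]
    rw [inv_mul_eq_iff_eq_mul] at h1
    rw [h1]
    group
  choose g hg using hg
  obtain ⟨f, hf⟩ := hlift g fun i => by rw [hg, inv_mul_cancel_right]
  refine ⟨f, p * (baseMap K f)⁻¹, fun i => ?_, ?_⟩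
  · have h : ∀ i, chi (p * (baseMap K f)⁻¹) (v i) = chi p (v (ρ i)) := by
      intro i
      rw [chi_mul, chi_inv, baseMap_chi, hf, hg, mul_inv_rev, inv_inv, mul_comm,
        inv_mul_cancel_right]
    rw [h, h, hτ]
  · rw [mul_comm, inv_mul_cancel_right]

end TripleSubgroup

/-! ### Lie algebras and groups preserving a monomial form -/

section MonomialForm

variable {K : Type*} [Field K] {ι : Type*} [Fintype ι] [DecidableEq ι]

/-- The matrix of the bilinear form pairing the basis vectors `p` and `bar p`. -/
def monomialForm (bar : ι → ι) (j : ι → K) : Matrix ι ι K :=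
  Matrix.of fun p q => if q = bar p then j p else 0

variable {bar : ι → ι} {j : ι → K} (hbar : Function.Involutive bar)
include hbar

theorem transpose_mul_monomialForm (x : Matrix ι ι K) (p q : ι) :
    (x.transpose * monomialForm bar j) p q = x (bar q) p * j (bar q) := by
  rw [Matrix.mul_apply, Finset.sum_eq_single (bar q)]
  · simp [monomialForm, hbar q]
  · intro l _ hl
    have : q ≠ bar l := fun h => hl (by rw [h, hbar l])
    simp [monomialForm, this]
  · simp

omit hbar in
theorem monomialForm_mul (x : Matrix ι ι K) (p q : ι) :
    (monomialForm bar j * x) p q = j p * x (bar p) q := by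
  rw [Matrix.mul_apply, Finset.sum_eq_single (bar p)]
  · simp [monomialForm]
  · intro l _ hl
    simp [monomialForm, hl]
  · simp

theorem mem_skewAdjoint_monomialForm (x : Matrix ι ι K) :
    x ∈ skewAdjointMatricesLieSubalgebra (monomialForm bar j) ↔
      ∀ p q, j (bar q) * x (bar q) (bar p) = -(j (bar p) * x p q) := by
  rw [mem_skewAdjointMatricesLieSubalgebra, mem_skewAdjointMatricesSubmodule,
    Matrix.IsSkewAdjoint, Matrix.IsAdjointPair, ← Matrix.ext_iff]
  simp only [transpose_mul_monomialForm hbar, monomialForm_mul, Matrix.neg_apply, mul_neg]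
  constructor
  · intro h p q
    have := h (bar p) q
    rwa [hbar p, mul_comm] at this
  · intro h p q
    have := h (bar p) q
    rwa [hbar p, mul_comm] at this

theorem transpose_mul_monomialForm_mul (x y : Matrix ι ι K) (p q : ι) :
    (x.transpose * monomialForm bar j * y) p q = ∑ l, x l p * j l * y (bar l) q := by
  rw [Matrix.mul_apply]
  refine (Equiv.sum_comp (Function.Involutive.toPerm bar hbar) _).symm.trans ?_
  refine Finset.sum_congr rfl fun l _ => ?_
  rw [transpose_mul_monomialForm hbar, Function.Involutive.coe_toPerm, hbar l]

theorem mem_isometryGroup_iff (X : GL ι K) :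
    X ∈ isometryGroup (monomialForm bar j) ↔
      ∀ p q, ∑ l, (X : Matrix ι ι K) l p * j l * (X : Matrix ι ι K) (bar l) q
        = if q = bar p then j p else 0 := by
  change (X : Matrix ι ι K).transpose * monomialForm bar j * (X : Matrix ι ι K)
    = monomialForm bar j ↔ _
  rw [← Matrix.ext_iff]
  simp only [transpose_mul_monomialForm_mul hbar]
  rfl

end MonomialForm

/-! ### Roots, torus and isometries of a monomial form -/

/-- The standard representation of a classical Lie algebra preserving the form with the matrix
`monomialForm bar j`, which is symmetric for `η = 1` and alternating for `η = -1`. The standard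
basis vector at `p` has the weight `w p`. -/
structure IsFormDatum {K : Type*} [Field K] {ι : Type*} {m : ℕ} (bar : ι → ι)
    (j : ι → K) (η : ℤˣ) (w : ι → Fin m → ℤ) (d : Fin m → ι) : Prop where
  bar_bar : Function.Involutive bar
  form_ne_zero : ∀ p, j p ≠ 0
  form_bar : ∀ p, j (bar p) = ((η : ℤ) : K) * j p
  weight_bar : ∀ p, w (bar p) = -w p
  weight_injective : Function.Injective w
  weight_d : ∀ k, w (d k) = Pi.single k 1
  cases : ∀ p, (∃ k, p = d k) ∨ (∃ k, p = bar (d k)) ∨ bar p = p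

namespace IsFormDatum

variable {K : Type*} [Field K] [CharZero K] {ι : Type*} [Fintype ι] [DecidableEq ι] {m n : ℕ}
  {bar : ι → ι} {j : ι → K} {η : ℤˣ} {w : ι → Fin m → ℤ} {d : Fin m → ι}
  (D : IsFormDatum bar j η w d) {v : Fin n → Fin m → ℤ}
include D

omit [CharZero K] [Fintype ι] [DecidableEq ι] in
theorem weight_eq_zero {p : ι} (h : bar p = p) : w p = 0 := by
  have := D.weight_bar p
  rw [h] at this
  exact self_eq_neg.1 this

omit [CharZero K] in
theorem cartan_bar {H : Matrix ι ι K}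
    (hH : H ∈ cartan (skewAdjointMatricesLieSubalgebra (monomialForm bar j))) (p : ι) :
    H (bar p) (bar p) = -H p p := by
  have := (mem_skewAdjoint_monomialForm D.bar_bar H).1 hH.1 p p
  rw [← mul_neg] at this
  exact mul_left_cancel₀ (D.form_ne_zero _) this

theorem cartan_apply {H : Matrix ι ι K}
    (hH : H ∈ cartan (skewAdjointMatricesLieSubalgebra (monomialForm bar j))) (p : ι) :
    H p p = ∑ k, (w p k : K) * H (d k) (d k) := by
  have hd : ∀ l, H (d l) (d l) = ∑ k, (w (d l) k : K) * H (d k) (d k) := by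
    intro l
    rw [D.weight_d, Finset.sum_eq_single l]
    · simp
    · intro k _ hk
      simp [hk]
    · simp
  rcases D.cases p with ⟨l, rfl⟩ | ⟨l, rfl⟩ | hp
  · exact hd l
  · rw [D.cartan_bar hH, hd, D.weight_bar]
    simp
  · have h1 := D.cartan_bar hH p
    rw [hp] at h1
    rw [self_eq_neg.1 h1, D.weight_eq_zero hp]
    simp

omit [CharZero K] in
theorem diagonal_mem_cartan (k : Fin m) : Matrix.diagonal (fun p => (w p k : K)) ∈
    cartan (skewAdjointMatricesLieSubalgebra (monomialForm bar j)) := by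
  refine ⟨(mem_skewAdjoint_monomialForm D.bar_bar _).2 fun p q => ?_, Matrix.isDiag_diagonal _⟩
  by_cases h : p = q
  · subst h
    simp [D.weight_bar]
  · have h' : bar q ≠ bar p := fun e => h (D.bar_bar.injective e).symm
    simp [h, h']

/-- Bracketing with diag(w p k) reads off the coordinate k of the weight; characteristic zero
carries the equality from K back to ℤ. -/
theorem homogeneous (a : Fin n → ℤ) (x : Matrix ι ι K) (p q : ι)
    (hx : InWeightSpace (skewAdjointMatricesLieSubalgebra (monomialForm bar j)) d v a x)
    (hpq : x p q ≠ 0) : w p - w q = comb v a := by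
  ext k
  have h1 := hx.2 _ (D.diagonal_mem_cartan k)
  rw [weight_apply, Finset.sum_eq_single k] at h1
  · have h2 := congrFun (congrFun h1 p) q
    rw [LieRing.of_associative_ring_bracket] at h2
    change (Matrix.diagonal (fun p => (w p k : K)) * x) p q
      - (x * Matrix.diagonal (fun p => (w p k : K))) p q = _ * x p q at h2
    rw [Matrix.diagonal_mul, Matrix.mul_diagonal, Matrix.diagonal_apply_eq, D.weight_d,
      Pi.single_eq_same, Int.cast_one, mul_one, mul_comm (x p q), ← sub_mul] at h2
    have h3 := mul_right_cancel₀ hpq h2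
    exact_mod_cast h3
  · intro l _ hl
    simp [D.weight_d, hl.symm]
  · simp

/-- A root vector is a combination of the matrix unit at (p, q) and its mirror image at (bar q, bar
p). If q = bar p the two positions coincide: the terms cancel for a symmetric form and add up for an
alternating one. -/
theorem isRoot_iff (hv : Function.Injective (comb v)) (a : Fin n → ℤ) :
    IsRoot (skewAdjointMatricesLieSubalgebra (monomialForm bar j)) d v a ↔
      comb v a ≠ 0 ∧ ∃ p q, w p - w q = comb v a ∧ (η = 1 → q ≠ bar p) := by
  constructor
  · rintro ⟨ha, x, hx0, hx⟩
    refine ⟨fun h => ha (hv (h.trans (comb_zero v).symm)), ?_⟩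
    have : ∃ p q, x p q ≠ 0 := by
      by_contra! h
      exact hx0 (Matrix.ext h)
    obtain ⟨p, q, hpq⟩ := this
    refine ⟨p, q, D.homogeneous a x p q hx hpq, ?_⟩
    rintro rfl rfl
    have h1 := (mem_skewAdjoint_monomialForm D.bar_bar x).1 hx.1 p (bar p)
    rw [D.bar_bar p, ← mul_neg, D.form_bar] at h1
    have h2 := D.form_ne_zero p
    simp only [Units.val_one, Int.cast_one, one_mul] at h1
    exact hpq (self_eq_neg.1 (mul_left_cancel₀ h2 h1))
  · rintro ⟨ha, p, q, hw, hη⟩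
    refine ⟨fun h => ha (by rw [h, comb_zero]), ?_⟩
    set x : Matrix ι ι K := Matrix.single p q (j (bar q)) -
      Matrix.single (bar q) (bar p) (j (bar p)) with hx
    have hη2 : ((η : ℤ) : K) * ((η : ℤ) : K) = 1 := by
      rcases Int.units_eq_one_or η with rfl | rfl <;> simp
    refine ⟨x, ?_, ?_, fun H hH => ?_⟩
    · intro h0
      have h1 : x p q = 0 := by rw [h0]; rfl
      rw [hx] at h1
      by_cases hpq : q = bar p
      · subst hpq
        have h2 : η = -1 := (Int.units_eq_one_or η).resolve_left fun h => hη h rfl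
        rw [D.bar_bar p] at h1
        simp only [Matrix.sub_apply, Matrix.single_apply_same, D.form_bar p, h2, Units.val_neg,
          Units.val_one, Int.cast_neg, Int.cast_one, neg_mul, one_mul, sub_neg_eq_add,
          add_self_eq_zero] at h1
        exact D.form_ne_zero p h1
      · have h2 : ¬ (bar q = p ∧ bar p = q) := fun h => hpq h.2.symm
        simp only [Matrix.sub_apply, Matrix.single_apply_same, Matrix.single_apply_of_ne _ _ _ _ _ h2,
          sub_zero] at h1
        exact D.form_ne_zero _ h1
    · refine (mem_skewAdjoint_monomialForm D.bar_bar x).2 fun p' q' => ?_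
      have e1 : (p = bar q' ∧ q = bar p') ↔ (bar q = p' ∧ bar p = q') := by
        constructor
        · rintro ⟨rfl, rfl⟩; exact ⟨D.bar_bar _, D.bar_bar _⟩
        · rintro ⟨rfl, rfl⟩; exact ⟨(D.bar_bar _).symm, (D.bar_bar _).symm⟩
      have e2 : (bar q = bar q' ∧ bar p = bar p') ↔ (p = p' ∧ q = q') := by
        rw [D.bar_bar.injective.eq_iff, D.bar_bar.injective.eq_iff, and_comm]
      simp only [hx, Matrix.sub_apply, Matrix.single_apply, e1, e2]
      -- The conditions express p and q through p' and q'; moving j to the latter makes the two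
      -- sides comparable.
      have k1 : (if bar q = p' ∧ bar p = q' then j (bar q) else 0)
          = (if bar q = p' ∧ bar p = q' then j p' else 0) := by
        split_ifs with h
        · rw [h.1]
        · rfl
      have k2 : (if p = p' ∧ q = q' then j (bar p) else 0)
          = (if p = p' ∧ q = q' then j (bar p') else 0) := by
        split_ifs with h
        · rw [h.1]
        · rfl
      have k3 : (if p = p' ∧ q = q' then j (bar q) else 0)
          = (if p = p' ∧ q = q' then j (bar q') else 0) := by
        split_ifs with h
        · rw [h.2]
        · rfl
      have k4 : (if bar q = p' ∧ bar p = q' then j (bar p) else 0)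
          = (if bar q = p' ∧ bar p = q' then j q' else 0) := by
        split_ifs with h
        · rw [h.2]
        · rfl
      rw [k1, k2, k3, k4, D.form_bar, D.form_bar]
      split_ifs <;> ring1
    · have hwt : H p p - H q q = weight d v a H := by
        rw [weight_apply, ← hw, D.cartan_apply hH p, D.cartan_apply hH q,
          ← Finset.sum_sub_distrib]
        refine Finset.sum_congr rfl fun k _ => ?_
        simp only [Pi.sub_apply, Int.cast_sub]
        ring
      have hwt' : H (bar q) (bar q) - H (bar p) (bar p) = weight d v a H := by
        rw [← hwt, D.cartan_bar hH, D.cartan_bar hH]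
        ring
      have hHd := hH.2.diagonal_diag
      have hsingle : ∀ (p q : ι) (c : K), H p p - H q q = weight d v a H →
          ⁅H, Matrix.single p q c⁆ = weight d v a H • Matrix.single p q c := by
        intro p q c h
        rw [LieRing.of_associative_ring_bracket]
        ext p' q'
        conv_lhs => rw [← hHd]
        rw [Matrix.sub_apply, Matrix.diagonal_mul, Matrix.mul_diagonal, Matrix.smul_apply,
          smul_eq_mul, Matrix.single_apply, ← h]
        simp only [Matrix.diag_apply]
        split_ifs with h'
        · rw [h'.1, h'.2]; ring
        · ring
      rw [hx, lie_sub, hsingle _ _ _ hwt, hsingle _ _ _ hwt', smul_sub]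

omit [CharZero K] [DecidableEq ι] in
theorem sum_weight : ∑ p, w p = 0 := by
  have h1 : ∑ p, w (bar p) = ∑ p, w p :=
    Equiv.sum_comp (Function.Involutive.toPerm bar D.bar_bar) w
  simp only [D.weight_bar, Finset.sum_neg_distrib] at h1
  exact self_eq_neg.1 h1.symm

omit [CharZero K] [Fintype ι] [DecidableEq ι] in
theorem chi_weight_bar (t : Fin m → Kˣ) (p : ι) : chi t (w (bar p)) = (chi t (w p))⁻¹ := by
  rw [D.weight_bar, chi_neg]

omit [CharZero K] in
theorem torus_mem_isometryGroup (t : Fin m → Kˣ) :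
    torus w t ∈ isometryGroup (monomialForm bar j) := by
  refine (mem_isometryGroup_iff D.bar_bar _).2 fun p q => ?_
  rw [Finset.sum_eq_single p]
  · rw [coe_torus, Matrix.diagonal_apply_eq]
    split_ifs with h
    · subst h
      rw [Matrix.diagonal_apply_eq, D.chi_weight_bar, mul_right_comm, ← Units.val_mul,
        mul_inv_cancel, Units.val_one, one_mul]
    · rw [Matrix.diagonal_apply_ne _ (Ne.symm h), mul_zero]
  · intro l _ hl
    rw [coe_torus, Matrix.diagonal_apply_ne _ hl, zero_mul, zero_mul]
  · simp

omit [CharZero K] in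
-- The involution negates the weights, so they sum to zero and the determinant is the trivial
-- character.
theorem torus_mem_specialIsometryGroup (t : Fin m → Kˣ) :
    torus w t ∈ specialIsometryGroup (monomialForm bar j) := by
  refine ⟨D.torus_mem_isometryGroup t, ?_⟩
  change Matrix.GeneralLinearGroup.det (torus w t) = 1
  refine Units.ext ?_
  rw [Matrix.GeneralLinearGroup.val_det_apply, coe_torus, Matrix.det_diagonal, Units.val_one]
  have h : ∀ s : Finset ι, ∏ p ∈ s, (chi t (w p) : K) = (chi t (∑ p ∈ s, w p) : K) := by
    intro s
    induction s using Finset.induction_on with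
    | empty => simp
    | insert p s hp ih => rw [Finset.prod_insert hp, Finset.sum_insert hp, chi_add, ih, Units.val_mul]
  rw [h, D.sum_weight, chi_zero, Units.val_one]

omit [CharZero K] in
theorem apply_mul_apply_bar {X : GL ι K} (hX : X ∈ isometryGroup (monomialForm bar j))
    (hdiag : (X : Matrix ι ι K).IsDiag) (p : ι) :
    (X : Matrix ι ι K) p p * (X : Matrix ι ι K) (bar p) (bar p) = 1 := by
  have h1 := (mem_isometryGroup_iff D.bar_bar X).1 hX p (bar p)
  rw [if_pos rfl, Finset.sum_eq_single p] at h1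
  · exact mul_left_cancel₀ (D.form_ne_zero p) (by linear_combination h1)
  · intro l _ hl
    rw [hdiag hl, zero_mul, zero_mul]
  · simp

omit [CharZero K] in
-- Entries of a diagonal isometry at p and bar p are inverse to each other. At a self-paired p this
-- leaves a sign, which `hfix` removes.
theorem exists_torus_eq {X : GL ι K} (hX : X ∈ isometryGroup (monomialForm bar j))
    (hdiag : (X : Matrix ι ι K).IsDiag)
    (hfix : ∀ p, bar p = p → (X : Matrix ι ι K) p p = 1) : ∃ t, torus w t = X := by
  have hmul := D.apply_mul_apply_bar hX hdiag
  refine ⟨fun k => Units.mk0 ((X : Matrix ι ι K) (d k) (d k))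
    (left_ne_zero_of_mul_eq_one (hmul _)), Units.ext ?_⟩
  set t : Fin m → Kˣ := fun k => Units.mk0 ((X : Matrix ι ι K) (d k) (d k))
    (left_ne_zero_of_mul_eq_one (hmul _)) with ht
  have hd : ∀ k, (chi t (w (d k)) : K) = (X : Matrix ι ι K) (d k) (d k) := by
    intro k
    rw [D.weight_d, chi_single, zpow_one]
    rfl
  rw [coe_torus, ← hdiag.diagonal_diag]
  congr 1
  ext p
  rw [Matrix.diag_apply]
  rcases D.cases p with ⟨k, rfl⟩ | ⟨k, rfl⟩ | hp
  · exact hd k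
  · rw [D.chi_weight_bar, Units.val_inv_eq_inv_val, hd]
    exact inv_eq_of_mul_eq_one_right (hmul _)
  · rw [D.weight_eq_zero hp, chi_zero, hfix p hp, Units.val_one]

theorem isRootDatum {P : Finset (Fin m → ℤ)} (hv : Function.Injective (comb v))
    (hP : ∀ u ∈ P, ∃ b, 0 ≤ b ∧ comb v b = u) (hP0 : 0 ∉ P)
    (hroot : ∀ u, (u ≠ 0 ∧ ∃ p q, w p - w q = u ∧ (η = 1 → q ≠ bar p)) ↔ u ∈ P ∨ -u ∈ P)
    (hsimple : ∀ i, v i ∈ P) :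
    IsRootDatum (skewAdjointMatricesLieSubalgebra (monomialForm bar j)) d v w P where
  comb_injective := hv
  exists_comb_eq := hP
  zero_notMem := hP0
  isRoot_iff a := (D.isRoot_iff hv a).trans (hroot _)
  isRoot_single i := ((D.isRoot_iff hv _).trans (hroot _)).2
    (.inl (by rw [comb_single]; exact hsimple i))
  weight_injective := D.weight_injective
  homogeneous := D.homogeneous

/-- The pairing of w p with 2ρ is 2c times the diagonal entry z_p, and X can only join indices with
equal z. -/
theorem dotProduct_sum_eq {P : Finset (Fin m → ℤ)}
    (R : IsRootDatum (skewAdjointMatricesLieSubalgebra (monomialForm bar j)) d v w P)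
    {T : AdmissibleTriple v}
    (hpush : ∀ a, IsRoot (skewAdjointMatricesLieSubalgebra (monomialForm bar j)) d v a →
      T.InSpan a → IsRoot (skewAdjointMatricesLieSubalgebra (monomialForm bar j)) d v (T.push a))
    {r : Matrix ι ι K ⊗[K] Matrix ι ι K}
    (hr : IsBDMatrix (skewAdjointMatricesLieSubalgebra (monomialForm bar j)) d T r) {X : GL ι K}
    (hX : adTensor X r = r) {p q : ι} (hpq : (X : Matrix ι ι K) p q ≠ 0) :
    w p ⬝ᵥ ∑ u ∈ P, u = w q ⬝ᵥ ∑ u ∈ P, u := by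
  obtain ⟨c, z, hc, hz, hXz, htr⟩ := R.exists_diagonal_commute hpush hr
  have hzp : ∀ p, z p = ∑ k, (w p k : K) * z (d k) := by
    intro p
    have := D.cartan_apply hz p
    simpa using this
  -- The factor 2 arises because diag(w p k) has two nonzero entries, at d k and bar (d k).
  have hzk : ∀ k, c * (2 * z (d k)) = (((∑ u ∈ P, u) k : ℤ) : K) := by
    intro k
    have h1 := htr _ (D.diagonal_mem_cartan k)
    have h2 : ∑ u ∈ P, ∑ l, (u l : K) * Matrix.diagonal (fun p => (w p k : K)) (d l) (d l)
        = (((∑ u ∈ P, u) k : ℤ) : K) := by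
      rw [Finset.sum_apply, Int.cast_sum]
      refine Finset.sum_congr rfl fun u _ => ?_
      rw [Finset.sum_eq_single k]
      · simp [D.weight_d]
      · intro l _ hl
        simp [D.weight_d, hl.symm]
      · simp
    rw [h2] at h1
    rw [← h1]
    congr 1
    have hne : d k ≠ bar (d k) := by
      intro h
      have h3 := D.weight_eq_zero h.symm
      rw [D.weight_d] at h3
      simpa using congrFun h3 k
    rw [Fintype.sum_eq_add (d k) (bar (d k)) hne]
    · have h3 := D.cartan_bar hz (d k)
      simp only [Matrix.diagonal_apply_eq] at h3
      rw [h3]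
      simp [D.weight_d, D.weight_bar]
      ring
    · rintro p ⟨hp1, hp2⟩
      rw [Matrix.diagonal_apply_eq]
      rcases D.cases p with ⟨l, rfl⟩ | ⟨l, rfl⟩ | hp
      · have hl : k ≠ l := fun h => hp1 (by rw [h])
        simp [D.weight_d, hl]
      · have hl : k ≠ l := fun h => hp2 (by rw [h])
        simp [D.weight_bar, D.weight_d, hl]
      · simp [D.weight_eq_zero hp]
  have key : ∀ p, ((w p ⬝ᵥ ∑ u ∈ P, u : ℤ) : K) = c * 2 * z p := by
    intro p
    rw [hzp, dotProduct, Int.cast_sum, Finset.mul_sum]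
    refine Finset.sum_congr rfl fun k _ => ?_
    rw [Int.cast_mul, ← hzk]
    ring
  have := hXz X hX p q hpq
  have h2 : ((w p ⬝ᵥ ∑ u ∈ P, u : ℤ) : K) = (w q ⬝ᵥ ∑ u ∈ P, u : ℤ) := by
    rw [key, key, this]
  exact_mod_cast h2

end IsFormDatum

/-! ### Integer vectors of small norm -/

section SmallNorm

variable {m : ℕ}

theorem eq_one_or_neg_one_of_dotProduct_self_lt_four {u : Fin m → ℤ} (h : u ⬝ᵥ u < 4) {k : Fin m}
    (hk : u k ≠ 0) : u k = 1 ∨ u k = -1 := by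
  have h1 : u k * u k ≤ u ⬝ᵥ u :=
    Finset.single_le_sum (f := fun i => u i * u i) (fun i _ => mul_self_nonneg _)
      (Finset.mem_univ k)
  have h2 : u k < 2 := by nlinarith
  have h3 : -2 < u k := by nlinarith
  omega

theorem sub_single_dotProduct_self (u : Fin m → ℤ) (k : Fin m) :
    (u - Pi.single k (u k)) ⬝ᵥ (u - Pi.single k (u k)) = u ⬝ᵥ u - u k * u k := by
  simp only [sub_dotProduct, dotProduct_sub, single_dotProduct, dotProduct_single, Pi.sub_apply,
    Pi.single_eq_same]
  ring

theorem exists_ne_zero_of_dotProduct_self {u : Fin m → ℤ} (h : u ⬝ᵥ u ≠ 0) : ∃ k, u k ≠ 0 := by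
  by_contra! h0
  exact h (by rw [show u = 0 from funext h0, zero_dotProduct])

theorem eq_single_of_dotProduct_self_eq_one {u : Fin m → ℤ} (h : u ⬝ᵥ u = 1) :
    ∃ k, ∃ x : ℤ, (x = 1 ∨ x = -1) ∧ u = Pi.single k x := by
  obtain ⟨k, hk⟩ := exists_ne_zero_of_dotProduct_self (u := u) (by omega)
  have hx := eq_one_or_neg_one_of_dotProduct_self_lt_four (by omega) hk
  refine ⟨k, u k, hx, ?_⟩
  have h1 := sub_single_dotProduct_self u k
  have h2 : u k * u k = 1 := by rcases hx with h | h <;> rw [h] <;> rfl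
  rw [h, h2, sub_self, dotProduct_self_eq_zero] at h1
  exact sub_eq_zero.1 h1

theorem eq_add_of_dotProduct_self_eq_two {u : Fin m → ℤ} (h : u ⬝ᵥ u = 2) :
    ∃ k l, k ≠ l ∧ ∃ x y : ℤ, (x = 1 ∨ x = -1) ∧ (y = 1 ∨ y = -1) ∧
      u = Pi.single k x + Pi.single l y := by
  obtain ⟨k, hk⟩ := exists_ne_zero_of_dotProduct_self (u := u) (by omega)
  have hx := eq_one_or_neg_one_of_dotProduct_self_lt_four (by omega) hk
  have h1 := sub_single_dotProduct_self u k
  have h2 : u k * u k = 1 := by rcases hx with h | h <;> rw [h] <;> rfl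
  rw [h, h2] at h1
  obtain ⟨l, y, hy, hl⟩ := eq_single_of_dotProduct_self_eq_one h1
  refine ⟨k, l, ?_, u k, y, hx, hy, ?_⟩
  · rintro rfl
    have h3 := congrFun hl k
    simp only [Pi.sub_apply, Pi.single_eq_same, sub_self] at h3
    omega
  · rw [← hl]
    abel

end SmallNorm

/-! ### The positive roots in coordinates -/

section PosRoots

/-- The vectors `ε_i - ε_j` with `i < j`. -/
def posRootsA (n : ℕ) : Finset (Fin n → ℤ) :=
  (Finset.univ.filter fun p : Fin n × Fin n => p.1 < p.2).image
    fun p => Pi.single p.1 1 - Pi.single p.2 1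

/-- The vectors `ε_i + ε_j` with `i < j`. -/
def posRootsPlus (n : ℕ) : Finset (Fin n → ℤ) :=
  (Finset.univ.filter fun p : Fin n × Fin n => p.1 < p.2).image
    fun p => Pi.single p.1 1 + Pi.single p.2 1

/-- The vectors `s ε_i`, and no vector if `s = 0`. -/
def posRootsShort (n : ℕ) (s : ℤ) : Finset (Fin n → ℤ) :=
  if s = 0 then ∅ else Finset.univ.image fun i => Pi.single i s

/-- The positive roots of type `D_n`, `B_n`, `C_n` for `s = 0, 1, 2`. -/
def posRoots (n : ℕ) (s : ℤ) : Finset (Fin n → ℤ) :=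
  (posRootsA n ∪ posRootsPlus n) ∪ posRootsShort n s

variable {n : ℕ}

theorem mem_posRootsA {u : Fin n → ℤ} :
    u ∈ posRootsA n ↔ ∃ i j, i < j ∧ Pi.single i 1 - Pi.single j 1 = u := by
  simp [posRootsA]

theorem mem_posRootsPlus {u : Fin n → ℤ} :
    u ∈ posRootsPlus n ↔ ∃ i j, i < j ∧ Pi.single i 1 + Pi.single j 1 = u := by
  simp [posRootsPlus]

theorem mem_posRootsShort {s : ℤ} {u : Fin n → ℤ} :
    u ∈ posRootsShort n s ↔ s ≠ 0 ∧ ∃ i, Pi.single i s = u := by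
  unfold posRootsShort
  split_ifs with h <;> simp [h]

theorem mem_posRoots {s : ℤ} {u : Fin n → ℤ} :
    u ∈ posRoots n s ↔ (∃ i j, i < j ∧ Pi.single i 1 - Pi.single j 1 = u) ∨
      (∃ i j, i < j ∧ Pi.single i 1 + Pi.single j 1 = u) ∨ s ≠ 0 ∧ ∃ i, Pi.single i s = u := by
  rw [posRoots, Finset.mem_union, Finset.mem_union, mem_posRootsA, mem_posRootsPlus,
    mem_posRootsShort, or_assoc]

theorem single_sub_single_dotProduct_self {i j : Fin n} (h : i ≠ j) :
    (Pi.single i 1 - Pi.single j 1 : Fin n → ℤ) ⬝ᵥ (Pi.single i 1 - Pi.single j 1) = 2 := by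
  simp [h, h.symm]

theorem single_add_single_dotProduct_self {i j : Fin n} (h : i ≠ j) :
    (Pi.single i 1 + Pi.single j 1 : Fin n → ℤ) ⬝ᵥ (Pi.single i 1 + Pi.single j 1) = 2 := by
  simp [h, h.symm]

theorem zero_notMem_posRootsA : 0 ∉ posRootsA n := by
  intro h
  obtain ⟨i, j, hij, h⟩ := mem_posRootsA.1 h
  have := single_sub_single_dotProduct_self hij.ne
  rw [h] at this
  simp at this

theorem zero_notMem_posRoots (s : ℤ) : 0 ∉ posRoots n s := by
  intro h
  rcases mem_posRoots.1 h with ⟨i, j, hij, h⟩ | ⟨i, j, hij, h⟩ | ⟨hs, i, h⟩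
  · have := single_sub_single_dotProduct_self hij.ne
    rw [h] at this
    simp at this
  · have := single_add_single_dotProduct_self hij.ne
    rw [h] at this
    simp at this
  · exact hs (Pi.single_eq_zero_iff.1 h)

/-- The roots in terms of the norm. -/
theorem mem_posRoots_or_neg_mem_iff {s : ℤ} {u : Fin n → ℤ} :
    (u ∈ posRoots n s ∨ -u ∈ posRoots n s) ↔
      u ⬝ᵥ u = 2 ∨ s ≠ 0 ∧ ∃ i, Pi.single i s = u ∨ Pi.single i (-s) = u := by
  constructor
  · have aux : ∀ u ∈ posRoots n s, u ⬝ᵥ u = 2 ∨ s ≠ 0 ∧ ∃ i, Pi.single i s = u := by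
      intro u h
      rcases mem_posRoots.1 h with ⟨i, j, hij, rfl⟩ | ⟨i, j, hij, rfl⟩ | ⟨hs, i, h⟩
      · exact .inl (single_sub_single_dotProduct_self hij.ne)
      · exact .inl (single_add_single_dotProduct_self hij.ne)
      · exact .inr ⟨hs, i, h⟩
    rintro (h | h)
    · rcases aux u h with h | ⟨hs, i, h⟩
      · exact .inl h
      · exact .inr ⟨hs, i, .inl h⟩
    · rcases aux _ h with h | ⟨hs, i, h⟩
      · exact .inl (by simpa using h)
      · exact .inr ⟨hs, i, .inr (by rw [Pi.single_neg, h, neg_neg])⟩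
  · rintro (h | ⟨hs, i, h | h⟩)
    · simp only [mem_posRoots]
      obtain ⟨k, l, hkl, x, y, rfl | rfl, rfl | rfl, rfl⟩ := eq_add_of_dotProduct_self_eq_two h
      · rcases lt_or_gt_of_ne hkl with h | h
        · exact .inl (.inr (.inl ⟨k, l, h, rfl⟩))
        · exact .inl (.inr (.inl ⟨l, k, h, add_comm _ _⟩))
      · rcases lt_or_gt_of_ne hkl with h | h
        · exact .inl (.inl ⟨k, l, h, by rw [Pi.single_neg]; abel⟩)
        · exact .inr (.inl ⟨l, k, h, by rw [Pi.single_neg]; abel⟩)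
      · rcases lt_or_gt_of_ne hkl with h | h
        · exact .inr (.inl ⟨k, l, h, by rw [Pi.single_neg]; abel⟩)
        · exact .inl (.inl ⟨l, k, h, by rw [Pi.single_neg]; abel⟩)
      · rcases lt_or_gt_of_ne hkl with h | h
        · exact .inr (.inr (.inl ⟨k, l, h, by rw [Pi.single_neg, Pi.single_neg]; abel⟩))
        · exact .inr (.inr (.inl ⟨l, k, h, by rw [Pi.single_neg, Pi.single_neg]; abel⟩))
    · exact .inl (mem_posRoots.2 (.inr (.inr ⟨hs, i, h⟩)))
    · exact .inr (mem_posRoots.2 (.inr (.inr ⟨hs, i, by rw [← h, Pi.single_neg, neg_neg]⟩)))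

theorem sum_posRootsA :
    ∑ u ∈ posRootsA n, u = ∑ p : Fin n × Fin n with p.1 < p.2,
      (Pi.single p.1 1 - Pi.single p.2 1 : Fin n → ℤ) := by
  refine Finset.sum_image ?_
  rintro ⟨i, j⟩ hij ⟨k, l⟩ hkl h
  simp only [Finset.coe_filter, Finset.mem_univ, true_and, Set.mem_ofPred_eq] at hij hkl
  have h1 := congrFun h i
  have h2 := congrFun h j
  simp only [Pi.sub_apply, Pi.single_apply] at h1 h2
  have e1 : i ≠ j := hij.ne
  ext1 <;> simp only <;> split_ifs at h1 h2 <;> simp_all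

theorem sum_posRootsPlus :
    ∑ u ∈ posRootsPlus n, u = ∑ p : Fin n × Fin n with p.1 < p.2,
      (Pi.single p.1 1 + Pi.single p.2 1 : Fin n → ℤ) := by
  refine Finset.sum_image ?_
  rintro ⟨i, j⟩ hij ⟨k, l⟩ hkl h
  simp only [Finset.coe_filter, Finset.mem_univ, true_and, Set.mem_ofPred_eq] at hij hkl
  have h1 := congrFun h i
  have h2 := congrFun h j
  simp only [Pi.add_apply, Pi.single_apply] at h1 h2
  have e1 : i ≠ j := hij.ne
  have e2 : k ≠ l := hkl.ne
  have h3 : i = k ∨ i = l := by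
    by_contra! hc
    simp [e1, hc.1, hc.2] at h1
  have h4 : j = k ∨ j = l := by
    by_contra! hc
    simp [e1.symm, hc.1, hc.2] at h2
  rcases h3 with rfl | rfl <;> rcases h4 with rfl | rfl
  · exact absurd rfl e1
  · rfl
  · exact absurd (hij.trans hkl) (lt_irrefl _)
  · exact absurd rfl e1

theorem sum_posRootsShort (s : ℤ) : ∑ u ∈ posRootsShort n s, u = fun _ => s := by
  unfold posRootsShort
  split_ifs with h
  · subst h
    rfl
  · rw [Finset.sum_image fun i _ j _ h' => by
      by_contra hij
      have h1 := congrFun h' i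
      simp only [Pi.single_eq_same, Pi.single_eq_of_ne hij] at h1
      exact h h1]
    ext k
    simp [Finset.sum_apply, Pi.single_apply]

/-- The sum of the positive roots of type `B`, `C`, `D`. -/
theorem sum_posRoots {s : ℤ} (hs : s * s ≠ 2) :
    ∑ u ∈ posRoots n s, u = fun k : Fin n => 2 * ((n : ℤ) - 1 - k) + s := by
  have hd1 : Disjoint (posRootsA n) (posRootsPlus n) := by
    rw [Finset.disjoint_left]
    intro u h1 h2
    obtain ⟨i, j, hij, rfl⟩ := mem_posRootsA.1 h1
    obtain ⟨k, l, hkl, h⟩ := mem_posRootsPlus.1 h2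
    have := congrArg (fun u : Fin n → ℤ => u ⬝ᵥ 1) h
    simp [add_dotProduct, sub_dotProduct] at this
  -- The vector s ε_i has norm s², so `hs` separates it from the roots of norm 2.
  have hd2 : Disjoint (posRootsA n ∪ posRootsPlus n) (posRootsShort n s) := by
    rw [Finset.disjoint_left]
    intro u h1 h2
    obtain ⟨-, i, rfl⟩ := mem_posRootsShort.1 h2
    have h3 : (Pi.single i s : Fin n → ℤ) ⬝ᵥ Pi.single i s = 2 := by
      rcases Finset.mem_union.1 h1 with h | h
      · obtain ⟨i, j, hij, h⟩ := mem_posRootsA.1 h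
        rw [← h, single_sub_single_dotProduct_self hij.ne]
      · obtain ⟨i, j, hij, h⟩ := mem_posRootsPlus.1 h
        rw [← h, single_add_single_dotProduct_self hij.ne]
    simp at h3
    exact hs h3
  rw [posRoots, Finset.sum_union hd2, Finset.sum_union hd1, sum_posRootsA, sum_posRootsPlus,
    sum_posRootsShort, ← Finset.sum_add_distrib]
  ext k
  rw [Pi.add_apply, Finset.sum_apply]
  congr 1
  -- A pair i < j contributes (ε_i - ε_j) + (ε_i + ε_j) = 2 ε_i.
  have h1 : ∀ p : Fin n × Fin n, ((Pi.single p.1 1 - Pi.single p.2 1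
      + (Pi.single p.1 1 + Pi.single p.2 1) : Fin n → ℤ)) k = if p.1 = k then 2 else 0 := by
    intro p
    simp only [Pi.add_apply, Pi.sub_apply, Pi.single_apply, eq_comm (a := k)]
    split_ifs <;> rfl
  rw [Finset.sum_congr rfl fun p _ => h1 p, ← Finset.sum_filter, Finset.sum_const,
    Finset.filter_filter]
  have h2 : (Finset.univ.filter fun p : Fin n × Fin n => p.1 < p.2 ∧ p.1 = k)
      = (Finset.Ioi k).map ⟨fun j => (k, j), fun a b h => congrArg Prod.snd h⟩ := by
    ext ⟨i, j⟩
    simp only [Finset.mem_filter, Finset.mem_univ, true_and, Finset.mem_map, Finset.mem_Ioi]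
    constructor
    · rintro ⟨h, rfl⟩; exact ⟨j, h, rfl⟩
    · rintro ⟨_, h, e⟩
      cases e
      exact ⟨h, rfl⟩
  rw [h2, Finset.card_map, Fin.card_Ioi, nsmul_eq_mul]
  have := k.2
  push_cast [Nat.cast_sub (show (k : ℕ) ≤ n - 1 by omega), Nat.cast_sub (show 1 ≤ n by omega)]
  ring

end PosRoots

/-! ### Nonnegative combinations of the simple roots -/

section NonnegComb

variable {n m : ℕ} {v : Fin n → Fin m → ℤ}

/-- `u` is a nonnegative integer combination of the simple roots. -/
def IsNonnegComb (v : Fin n → Fin m → ℤ) (u : Fin m → ℤ) : Prop := ∃ b, 0 ≤ b ∧ comb v b = u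

theorem IsNonnegComb.add {u u' : Fin m → ℤ} (h : IsNonnegComb v u) (h' : IsNonnegComb v u') :
    IsNonnegComb v (u + u') := by
  obtain ⟨b, hb, rfl⟩ := h
  obtain ⟨b', hb', rfl⟩ := h'
  exact ⟨b + b', add_nonneg hb hb', comb_add v b b'⟩

theorem isNonnegComb_single (i : Fin n) : IsNonnegComb v (v i) :=
  ⟨Pi.single i 1, Pi.single_nonneg.2 zero_le_one, comb_single v i⟩

theorem isNonnegComb_sub
    (hv : ∀ (k : ℕ) (h : k + 1 < m),
      IsNonnegComb v (Pi.single ⟨k, Nat.lt_of_succ_lt h⟩ 1 - Pi.single ⟨k + 1, h⟩ 1))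
    {i j : Fin m} (hij : i ≤ j) : IsNonnegComb v (Pi.single i 1 - Pi.single j 1) := by
  obtain ⟨i, hi⟩ := i
  obtain ⟨j, hj⟩ := j
  rw [Fin.mk_le_mk] at hij
  induction j, hij using Nat.le_induction with
  | base => exact ⟨0, le_rfl, by rw [comb_zero, sub_self]⟩
  | succ j hj' ih =>
    have := (ih (Nat.lt_of_succ_lt hj)).add (hv j hj)
    rwa [sub_add_sub_cancel] at this

end NonnegComb

/-! ### Lifting values of the simple roots to the torus -/

section Lifting

variable {F : Type*} [Field F] {m : ℕ}

/-- The element of the torus with the coordinates `∏_{j ≥ k} g_j`. -/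
def tailProd (g : Fin m → Fˣ) (k : Fin m) : Fˣ := ∏ j ∈ Finset.Ici k, g j

theorem tailProd_eq (g : Fin m → Fˣ) (k : ℕ) (h : k + 1 < m) :
    tailProd g ⟨k, Nat.lt_of_succ_lt h⟩ = g ⟨k, Nat.lt_of_succ_lt h⟩ * tailProd g ⟨k + 1, h⟩ := by
  unfold tailProd
  have h1 : Finset.Ici (⟨k, Nat.lt_of_succ_lt h⟩ : Fin m)
      = insert ⟨k, Nat.lt_of_succ_lt h⟩ (Finset.Ici ⟨k + 1, h⟩) := by
    ext j
    simp only [Finset.mem_Ici, Finset.mem_insert, Fin.le_def, Fin.ext_iff]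
    omega
  rw [h1, Finset.prod_insert]
  simp

theorem tailProd_last (g : Fin m → Fˣ) {k : Fin m} (h : (k : ℕ) + 1 = m) :
    tailProd g k = g k := by
  unfold tailProd
  have h1 : Finset.Ici k = {k} := by
    ext j
    have := j.2
    simp only [Finset.mem_Ici, Finset.mem_singleton, Fin.le_def, Fin.ext_iff]
    omega
  rw [h1, Finset.prod_singleton]

/-- The tail products solve t_k / t_{k+1} = g_k; the last entry of g is free and becomes the last
coordinate. -/
theorem chi_tailProd_sub (g : Fin m → Fˣ) (k : ℕ) (h : k + 1 < m) :
    chi (tailProd g) (Pi.single ⟨k, Nat.lt_of_succ_lt h⟩ 1 - Pi.single ⟨k + 1, h⟩ 1)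
      = g ⟨k, Nat.lt_of_succ_lt h⟩ := by
  rw [chi_sub, chi_single, chi_single, zpow_one, zpow_one, tailProd_eq g k h, mul_div_cancel_right]

end Lifting

/-! ### The centralizer as a subgroup of the torus -/

theorem IsRootDatum.mem_centralizer_iff {K : Type*} [Field K] {ι : Type*} [Fintype ι]
    [DecidableEq ι] {L : LieSubalgebra K (Matrix ι ι K)} {n m : ℕ} {d : Fin m → ι}
    {v : Fin n → Fin m → ℤ} {w : ι → Fin m → ℤ} {P : Finset (Fin m → ℤ)}
    (R : IsRootDatum L d v w P) {T : AdmissibleTriple v}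
    (hpush : ∀ a, IsRoot L d v a → T.InSpan a → IsRoot L d v (T.push a))
    {r : Matrix ι ι K ⊗[K] Matrix ι ι K} (hr : IsBDMatrix L d T r) {G : Subgroup (GL ι K)}
    (hG : ∀ t, torus w t ∈ G)
    (htorus : ∀ X ∈ G, adTensor X r = r → ∃ t, torus w t = X) (X : GL ι K) :
    X ∈ centralizer G r ↔ ∃ t ∈ T.torusSubgroup K, torus w t = X := by
  constructor
  · rintro ⟨hX, hXr⟩
    obtain ⟨t, rfl⟩ := htorus X hX hXr
    exact ⟨t, R.chi_eq_of_adTensor_torus_eq hpush hr t hXr, rfl⟩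
  · rintro ⟨t, ht, rfl⟩
    exact ⟨hG t, R.adTensor_torus_eq hpush hr t ht⟩

theorem det_eq_one_of_mem {K : Type*} [Field K] {ι : Type*} [Fintype ι] [DecidableEq ι]
    {J : Matrix ι ι K} {X : GL ι K} (hX : X ∈ specialIsometryGroup J) :
    (X : Matrix ι ι K).det = 1 :=
  congrArg Units.val (show Matrix.GeneralLinearGroup.det X = 1 from hX.2)

/-! ### Weights of the standard representation -/

/-- The weights of the standard representation of type `C_n` and `D_n`. -/
def stdWeight (n : ℕ) : Fin n ⊕ Fin n → Fin n → ℤ :=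
  Sum.elim (fun i => Pi.single i 1) (fun i => -Pi.single i 1)

theorem stdWeight_swap {n : ℕ} (p : Fin n ⊕ Fin n) : stdWeight n p.swap = -stdWeight n p := by
  cases p <;> simp [stdWeight]

theorem single_injective {n : ℕ} {i j : Fin n}
    (h : (Pi.single i 1 : Fin n → ℤ) = Pi.single j 1) : i = j := by
  by_contra hij
  have h1 := congrFun h i
  simp only [Pi.single_eq_same, Pi.single_eq_of_ne hij] at h1
  exact one_ne_zero h1

theorem single_ne_neg_single {n : ℕ} (i j : Fin n) :
    (Pi.single i 1 : Fin n → ℤ) ≠ -Pi.single j 1 := by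
  intro h
  have h1 := congrFun h i
  simp only [Pi.single_eq_same, Pi.neg_apply, Pi.single_apply] at h1
  split_ifs at h1; all_goals omega

theorem stdWeight_injective (n : ℕ) : Function.Injective (stdWeight n) := by
  rintro (i | i) (j | j) h
  · rw [single_injective h]
  · exact absurd h (single_ne_neg_single i j)
  · exact absurd h.symm (single_ne_neg_single j i)
  · rw [single_injective (neg_injective h)]

theorem stdWeight_ne_zero {n : ℕ} (p : Fin n ⊕ Fin n) : stdWeight n p ≠ 0 := by
  rcases p with i | i <;> simp [stdWeight]

/-! ### Type `D_n` -/

theorem sub_one_lt_of_three_le {n : ℕ} (hn : 3 ≤ n) : n - 1 < n := by omega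

theorem sub_two_lt_of_three_le {n : ℕ} (hn : 3 ≤ n) : n - 2 < n := by omega

section TypeD

variable {n : ℕ} (K : Type*) [Field K]

theorem JD_eq_monomialForm : LieAlgebra.Orthogonal.JD (Fin n) K =
    monomialForm Sum.swap (fun _ => 1) := by
  ext (i | i) (j | j) <;>
    simp [LieAlgebra.Orthogonal.JD, monomialForm, Matrix.one_apply, eq_comm]

theorem typeD_eq : LieAlgebra.Orthogonal.typeD (Fin n) K =
    skewAdjointMatricesLieSubalgebra (monomialForm Sum.swap (fun _ => 1)) := by
  rw [← JD_eq_monomialForm]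
  rfl

theorem SOeven_eq : SOeven n K = specialIsometryGroup (monomialForm Sum.swap (fun _ => 1)) := by
  rw [← JD_eq_monomialForm]
  rfl

variable {K} in
theorem isFormDatum_D :
    IsFormDatum (K := K) Sum.swap (fun _ => 1) 1 (stdWeight n) Sum.inl where
  bar_bar := Sum.swap_swap
  form_ne_zero _ := one_ne_zero
  form_bar _ := by simp
  weight_bar := stdWeight_swap
  weight_injective := stdWeight_injective n
  weight_d _ := rfl
  cases p := by
    rcases p with i | i
    · exact .inl ⟨i, rfl⟩
    · exact .inr (.inl ⟨i, rfl⟩)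

theorem simpleRootsD_of_lt (k : ℕ) (h : k + 1 < n) :
    simpleRootsD n ⟨k, Nat.lt_of_succ_lt h⟩
      = Pi.single ⟨k, Nat.lt_of_succ_lt h⟩ 1 - Pi.single ⟨k + 1, h⟩ 1 := by
  simp [simpleRootsD, h]

theorem simpleRootsD_last (hn : 3 ≤ n) :
    simpleRootsD n ⟨n - 1, sub_one_lt_of_three_le hn⟩
      = Pi.single ⟨n - 2, sub_two_lt_of_three_le hn⟩ 1 + Pi.single ⟨n - 1, sub_one_lt_of_three_le hn⟩ 1 := by
  have h : ¬ (n - 1 + 1 < n) := by omega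
  simp only [simpleRootsD, h, dite_false]
  rfl

theorem eq_last_of_not_lt {i : Fin n} (h : ¬ (i : ℕ) + 1 < n) (h' : n - 1 < n) :
    i = ⟨n - 1, h'⟩ := by
  ext
  have := i.2
  simp only
  omega

theorem comb_simpleRootsD_injective (hn : 3 ≤ n) :
    Function.Injective (comb (simpleRootsD n)) := by
  -- Multiples of the fundamental coweights: (1, …, 1) and (1, …, 1, -1) for the two end nodes, each
  -- pairing to 2 with its root, and ε_1 + … + ε_i otherwise.
  refine comb_injective_of_dual _ (fun i k => if (i : ℕ) + 1 = n then 1 else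
    if (i : ℕ) + 2 = n then (if (k : ℕ) + 1 = n then -1 else 1) else if k ≤ i then 1 else 0) ?_
  intro i j
  have hi := i.2
  have hj := j.2
  by_cases h : (j : ℕ) + 1 < n
  · rw [show simpleRootsD n j = _ from simpleRootsD_of_lt j h]
    simp only [sub_dotProduct, single_dotProduct, one_mul, Fin.le_def, Fin.ext_iff]
    split_ifs <;> omega
  · rw [eq_last_of_not_lt h (by omega), simpleRootsD_last hn]
    simp only [add_dotProduct, single_dotProduct, one_mul, Fin.le_def, Fin.ext_iff]
    split_ifs <;> omega

theorem isNonnegComb_posRoots_D (hn : 3 ≤ n) (u : Fin n → ℤ) (hu : u ∈ posRoots n 0) :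
    IsNonnegComb (simpleRootsD n) u := by
  have hsub : ∀ {i j : Fin n}, i ≤ j →
      IsNonnegComb (simpleRootsD n) (Pi.single i 1 - Pi.single j 1) := by
    refine isNonnegComb_sub fun k h => ?_
    rw [← simpleRootsD_of_lt]
    exact isNonnegComb_single _
  rcases mem_posRoots.1 hu with ⟨i, j, hij, rfl⟩ | ⟨i, j, hij, rfl⟩ | ⟨h, -⟩
  · exact hsub hij.le
  · have h1 := isNonnegComb_single (v := simpleRootsD n) ⟨n - 1, sub_one_lt_of_three_le hn⟩
    rw [simpleRootsD_last hn] at h1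
    have hij' : (i : ℕ) < j := hij
    have hj := j.2
    -- ε_i + ε_j = (ε_i - ε_{n-1}) + (ε_j - ε_n) + (ε_{n-1} + ε_n).
    have h2 := ((hsub (i := i) (j := ⟨n - 2, sub_two_lt_of_three_le hn⟩) (Fin.le_def.2 (by simp only; omega))).add
      (hsub (i := j) (j := ⟨n - 1, sub_one_lt_of_three_le hn⟩) (Fin.le_def.2 (by simp only; omega)))).add h1
    convert h2 using 1
    abel
  · exact absurd rfl h

variable [CharZero K]

theorem isRootDatum_D (hn : 3 ≤ n) : IsRootDatum (LieAlgebra.Orthogonal.typeD (Fin n) K) Sum.inl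
    (simpleRootsD n) (stdWeight n) (posRoots n 0) := by
  rw [typeD_eq]
  refine isFormDatum_D.isRootDatum (comb_simpleRootsD_injective hn) (isNonnegComb_posRoots_D hn)
    (zero_notMem_posRoots 0) (fun u => ?_) fun i => ?_
  · rw [mem_posRoots_or_neg_mem_iff]
    constructor
    · rintro ⟨hu, i | i, j | j, rfl, h⟩ <;> left
      · have hij : i ≠ j := by rintro rfl; simp at hu
        simpa [stdWeight] using single_sub_single_dotProduct_self hij
      · have hij : i ≠ j := by rintro rfl; simp at h
        simpa [stdWeight] using single_add_single_dotProduct_self hij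
      · have hij : i ≠ j := by rintro rfl; simp at h
        have := single_add_single_dotProduct_self hij
        rw [show stdWeight n (Sum.inr i) - stdWeight n (Sum.inl j)
          = -(Pi.single i 1 + Pi.single j 1) by simp [stdWeight]; abel, neg_dotProduct_neg]
        exact this
      · have hij : j ≠ i := by rintro rfl; simp at hu
        have := single_sub_single_dotProduct_self hij
        rw [show stdWeight n (Sum.inr i) - stdWeight n (Sum.inr j)
          = (Pi.single j 1 - Pi.single i 1) by simp [stdWeight]; abel]
        exact this
    · rintro (h | ⟨h, -⟩)
      · refine ⟨by rintro rfl; simp at h, ?_⟩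
        obtain ⟨k, l, hkl, x, y, rfl | rfl, rfl | rfl, rfl⟩ := eq_add_of_dotProduct_self_eq_two h
        · exact ⟨Sum.inl k, Sum.inr l, by simp [stdWeight], fun _ => by simpa using hkl.symm⟩
        · exact ⟨Sum.inl k, Sum.inl l, by simp [stdWeight, Pi.single_neg, sub_eq_add_neg],
            fun _ => by simp⟩
        · exact ⟨Sum.inr k, Sum.inr l, by simp [stdWeight, Pi.single_neg], fun _ => by simp⟩
        · exact ⟨Sum.inr k, Sum.inl l, by simp [stdWeight, Pi.single_neg, sub_eq_add_neg],
            fun _ => by simpa using hkl.symm⟩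
      · exact absurd rfl h
  · rw [mem_posRoots]
    by_cases h : (i : ℕ) + 1 < n
    · exact .inl ⟨i, ⟨i + 1, h⟩, Fin.lt_def.2 (Nat.lt_succ_self _), (simpleRootsD_of_lt i h).symm⟩
    · rw [eq_last_of_not_lt h (by omega), simpleRootsD_last hn]
      exact .inr (.inl ⟨_, _, Fin.lt_def.2 (by simp only; omega), rfl⟩)

/-- The roots of type D are exactly the integer vectors of norm 2, and τ preserves norms. -/
theorem isRoot_push_D (hn : 3 ≤ n) (T : AdmissibleTriple (simpleRootsD n)) (a : Fin n → ℤ)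
    (ha : IsRoot (LieAlgebra.Orthogonal.typeD (Fin n) K) Sum.inl (simpleRootsD n) a)
    (hs : T.InSpan a) :
    IsRoot (LieAlgebra.Orthogonal.typeD (Fin n) K) Sum.inl (simpleRootsD n) (T.push a) := by
  rw [(isRootDatum_D K hn).isRoot_iff, mem_posRoots_or_neg_mem_iff] at ha ⊢
  rw [comb_push_dotProduct_self _ T hs]
  rcases ha with h | ⟨h, -⟩
  · exact .inl h
  · exact absurd rfl h

variable {K}

/-- The coordinates 2(n - 1 - k) of 2ρ vanish at the last index, so a 2 × 2 block with rows (a, b)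
and (c, d) survives on the weights ε_n and -ε_n. The form gives ac = bd = 0 and ad + bc = 1, so the
block is diagonal or antidiagonal; the second case has determinant -1. -/
theorem SOeven_exists_torus (hn : 3 ≤ n) {T : AdmissibleTriple (simpleRootsD n)}
    {r : Matrix (Fin n ⊕ Fin n) (Fin n ⊕ Fin n) K ⊗[K] Matrix (Fin n ⊕ Fin n) (Fin n ⊕ Fin n) K}
    (hr : IsBDMatrix (LieAlgebra.Orthogonal.typeD (Fin n) K) Sum.inl T r)
    (X : GL (Fin n ⊕ Fin n) K) (hX : X ∈ SOeven n K) (hXr : adTensor X r = r) :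
    ∃ t, torus (stdWeight n) t = X := by
  have R := isRootDatum_D K hn
  have hpush := isRoot_push_D K hn T
  have hdet : X.1.det = 1 := det_eq_one_of_mem hX
  rw [typeD_eq] at R hr
  simp only [typeD_eq] at hpush
  rw [SOeven_eq] at hX
  set N : Fin n := ⟨n - 1, sub_one_lt_of_three_le hn⟩ with hN
  have hzero : ∀ p q, X.1 p q ≠ 0 →
      p = q ∨ (p = Sum.inl N ∧ q = Sum.inr N) ∨ (p = Sum.inr N ∧ q = Sum.inl N) := by
    intro p q hpq
    have h := isFormDatum_D.dotProduct_sum_eq R hpush hr hXr hpq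
    rw [sum_posRoots (by norm_num)] at h
    rcases p with i | i <;> rcases q with j | j <;> have hi := i.2 <;> have hj := j.2 <;>
      simp only [stdWeight, Sum.elim_inl, Sum.elim_inr, neg_dotProduct, single_dotProduct] at h <;>
      simp only [Sum.inl.injEq, Sum.inr.injEq, reduceCtorEq, false_and, and_false, or_false,
        false_or, hN, Fin.ext_iff] <;> omega
  have hiso := (mem_isometryGroup_iff (K := K) Sum.swap_swap X).1 hX.1
  have hNN : (Sum.inl N : Fin n ⊕ Fin n) ≠ Sum.inr N := by simp
  have hcol : ∀ l, l ≠ Sum.inl N ∧ l ≠ Sum.inr N →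
      X.1 l (Sum.inl N) = 0 ∧ X.1 l (Sum.inr N) = 0 := by
    rintro l ⟨h1, h2⟩
    constructor
    · by_contra h
      rcases hzero _ _ h with h | ⟨h, -⟩ | ⟨h, -⟩
      exacts [h1 h, h1 h, h2 h]
    · by_contra h
      rcases hzero _ _ h with h | ⟨h, -⟩ | ⟨h, -⟩
      exacts [h2 h, h1 h, h2 h]
  have hac := hiso (Sum.inl N) (Sum.inl N)
  have hbd := hiso (Sum.inr N) (Sum.inr N)
  have habcd := hiso (Sum.inl N) (Sum.inr N)
  rw [Fintype.sum_eq_add _ _ hNN fun l hl => by rw [(hcol l hl).1, zero_mul, zero_mul]]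
    at hac habcd
  rw [Fintype.sum_eq_add _ _ hNN fun l hl => by rw [(hcol l hl).2, zero_mul, zero_mul]] at hbd
  simp only [Sum.swap_inl, Sum.swap_inr, mul_one, if_true, hNN, hNN.symm, if_false] at hac hbd habcd
  by_cases ha : X.1 (Sum.inl N) (Sum.inl N) = 0
  · exfalso
    rw [ha, zero_mul, zero_add] at habcd
    have hd : X.1 (Sum.inr N) (Sum.inr N) = 0 := by
      have h1 : X.1 (Sum.inl N) (Sum.inr N) ≠ 0 :=
        right_ne_zero_of_mul_eq_one habcd
      have h2 : 2 * (X.1 (Sum.inl N) (Sum.inr N) *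
        X.1 (Sum.inr N) (Sum.inr N)) = 0 := by linear_combination hbd
      simpa [h1] using h2
    -- Exchanging the two columns of the block makes X diagonal, with the entries of each hyperbolic
    -- pair multiplying to 1; undoing the exchange gives determinant -1.
    set s : Equiv.Perm (Fin n ⊕ Fin n) := Equiv.swap (Sum.inl N) (Sum.inr N) with hs
    have hsub : (X.1.submatrix id s).IsDiag := by
      intro p q hpq
      rw [Matrix.submatrix_apply, id]
      by_contra h
      by_cases h1 : q = Sum.inl N
      · rw [h1, hs, Equiv.swap_apply_left] at h
        rcases hzero _ _ h with h2 | ⟨h2, -⟩ | ⟨-, h2⟩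
        · rw [h2] at h; exact h hd
        · exact hpq (h2.trans h1.symm)
        · exact hNN h2.symm
      · by_cases h2 : q = Sum.inr N
        · rw [h2, hs, Equiv.swap_apply_right] at h
          rcases hzero _ _ h with h3 | ⟨-, h3⟩ | ⟨h3, -⟩
          · rw [h3] at h; exact h ha
          · exact hNN h3
          · exact hpq (h3.trans h2.symm)
        · rw [hs, Equiv.swap_apply_of_ne_of_ne h1 h2] at h
          rcases hzero _ _ h with h3 | ⟨-, h3⟩ | ⟨-, h3⟩
          exacts [hpq h3, h2 h3, h1 h3]
    have hdet' := Matrix.det_permute' s X.1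
    have hsign : Equiv.Perm.sign s = -1 := Equiv.Perm.sign_swap hNN
    rw [hdet, hsign, ← hsub.diagonal_diag, Matrix.det_diagonal, Fintype.prod_sum_type,
      ← Finset.prod_mul_distrib] at hdet'
    have hprod : ∏ k, ((X.1.submatrix id s).diag (Sum.inl k) *
        (X.1.submatrix id s).diag (Sum.inr k)) = 1 := by
      refine Finset.prod_eq_one fun k _ => ?_
      simp only [Matrix.diag_apply, Matrix.submatrix_apply, id]
      by_cases hk : k = N
      · subst hk
        rw [hs, Equiv.swap_apply_left, Equiv.swap_apply_right]
        linear_combination habcd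
      · have h1 : (Sum.inl k : Fin n ⊕ Fin n) ≠ Sum.inl N := by simpa using hk
        have h2 : (Sum.inr k : Fin n ⊕ Fin n) ≠ Sum.inr N := by simpa using hk
        rw [hs, Equiv.swap_apply_of_ne_of_ne h1 (by simp),
          Equiv.swap_apply_of_ne_of_ne (by simp) h2]
        have h3 := hiso (Sum.inl k) (Sum.inr k)
        rw [Finset.sum_eq_single (Sum.inl k)] at h3
        · simpa using h3
        · intro l _ hl
          have : X.1 l (Sum.inl k) = 0 := by
            by_contra h
            rcases hzero _ _ h with h3 | ⟨-, h3⟩ | ⟨-, h3⟩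
            · exact hl h3
            · simp at h3
            · exact h1 h3
          rw [this, zero_mul, zero_mul]
        · simp
    rw [hprod] at hdet'
    have h2 : (2 : K) = 0 := by
      simp only [Units.val_neg, Units.val_one, Int.cast_neg, Int.cast_one, mul_one] at hdet'
      linear_combination hdet'
    exact two_ne_zero h2
  · have hc : X.1 (Sum.inr N) (Sum.inl N) = 0 := by
      have h2 : 2 * (X.1 (Sum.inl N) (Sum.inl N) *
        X.1 (Sum.inr N) (Sum.inl N)) = 0 := by linear_combination hac
      simpa [ha] using h2
    have hd : X.1 (Sum.inr N) (Sum.inr N) ≠ 0 := by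
      rw [hc, zero_mul, add_zero] at habcd
      exact right_ne_zero_of_mul_eq_one habcd
    have hb : X.1 (Sum.inl N) (Sum.inr N) = 0 := by
      have h2 : 2 * (X.1 (Sum.inl N) (Sum.inr N) *
        X.1 (Sum.inr N) (Sum.inr N)) = 0 := by linear_combination hbd
      simpa [hd] using h2
    refine isFormDatum_D.exists_torus_eq hX.1 (fun p q hpq => ?_) fun p hp => ?_
    · by_contra h
      rcases hzero _ _ h with h1 | ⟨rfl, rfl⟩ | ⟨rfl, rfl⟩
      exacts [hpq h1, h hb, h hc]
    · rcases p with i | i <;> simp at hp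

omit [CharZero K] in
theorem torus_mem_SOeven (t : Fin n → Kˣ) : torus (stdWeight n) t ∈ SOeven n K := by
  rw [SOeven_eq]
  exact isFormDatum_D.torus_mem_specialIsometryGroup t

theorem mem_centralizer_SOeven_iff (hn : 3 ≤ n) {T : AdmissibleTriple (simpleRootsD n)}
    {r : Matrix (Fin n ⊕ Fin n) (Fin n ⊕ Fin n) K ⊗[K] Matrix (Fin n ⊕ Fin n) (Fin n ⊕ Fin n) K}
    (hr : IsBDMatrix (LieAlgebra.Orthogonal.typeD (Fin n) K) Sum.inl T r)
    (X : GL (Fin n ⊕ Fin n) K) :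
    X ∈ centralizer (SOeven n K) r ↔ ∃ t ∈ T.torusSubgroup K, torus (stdWeight n) t = X :=
  (isRootDatum_D K hn).mem_centralizer_iff (isRoot_push_D K hn T) hr torus_mem_SOeven
    (SOeven_exists_torus hn hr) X

end TypeD

/-! ### Type `B_n` -/

section TypeB

variable {n : ℕ} (K : Type*) [Field K]

/-- The involution on the standard basis of type `B_n`. -/
def barB (n : ℕ) : Unit ⊕ Fin n ⊕ Fin n → Unit ⊕ Fin n ⊕ Fin n := Sum.map id Sum.swap

/-- The entries of the form of type `B_n`. -/
def formB (n : ℕ) : Unit ⊕ Fin n ⊕ Fin n → K := Sum.elim (fun _ => 2) (fun _ => 1)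

/-- The weights of the standard representation of type `B_n`. -/
def weightB (n : ℕ) : Unit ⊕ Fin n ⊕ Fin n → Fin n → ℤ := Sum.elim (fun _ => 0) (stdWeight n)

theorem JB_eq_monomialForm : LieAlgebra.Orthogonal.JB (Fin n) K =
    monomialForm (barB n) (formB K n) := by
  ext (i | i | i) (j | j | j) <;>
    simp [LieAlgebra.Orthogonal.JB, LieAlgebra.Orthogonal.JD, monomialForm, Matrix.one_apply,
      eq_comm, barB, formB]

theorem typeB_eq : LieAlgebra.Orthogonal.typeB (Fin n) K =
    skewAdjointMatricesLieSubalgebra (monomialForm (barB n) (formB K n)) := by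
  rw [← JB_eq_monomialForm]
  rfl

theorem SOodd_eq : SOodd n K = specialIsometryGroup (monomialForm (barB n) (formB K n)) := by
  rw [← JB_eq_monomialForm]
  rfl

variable {K} in
theorem isFormDatum_B [CharZero K] :
    IsFormDatum (K := K) (barB n) (formB K n) 1 (weightB n) (Sum.inr ∘ Sum.inl) where
  bar_bar p := by rcases p with i | i | i <;> rfl
  form_ne_zero p := by rcases p with i | i <;> simp [formB]
  form_bar p := by rcases p with i | i <;> simp [formB, barB]
  weight_bar p := by
    rcases p with i | i
    · simp [weightB, barB]
    · exact stdWeight_swap i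
  weight_injective := by
    rintro (i | i) (j | j) h
    · rfl
    · exact absurd h.symm (stdWeight_ne_zero j)
    · exact absurd h (stdWeight_ne_zero i)
    · rw [stdWeight_injective n h]
  weight_d _ := rfl
  cases p := by
    rcases p with i | i | i
    · exact .inr (.inr rfl)
    · exact .inl ⟨i, rfl⟩
    · exact .inr (.inl ⟨i, rfl⟩)

theorem simpleRootsB_of_lt (k : ℕ) (h : k + 1 < n) :
    simpleRootsB n ⟨k, Nat.lt_of_succ_lt h⟩
      = Pi.single ⟨k, Nat.lt_of_succ_lt h⟩ 1 - Pi.single ⟨k + 1, h⟩ 1 := by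
  simp [simpleRootsB, h]

theorem simpleRootsB_last {i : Fin n} (h : ¬ (i : ℕ) + 1 < n) :
    simpleRootsB n i = Pi.single i 1 := by
  simp [simpleRootsB, h]

theorem comb_simpleRootsB_injective : Function.Injective (comb (simpleRootsB n)) := by
  refine comb_injective_of_dual _ (fun i k => if k ≤ i then 1 else 0) ?_
  intro i j
  have hi := i.2
  have hj := j.2
  by_cases h : (j : ℕ) + 1 < n
  · rw [show simpleRootsB n j = _ from simpleRootsB_of_lt j h]
    simp only [sub_dotProduct, single_dotProduct, one_mul, Fin.le_def, Fin.ext_iff]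
    split_ifs <;> omega
  · rw [simpleRootsB_last h]
    simp only [single_dotProduct, one_mul, Fin.le_def, Fin.ext_iff]
    split_ifs <;> omega

theorem isNonnegComb_posRoots_B (u : Fin n → ℤ) (hu : u ∈ posRoots n 1) :
    IsNonnegComb (simpleRootsB n) u := by
  have hsub : ∀ {i j : Fin n}, i ≤ j →
      IsNonnegComb (simpleRootsB n) (Pi.single i 1 - Pi.single j 1) := by
    refine isNonnegComb_sub fun k h => ?_
    rw [← simpleRootsB_of_lt]
    exact isNonnegComb_single _
  have hshort : ∀ i : Fin n, IsNonnegComb (simpleRootsB n) (Pi.single i 1) := by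
    intro i
    have hi := i.2
    have h1 := isNonnegComb_single (v := simpleRootsB n) ⟨n - 1, by omega⟩
    rw [simpleRootsB_last (by simp only; omega)] at h1
    have h2 := (hsub (i := i) (j := ⟨n - 1, by omega⟩) (Fin.le_def.2 (by simp only; omega))).add h1
    rwa [sub_add_cancel] at h2
  rcases mem_posRoots.1 hu with ⟨i, j, hij, rfl⟩ | ⟨i, j, hij, rfl⟩ | ⟨-, i, rfl⟩
  · exact hsub hij.le
  · exact (hshort i).add (hshort j)
  · exact hshort i

variable [CharZero K]

theorem isRootDatum_B : IsRootDatum (LieAlgebra.Orthogonal.typeB (Fin n) K) (Sum.inr ∘ Sum.inl)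
    (simpleRootsB n) (weightB n) (posRoots n 1) := by
  rw [typeB_eq]
  refine isFormDatum_B.isRootDatum comb_simpleRootsB_injective isNonnegComb_posRoots_B
    (zero_notMem_posRoots 1) (fun u => ?_) fun i => ?_
  · rw [mem_posRoots_or_neg_mem_iff]
    constructor
    · rintro ⟨hu, i | i | i, j | j | j, rfl, h⟩
      · simp [weightB] at hu
      · exact .inr ⟨one_ne_zero, j, .inr (by simp [weightB, stdWeight, Pi.single_neg])⟩
      · exact .inr ⟨one_ne_zero, j, .inl (by simp [weightB, stdWeight])⟩
      · exact .inr ⟨one_ne_zero, i, .inl (by simp [weightB, stdWeight])⟩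
      · have hij : i ≠ j := by rintro rfl; simp at hu
        exact .inl (by simpa [weightB, stdWeight] using single_sub_single_dotProduct_self hij)
      · have hij : i ≠ j := by rintro rfl; simp [barB] at h
        exact .inl (by simpa [weightB, stdWeight] using single_add_single_dotProduct_self hij)
      · exact .inr ⟨one_ne_zero, i, .inr (by simp [weightB, stdWeight, Pi.single_neg])⟩
      · have hij : i ≠ j := by rintro rfl; simp [barB] at h
        have := single_add_single_dotProduct_self hij
        rw [show weightB n (Sum.inr (Sum.inr i)) - weightB n (Sum.inr (Sum.inl j))
          = -(Pi.single i 1 + Pi.single j 1) by simp [weightB, stdWeight]; abel,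
          neg_dotProduct_neg]
        exact .inl this
      · have hij : j ≠ i := by rintro rfl; simp at hu
        have := single_sub_single_dotProduct_self hij
        rw [show weightB n (Sum.inr (Sum.inr i)) - weightB n (Sum.inr (Sum.inr j))
          = (Pi.single j 1 - Pi.single i 1) by simp [weightB, stdWeight]; abel]
        exact .inl this
    · rintro (h | ⟨-, i, rfl | rfl⟩)
      · refine ⟨by rintro rfl; simp at h, ?_⟩
        obtain ⟨k, l, hkl, x, y, rfl | rfl, rfl | rfl, rfl⟩ := eq_add_of_dotProduct_self_eq_two h
        · exact ⟨Sum.inr (Sum.inl k), Sum.inr (Sum.inr l), by simp [weightB, stdWeight],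
            fun _ => by simpa [barB] using hkl.symm⟩
        · exact ⟨Sum.inr (Sum.inl k), Sum.inr (Sum.inl l),
            by simp [weightB, stdWeight, Pi.single_neg, sub_eq_add_neg], fun _ => by simp [barB]⟩
        · exact ⟨Sum.inr (Sum.inr k), Sum.inr (Sum.inr l),
            by simp [weightB, stdWeight, Pi.single_neg], fun _ => by simp [barB]⟩
        · exact ⟨Sum.inr (Sum.inr k), Sum.inr (Sum.inl l),
            by simp [weightB, stdWeight, Pi.single_neg, sub_eq_add_neg],
            fun _ => by simpa [barB] using hkl.symm⟩
      · exact ⟨by simp, Sum.inr (Sum.inl i), Sum.inl (), by simp [weightB, stdWeight],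
          fun _ => by simp [barB]⟩
      · exact ⟨by simp, Sum.inl (), Sum.inr (Sum.inl i),
          by simp [weightB, stdWeight, Pi.single_neg], fun _ => by simp [barB]⟩
  · rw [mem_posRoots]
    by_cases h : (i : ℕ) + 1 < n
    · exact .inl ⟨i, ⟨i + 1, h⟩, Fin.lt_def.2 (Nat.lt_succ_self _), (simpleRootsB_of_lt i h).symm⟩
    · exact .inr (.inr ⟨one_ne_zero, i, (simpleRootsB_last h).symm⟩)

theorem single_or_neg_iff_dotProduct_self (u : Fin n → ℤ) :
    (∃ i, Pi.single i 1 = u ∨ Pi.single i (-1) = u) ↔ u ⬝ᵥ u = 1 := by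
  constructor
  · rintro ⟨i, rfl | rfl⟩ <;> simp
  · intro h
    obtain ⟨k, x, rfl | rfl, rfl⟩ := eq_single_of_dotProduct_self_eq_one h
    · exact ⟨k, .inl rfl⟩
    · exact ⟨k, .inr rfl⟩

/-- The roots of type B are the integer vectors of norm 1 or 2. -/
theorem isRoot_push_B (T : AdmissibleTriple (simpleRootsB n)) (a : Fin n → ℤ)
    (ha : IsRoot (LieAlgebra.Orthogonal.typeB (Fin n) K) (Sum.inr ∘ Sum.inl) (simpleRootsB n) a)
    (hs : T.InSpan a) :
    IsRoot (LieAlgebra.Orthogonal.typeB (Fin n) K) (Sum.inr ∘ Sum.inl) (simpleRootsB n)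
      (T.push a) := by
  rw [(isRootDatum_B K).isRoot_iff, mem_posRoots_or_neg_mem_iff,
    single_or_neg_iff_dotProduct_self] at ha ⊢
  rwa [comb_push_dotProduct_self _ T hs]

variable {K}

/-- The coordinates of 2ρ are distinct positive odd numbers, so 2ρ separates the weights 0 and ±ε_k
and X is diagonal. The determinant then fixes the entry of weight zero to be 1. -/
theorem SOodd_exists_torus {T : AdmissibleTriple (simpleRootsB n)}
    {r : Matrix (Unit ⊕ Fin n ⊕ Fin n) (Unit ⊕ Fin n ⊕ Fin n) K ⊗[K]
      Matrix (Unit ⊕ Fin n ⊕ Fin n) (Unit ⊕ Fin n ⊕ Fin n) K}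
    (hr : IsBDMatrix (LieAlgebra.Orthogonal.typeB (Fin n) K) (Sum.inr ∘ Sum.inl) T r)
    (X : GL (Unit ⊕ Fin n ⊕ Fin n) K) (hX : X ∈ SOodd n K) (hXr : adTensor X r = r) :
    ∃ t, torus (weightB n) t = X := by
  have R := isRootDatum_B (n := n) K
  have hpush := isRoot_push_B K T
  have hdet : X.1.det = 1 := det_eq_one_of_mem hX
  rw [typeB_eq] at R hr
  simp only [typeB_eq] at hpush
  rw [SOodd_eq] at hX
  have hdiag : X.1.IsDiag := by
    intro p q hpq
    by_contra h
    refine hpq ?_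
    have h := isFormDatum_B.dotProduct_sum_eq R hpush hr hXr h
    rw [sum_posRoots (by norm_num)] at h
    rcases p with i | i | i <;> rcases q with j | j | j <;> simp only [weightB, stdWeight,
      Sum.elim_inl, Sum.elim_inr, neg_dotProduct, single_dotProduct, zero_dotProduct] at h <;>
      first
        | rfl
        | (have hj := j.2
           simp only [Sum.inl.injEq, Sum.inr.injEq, reduceCtorEq, Fin.ext_iff]
           omega)
        | (have hi := i.2
           simp only [reduceCtorEq]
           omega)
  have hmul := isFormDatum_B.apply_mul_apply_bar hX.1 hdiag
  refine isFormDatum_B.exists_torus_eq hX.1 hdiag fun p hp => ?_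
  rcases p with ⟨⟩ | i | i
  · rw [← hdiag.diagonal_diag, Matrix.det_diagonal, Fintype.prod_sum_type, Fintype.prod_sum_type,
      ← Finset.prod_mul_distrib] at hdet
    have : ∏ i, (X.1.diag (Sum.inr (Sum.inl i)) * X.1.diag (Sum.inr (Sum.inr i))) = 1 :=
      Finset.prod_eq_one fun i _ => hmul (Sum.inr (Sum.inl i))
    rw [this, mul_one, Fintype.prod_unique] at hdet
    exact hdet
  · simp [barB] at hp
  · simp [barB] at hp

theorem torus_mem_SOodd (t : Fin n → Kˣ) : torus (weightB n) t ∈ SOodd n K := by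
  rw [SOodd_eq]
  exact isFormDatum_B.torus_mem_specialIsometryGroup t

theorem mem_centralizer_SOodd_iff {T : AdmissibleTriple (simpleRootsB n)}
    {r : Matrix (Unit ⊕ Fin n ⊕ Fin n) (Unit ⊕ Fin n ⊕ Fin n) K ⊗[K]
      Matrix (Unit ⊕ Fin n ⊕ Fin n) (Unit ⊕ Fin n ⊕ Fin n) K}
    (hr : IsBDMatrix (LieAlgebra.Orthogonal.typeB (Fin n) K) (Sum.inr ∘ Sum.inl) T r)
    (X : GL (Unit ⊕ Fin n ⊕ Fin n) K) :
    X ∈ centralizer (SOodd n K) r ↔ ∃ t ∈ T.torusSubgroup K, torus (weightB n) t = X :=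
  (isRootDatum_B K).mem_centralizer_iff (isRoot_push_B K T) hr torus_mem_SOodd
    (SOodd_exists_torus hr) X

end TypeB

/-! ### Type `C_n` -/

section TypeC

variable {n : ℕ} (K : Type*) [Field K]

/-- The entries of the form of type `C_n`. -/
def formC (n : ℕ) : Fin n ⊕ Fin n → K := Sum.elim (fun _ => -1) (fun _ => 1)

theorem J_eq_monomialForm : Matrix.J (Fin n) K = monomialForm Sum.swap (formC K n) := by
  ext (i | i) (j | j) <;>
    simp [Matrix.J, monomialForm, Matrix.one_apply, eq_comm, formC]
  split_ifs <;> simp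

theorem sp_eq : LieAlgebra.Symplectic.sp (Fin n) K =
    skewAdjointMatricesLieSubalgebra (monomialForm Sum.swap (formC K n)) := by
  rw [← J_eq_monomialForm]
  rfl

theorem Sp_eq : Sp n K = isometryGroup (monomialForm Sum.swap (formC K n)) := by
  rw [← J_eq_monomialForm]
  rfl

variable {K} in
theorem isFormDatum_C :
    IsFormDatum (K := K) Sum.swap (formC K n) (-1) (stdWeight n) Sum.inl where
  bar_bar := Sum.swap_swap
  form_ne_zero p := by rcases p with i | i <;> simp [formC]
  form_bar p := by rcases p with i | i <;> simp [formC]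
  weight_bar := stdWeight_swap
  weight_injective := stdWeight_injective n
  weight_d _ := rfl
  cases p := by
    rcases p with i | i
    · exact .inl ⟨i, rfl⟩
    · exact .inr (.inl ⟨i, rfl⟩)

theorem simpleRootsC_of_lt (k : ℕ) (h : k + 1 < n) :
    simpleRootsC n ⟨k, Nat.lt_of_succ_lt h⟩
      = Pi.single ⟨k, Nat.lt_of_succ_lt h⟩ 1 - Pi.single ⟨k + 1, h⟩ 1 := by
  simp [simpleRootsC, h]

theorem simpleRootsC_last {i : Fin n} (h : ¬ (i : ℕ) + 1 < n) :
    simpleRootsC n i = Pi.single i 2 := by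
  simp [simpleRootsC, h]

theorem comb_simpleRootsC_injective : Function.Injective (comb (simpleRootsC n)) := by
  refine comb_injective_of_dual _ (fun i k => if k ≤ i then 1 else 0) ?_
  intro i j
  have hi := i.2
  have hj := j.2
  by_cases h : (j : ℕ) + 1 < n
  · rw [show simpleRootsC n j = _ from simpleRootsC_of_lt j h]
    simp only [sub_dotProduct, single_dotProduct, one_mul, Fin.le_def, Fin.ext_iff]
    split_ifs <;> omega
  · rw [simpleRootsC_last h]
    simp only [single_dotProduct, Fin.le_def, Fin.ext_iff]
    split_ifs <;> omega

theorem isNonnegComb_posRoots_C (u : Fin n → ℤ) (hu : u ∈ posRoots n 2) :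
    IsNonnegComb (simpleRootsC n) u := by
  have hsub : ∀ {i j : Fin n}, i ≤ j →
      IsNonnegComb (simpleRootsC n) (Pi.single i 1 - Pi.single j 1) := by
    refine isNonnegComb_sub fun k h => ?_
    rw [← simpleRootsC_of_lt]
    exact isNonnegComb_single _
  have hadd : ∀ i j : Fin n, IsNonnegComb (simpleRootsC n) (Pi.single i 1 + Pi.single j 1) := by
    intro i j
    have hi := i.2
    have hj := j.2
    have h1 := isNonnegComb_single (v := simpleRootsC n) ⟨n - 1, by omega⟩
    rw [simpleRootsC_last (by simp only; omega), ← one_add_one_eq_two, Pi.single_add] at h1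
    -- ε_i + ε_j = (ε_i - ε_n) + (ε_j - ε_n) + 2ε_n.
    have h2 := ((hsub (i := i) (j := ⟨n - 1, by omega⟩) (Fin.le_def.2 (by simp only; omega))).add
      (hsub (i := j) (j := ⟨n - 1, by omega⟩) (Fin.le_def.2 (by simp only; omega)))).add h1
    convert h2 using 1
    abel
  rcases mem_posRoots.1 hu with ⟨i, j, hij, rfl⟩ | ⟨i, j, hij, rfl⟩ | ⟨-, i, rfl⟩
  · exact hsub hij.le
  · exact hadd i j
  · rw [← one_add_one_eq_two, Pi.single_add]
    exact hadd i i

variable [CharZero K]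

theorem isRootDatum_C : IsRootDatum (LieAlgebra.Symplectic.sp (Fin n) K) Sum.inl
    (simpleRootsC n) (stdWeight n) (posRoots n 2) := by
  have htwo : ∀ i : Fin n, (Pi.single i 2 : Fin n → ℤ) = Pi.single i 1 + Pi.single i 1 := by
    intro i
    rw [← Pi.single_add, one_add_one_eq_two]
  rw [sp_eq]
  refine isFormDatum_C.isRootDatum comb_simpleRootsC_injective isNonnegComb_posRoots_C
    (zero_notMem_posRoots 2) (fun u => ?_) fun i => ?_
  · rw [mem_posRoots_or_neg_mem_iff]
    constructor
    · rintro ⟨hu, i | i, j | j, rfl, -⟩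
      · have hij : i ≠ j := by rintro rfl; simp at hu
        exact .inl (by simpa [stdWeight] using single_sub_single_dotProduct_self hij)
      · by_cases hij : i = j
        · subst hij
          exact .inr ⟨two_ne_zero, i, .inl (by simp [stdWeight, htwo])⟩
        · exact .inl (by simpa [stdWeight] using single_add_single_dotProduct_self hij)
      · rw [show stdWeight n (Sum.inr i) - stdWeight n (Sum.inl j)
          = -(Pi.single i 1 + Pi.single j 1) by simp [stdWeight]; abel, neg_dotProduct_neg]
        by_cases hij : i = j
        · subst hij
          exact .inr ⟨two_ne_zero, i, .inr (by rw [Pi.single_neg, htwo])⟩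
        · exact .inl (single_add_single_dotProduct_self hij)
      · have hij : j ≠ i := by rintro rfl; simp at hu
        have := single_sub_single_dotProduct_self hij
        rw [show stdWeight n (Sum.inr i) - stdWeight n (Sum.inr j)
          = (Pi.single j 1 - Pi.single i 1) by simp [stdWeight]; abel]
        exact .inl this
    · have hη : (-1 : ℤˣ) ≠ 1 := by decide
      rintro (h | ⟨-, i, rfl | rfl⟩)
      · refine ⟨by rintro rfl; simp at h, ?_⟩
        obtain ⟨k, l, hkl, x, y, rfl | rfl, rfl | rfl, rfl⟩ := eq_add_of_dotProduct_self_eq_two h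
        · exact ⟨Sum.inl k, Sum.inr l, by simp [stdWeight], fun h => absurd h hη⟩
        · exact ⟨Sum.inl k, Sum.inl l, by simp [stdWeight, Pi.single_neg, sub_eq_add_neg],
            fun h => absurd h hη⟩
        · exact ⟨Sum.inr k, Sum.inr l, by simp [stdWeight, Pi.single_neg], fun h => absurd h hη⟩
        · exact ⟨Sum.inr k, Sum.inl l, by simp [stdWeight, Pi.single_neg, sub_eq_add_neg],
            fun h => absurd h hη⟩
      · exact ⟨by simp, Sum.inl i, Sum.inr i, by simp [stdWeight, htwo], fun h => absurd h hη⟩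
      · exact ⟨by simp, Sum.inr i, Sum.inl i,
          by rw [Pi.single_neg, htwo]; simp [stdWeight]; abel, fun h => absurd h hη⟩
  · rw [mem_posRoots]
    by_cases h : (i : ℕ) + 1 < n
    · exact .inl ⟨i, ⟨i + 1, h⟩, Fin.lt_def.2 (Nat.lt_succ_self _), (simpleRootsC_of_lt i h).symm⟩
    · exact .inr (.inr ⟨two_ne_zero, i, (simpleRootsC_last h).symm⟩)

omit K in
theorem simpleRootsC_dotProduct_self (i : Fin n) :
    simpleRootsC n i ⬝ᵥ simpleRootsC n i = if (i : ℕ) + 1 < n then 2 else 4 := by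
  split_ifs with h
  · rw [show simpleRootsC n i = _ from simpleRootsC_of_lt i h]
    exact single_sub_single_dotProduct_self (by simp [Fin.ext_iff])
  · rw [simpleRootsC_last h]
    simp

/-- The long simple root belongs neither to `Γ₁` nor to `Γ₂`. -/
theorem lt_of_mem_C (T : AdmissibleTriple (simpleRootsC n)) (i : T.Γ₁) :
    ((i : Fin n) : ℕ) + 1 < n ∧ ((T.τ i : Fin n) : ℕ) + 1 < n := by
  -- Only one simple root has norm 4, so τ could only fix it, which `tau_ne` excludes.
  have h := T.isometric i i
  have hne := T.tau_ne i
  rw [simpleRootsC_dotProduct_self, simpleRootsC_dotProduct_self] at h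
  have h1 := (i : Fin n).2
  have h2 := (T.τ i : Fin n).2
  rw [Ne, Fin.ext_iff] at hne
  split_ifs at h <;> omega

/-- Roots of norm 2 stay roots by isometry. A root ±2ε_i is never in the span of Γ₁: the short
simple roots have coordinate sum zero. -/
theorem isRoot_push_C (T : AdmissibleTriple (simpleRootsC n)) (a : Fin n → ℤ)
    (ha : IsRoot (LieAlgebra.Symplectic.sp (Fin n) K) Sum.inl (simpleRootsC n) a)
    (hs : T.InSpan a) :
    IsRoot (LieAlgebra.Symplectic.sp (Fin n) K) Sum.inl (simpleRootsC n) (T.push a) := by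
  rw [(isRootDatum_C K).isRoot_iff, mem_posRoots_or_neg_mem_iff] at ha ⊢
  rw [comb_push_dotProduct_self _ T hs]
  rcases ha with h | ⟨-, i, h⟩
  · exact .inl h
  · exfalso
    have h1 : comb (simpleRootsC n) a ⬝ᵥ 1 = 0 := by
      rw [comb_dotProduct]
      refine Finset.sum_eq_zero fun i _ => ?_
      by_cases hi : a i = 0
      · rw [hi, zero_mul]
      · have h2 := (lt_of_mem_C T ⟨i, hs i hi⟩).1
        rw [show simpleRootsC n i = _ from simpleRootsC_of_lt i h2]
        simp [sub_dotProduct]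
    rcases h with h | h <;> rw [← h] at h1 <;> simp at h1

variable {K}

/-- The coordinates of 2ρ are distinct and positive, so its pairings with the weights ±ε_k are all
different. -/
theorem Sp_exists_torus {T : AdmissibleTriple (simpleRootsC n)}
    {r : Matrix (Fin n ⊕ Fin n) (Fin n ⊕ Fin n) K ⊗[K] Matrix (Fin n ⊕ Fin n) (Fin n ⊕ Fin n) K}
    (hr : IsBDMatrix (LieAlgebra.Symplectic.sp (Fin n) K) Sum.inl T r)
    (X : GL (Fin n ⊕ Fin n) K) (hX : X ∈ Sp n K) (hXr : adTensor X r = r) :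
    ∃ t, torus (stdWeight n) t = X := by
  have R := isRootDatum_C (n := n) K
  have hpush := isRoot_push_C K T
  rw [sp_eq] at R hr
  simp only [sp_eq] at hpush
  rw [Sp_eq] at hX
  refine isFormDatum_C.exists_torus_eq hX (fun p q hpq => ?_) fun p hp => ?_
  · by_contra h
    refine hpq ?_
    have h := isFormDatum_C.dotProduct_sum_eq R hpush hr hXr h
    rw [sum_posRoots (by norm_num)] at h
    rcases p with i | i <;> rcases q with j | j <;> have hi := i.2 <;> have hj := j.2 <;>
      simp only [stdWeight, Sum.elim_inl, Sum.elim_inr, neg_dotProduct, single_dotProduct] at h <;>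
      simp only [Sum.inl.injEq, Sum.inr.injEq, reduceCtorEq, Fin.ext_iff] <;> omega
  · rcases p with i | i <;> simp at hp

omit [CharZero K] in
theorem torus_mem_Sp (t : Fin n → Kˣ) : torus (stdWeight n) t ∈ Sp n K := by
  rw [Sp_eq]
  exact isFormDatum_C.torus_mem_isometryGroup t

theorem mem_centralizer_Sp_iff {T : AdmissibleTriple (simpleRootsC n)}
    {r : Matrix (Fin n ⊕ Fin n) (Fin n ⊕ Fin n) K ⊗[K] Matrix (Fin n ⊕ Fin n) (Fin n ⊕ Fin n) K}
    (hr : IsBDMatrix (LieAlgebra.Symplectic.sp (Fin n) K) Sum.inl T r)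
    (X : GL (Fin n ⊕ Fin n) K) :
    X ∈ centralizer (Sp n K) r ↔ ∃ t ∈ T.torusSubgroup K, torus (stdWeight n) t = X :=
  (isRootDatum_C K).mem_centralizer_iff (isRoot_push_C K T) hr torus_mem_Sp
    (Sp_exists_torus hr) X

end TypeC

/-! ### Type `A_n` -/

/-- The vector ε_k enters with sign + through the n - 1 - k pairs k < j and with sign - through the
k pairs i < k. -/
theorem sum_posRootsA_apply {n : ℕ} (k : Fin n) :
    (∑ u ∈ posRootsA n, u) k = (n : ℤ) - 1 - 2 * k := by
  have h1 : (Finset.univ.filter fun p : Fin n × Fin n => p.1 < p.2 ∧ k = p.1)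
      = (Finset.Ioi k).map ⟨fun j => (k, j), fun a b h => congrArg Prod.snd h⟩ := by
    ext ⟨i, j⟩
    simp only [Finset.mem_filter, Finset.mem_univ, true_and, Finset.mem_map, Finset.mem_Ioi]
    constructor
    · rintro ⟨h, rfl⟩; exact ⟨j, h, rfl⟩
    · rintro ⟨_, h, e⟩
      cases e
      exact ⟨h, rfl⟩
  have h2 : (Finset.univ.filter fun p : Fin n × Fin n => p.1 < p.2 ∧ k = p.2)
      = (Finset.Iio k).map ⟨fun i => (i, k), fun a b h => congrArg Prod.fst h⟩ := by
    ext ⟨i, j⟩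
    simp only [Finset.mem_filter, Finset.mem_univ, true_and, Finset.mem_map, Finset.mem_Iio]
    constructor
    · rintro ⟨h, rfl⟩; exact ⟨i, h, rfl⟩
    · rintro ⟨_, h, e⟩
      cases e
      exact ⟨h, rfl⟩
  rw [sum_posRootsA, Finset.sum_apply]
  simp only [Pi.sub_apply, Pi.single_apply, Finset.sum_sub_distrib]
  rw [← Finset.sum_filter, ← Finset.sum_filter, Finset.filter_filter, Finset.filter_filter, h1, h2]
  simp only [Finset.sum_const, Finset.card_map, Fin.card_Ioi, Fin.card_Iio, nsmul_eq_mul, mul_one]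
  have := k.2
  push_cast [Nat.cast_sub (show (k : ℕ) ≤ n - 1 by omega), Nat.cast_sub (show 1 ≤ n by omega)]
  ring

section TypeA

variable {n : ℕ}

/-- The weights of the standard representation of type `A_n`. -/
def weightA (n : ℕ) : Fin (n + 1) → Fin (n + 1) → ℤ := fun i => Pi.single i 1

theorem simpleRootsA_of_lt (k : ℕ) (h : k + 1 < n + 1) :
    simpleRootsA n ⟨k, Nat.lt_of_succ_lt_succ h⟩
      = Pi.single ⟨k, Nat.lt_of_succ_lt h⟩ 1 - Pi.single ⟨k + 1, h⟩ 1 := rfl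

theorem comb_simpleRootsA_injective : Function.Injective (comb (simpleRootsA n)) := by
  refine comb_injective_of_dual _ (fun i k => if (k : ℕ) ≤ i then 1 else 0) ?_
  intro i j
  simp only [simpleRootsA, sub_dotProduct, single_dotProduct, one_mul, Fin.ext_iff,
    Fin.val_castSucc, Fin.val_succ]
  split_ifs <;> omega

theorem isNonnegComb_posRootsA (u : Fin (n + 1) → ℤ) (hu : u ∈ posRootsA (n + 1)) :
    IsNonnegComb (simpleRootsA n) u := by
  obtain ⟨i, j, hij, rfl⟩ := mem_posRootsA.1 hu
  refine isNonnegComb_sub (fun k h => ?_) hij.le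
  rw [← simpleRootsA_of_lt]
  exact isNonnegComb_single _

theorem comb_simpleRootsA_dotProduct_one (a : Fin n → ℤ) : comb (simpleRootsA n) a ⬝ᵥ 1 = 0 := by
  rw [comb_dotProduct]
  refine Finset.sum_eq_zero fun i _ => ?_
  simp [simpleRootsA, sub_dotProduct]

theorem mem_posRootsA_or_neg_mem_iff (u : Fin n → ℤ) :
    (u ∈ posRootsA n ∨ -u ∈ posRootsA n) ↔ u ⬝ᵥ u = 2 ∧ u ⬝ᵥ 1 = 0 := by
  constructor
  · have aux : ∀ u ∈ posRootsA n, u ⬝ᵥ u = 2 ∧ u ⬝ᵥ 1 = 0 := by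
      intro u hu
      obtain ⟨i, j, hij, rfl⟩ := mem_posRootsA.1 hu
      exact ⟨single_sub_single_dotProduct_self hij.ne, by simp [sub_dotProduct]⟩
    rintro (h | h)
    · exact aux u h
    · simpa using aux _ h
  · rintro ⟨h, h0⟩
    simp only [mem_posRootsA]
    obtain ⟨k, l, hkl, x, y, rfl | rfl, rfl | rfl, rfl⟩ := eq_add_of_dotProduct_self_eq_two h
    · simp [add_dotProduct] at h0
    · rcases lt_or_gt_of_ne hkl with h | h
      · exact .inl ⟨k, l, h, by rw [Pi.single_neg]; abel⟩
      · exact .inr ⟨l, k, h, by rw [Pi.single_neg]; abel⟩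
    · rcases lt_or_gt_of_ne hkl with h | h
      · exact .inr ⟨k, l, h, by rw [Pi.single_neg]; abel⟩
      · exact .inl ⟨l, k, h, by rw [Pi.single_neg]; abel⟩
    · simp [add_dotProduct] at h0

variable (K : Type*) [Field K]

theorem mem_sl_iff {ι : Type*} [Fintype ι] [DecidableEq ι] (x : Matrix ι ι K) :
    x ∈ LieAlgebra.SpecialLinear.sl ι K ↔ x.trace = 0 := Iff.rfl

theorem diagonal_mem_cartan_sl (i j : Fin n) :
    Matrix.diagonal (Pi.single i 1 - Pi.single j 1 : Fin n → K) ∈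
      cartan (LieAlgebra.SpecialLinear.sl (Fin n) K) := by
  refine ⟨(mem_sl_iff K _).2 ?_, Matrix.isDiag_diagonal _⟩
  simp [Matrix.trace_diagonal, Finset.sum_sub_distrib]

variable [CharZero K]

/-- Diagonal matrices of trace zero determine a weight only modulo (1, …, 1). Both sides have
coordinate sum zero, which removes the ambiguity. -/
theorem homogeneous_sl (a : Fin n → ℤ) (x : Matrix (Fin (n + 1)) (Fin (n + 1)) K)
    (p q : Fin (n + 1))
    (hx : InWeightSpace (LieAlgebra.SpecialLinear.sl (Fin (n + 1)) K) id (simpleRootsA n) a x)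
    (hpq : x p q ≠ 0) : weightA n p - weightA n q = comb (simpleRootsA n) a := by
  set y : Fin (n + 1) → ℤ := weightA n p - weightA n q - comb (simpleRootsA n) a with hy
  have hH : ∀ i j, y i = y j := by
    intro i j
    have h1 := hx.2 _ (diagonal_mem_cartan_sl K i j)
    have h2 := congrFun (congrFun h1 p) q
    rw [LieRing.of_associative_ring_bracket] at h2
    change (Matrix.diagonal (Pi.single i 1 - Pi.single j 1 : Fin (n + 1) → K) * x) p q
      - (x * Matrix.diagonal (Pi.single i 1 - Pi.single j 1 : Fin (n + 1) → K)) p q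
        = _ * x p q at h2
    rw [Matrix.diagonal_mul, Matrix.mul_diagonal, mul_comm (x p q), ← sub_mul] at h2
    have h3 := mul_right_cancel₀ hpq h2
    rw [weight_apply] at h3
    simp only [id, Matrix.diagonal_apply_eq, Pi.sub_apply, mul_sub, Finset.sum_sub_distrib,
      Pi.single_apply, mul_ite, mul_one, mul_zero, Finset.sum_ite_eq', Finset.mem_univ,
      if_true] at h3
    have h4 : ((y i : ℤ) : K) = y j := by
      simp only [hy, weightA, Pi.sub_apply, Pi.single_apply, Int.cast_sub, Int.cast_ite,
        Int.cast_one, Int.cast_zero]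
      simp only [eq_comm (a := p), eq_comm (a := q)] at h3
      linear_combination h3
    exact_mod_cast h4
  have hsum : y ⬝ᵥ 1 = 0 := by
    rw [hy, sub_dotProduct, comb_simpleRootsA_dotProduct_one, sub_dotProduct]
    simp [weightA]
  have hy0 : y = 0 := by
    have h1 : y = fun _ => y p := funext fun i => hH i p
    rw [h1] at hsum
    simp only [dotProduct, Pi.one_apply, mul_one, Finset.sum_const, Finset.card_univ,
      Fintype.card_fin, nsmul_eq_mul] at hsum
    have h2 : y p = 0 := by
      rcases mul_eq_zero.1 hsum with h | h
      · exact absurd h (by positivity)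
      · exact h
    rw [h1, h2]
    rfl
  exact sub_eq_zero.1 hy0

theorem isRoot_sl_iff (a : Fin n → ℤ) :
    IsRoot (LieAlgebra.SpecialLinear.sl (Fin (n + 1)) K) id (simpleRootsA n) a ↔
      comb (simpleRootsA n) a ∈ posRootsA (n + 1) ∨ -comb (simpleRootsA n) a ∈ posRootsA (n + 1) := by
  constructor
  · rintro ⟨ha, x, hx0, hx⟩
    have : ∃ p q, x p q ≠ 0 := by
      by_contra! h
      exact hx0 (Matrix.ext h)
    obtain ⟨p, q, hpq⟩ := this
    have hw := homogeneous_sl K a x p q hx hpq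
    have hne : p ≠ q := by
      rintro rfl
      rw [sub_self, ← comb_zero (simpleRootsA n)] at hw
      exact ha (comb_simpleRootsA_injective hw).symm
    rw [← hw]
    simp only [mem_posRootsA]
    rcases lt_or_gt_of_ne hne with h | h
    · exact .inl ⟨p, q, h, rfl⟩
    · exact .inr ⟨q, p, h, (neg_sub _ _).symm⟩
  · intro h
    have hij : ∃ i j, i ≠ j ∧ Pi.single i 1 - Pi.single j 1 = comb (simpleRootsA n) a := by
      simp only [mem_posRootsA] at h
      rcases h with ⟨i, j, hij, h⟩ | ⟨i, j, hij, h⟩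
      · exact ⟨i, j, hij.ne, h⟩
      · exact ⟨j, i, hij.ne', by rw [← neg_sub, h, neg_neg]⟩
    obtain ⟨i, j, hij, h⟩ := hij
    refine ⟨?_, Matrix.single i j 1, ?_, (mem_sl_iff K _).2 ?_, fun H hH => ?_⟩
    · rintro rfl
      rw [comb_zero, sub_eq_zero] at h
      exact hij (single_injective h)
    · intro h0
      have := congrFun (congrFun h0 i) j
      simp at this
    · exact Matrix.trace_single_eq_of_ne i j 1 hij
    · have hwt : H i i - H j j = weight id (simpleRootsA n) a H := by
        rw [weight_apply, ← h]
        simp [sub_mul, Finset.sum_sub_distrib, Pi.single_apply]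
      have hHd := hH.2.diagonal_diag
      rw [LieRing.of_associative_ring_bracket]
      ext p' q'
      conv_lhs => rw [← hHd]
      rw [Matrix.sub_apply, Matrix.diagonal_mul, Matrix.mul_diagonal, Matrix.smul_apply,
        smul_eq_mul, Matrix.single_apply, ← hwt]
      simp only [Matrix.diag_apply]
      split_ifs with h'
      · rw [h'.1, h'.2]; ring
      · ring

theorem isRootDatum_A : IsRootDatum (LieAlgebra.SpecialLinear.sl (Fin (n + 1)) K) id
    (simpleRootsA n) (weightA n) (posRootsA (n + 1)) where
  comb_injective := comb_simpleRootsA_injective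
  exists_comb_eq := isNonnegComb_posRootsA
  zero_notMem := zero_notMem_posRootsA
  isRoot_iff := isRoot_sl_iff K
  isRoot_single i := (isRoot_sl_iff K _).2 (.inl (by
    rw [comb_single]
    exact mem_posRootsA.2 ⟨_, _, Fin.castSucc_lt_succ, rfl⟩))
  weight_injective _ _ h := single_injective h
  homogeneous := homogeneous_sl K

/-- The roots are the vectors of norm 2 with coordinate sum zero, and the second condition holds on
the whole root lattice. -/
theorem isRoot_push_A (T : AdmissibleTriple (simpleRootsA n)) (a : Fin n → ℤ)
    (ha : IsRoot (LieAlgebra.SpecialLinear.sl (Fin (n + 1)) K) id (simpleRootsA n) a)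
    (hs : T.InSpan a) :
    IsRoot (LieAlgebra.SpecialLinear.sl (Fin (n + 1)) K) id (simpleRootsA n) (T.push a) := by
  rw [isRoot_sl_iff, mem_posRootsA_or_neg_mem_iff] at ha ⊢
  exact ⟨(comb_push_dotProduct_self _ T hs).trans ha.1, comb_simpleRootsA_dotProduct_one _⟩

variable {K}

/-- Differences of the z_i are nonzero multiples of differences of the coordinates n - 2i of 2ρ, so
the z_i are distinct and X is diagonal. -/
theorem GL_exists_torus {T : AdmissibleTriple (simpleRootsA n)}
    {r : Matrix (Fin (n + 1)) (Fin (n + 1)) K ⊗[K] Matrix (Fin (n + 1)) (Fin (n + 1)) K}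
    (hr : IsBDMatrix (LieAlgebra.SpecialLinear.sl (Fin (n + 1)) K) id T r)
    (X : GL (Fin (n + 1)) K) (hXr : adTensor X r = r) : ∃ t, torus (weightA n) t = X := by
  obtain ⟨c, z, hc, -, hXz, htr⟩ :=
    (isRootDatum_A (n := n) K).exists_diagonal_commute (isRoot_push_A K T) hr
  have hz : ∀ i j, z i = z j → i = j := by
    intro i j hij
    have h1 := htr _ (diagonal_mem_cartan_sl K i j)
    rw [Finset.sum_comm] at h1
    simp only [id, Matrix.diagonal_apply_eq, Pi.sub_apply, mul_sub, Finset.sum_sub_distrib,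
      Pi.single_apply, mul_ite, mul_one, mul_zero, Finset.sum_ite_eq', Finset.mem_univ, if_true,
      hij, sub_self, Finset.sum_ite_irrel, Finset.sum_const_zero] at h1
    have h2 : ∀ k, ∑ u ∈ posRootsA (n + 1), ((u k : ℤ) : K) = ((n - 2 * (k : ℕ) : ℤ) : K) := by
      intro k
      rw [← Int.cast_sum, ← Finset.sum_apply, sum_posRootsA_apply]
      push_cast
      ring
    rw [h2, h2, eq_comm, sub_eq_zero] at h1
    have h3 : (n - 2 * (i : ℕ) : ℤ) = n - 2 * (j : ℕ) := by exact_mod_cast h1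
    ext
    omega
  have hdiag : X.1.IsDiag := by
    intro p q hpq
    by_contra h
    exact hpq (hz p q (hXz X hXr p q h))
  have hne : ∀ k, X.1 k k ≠ 0 := by
    intro k h0
    refine (Matrix.isUnits_det_units X).ne_zero (Matrix.det_eq_zero_of_column_eq_zero k fun i => ?_)
    by_cases h : i = k
    · rw [h, h0]
    · exact hdiag h
  refine ⟨fun k => Units.mk0 _ (hne k), Units.ext (Eq.trans ?_ hdiag.diagonal_diag)⟩
  rw [coe_torus]
  congr 1
  ext k
  rw [weightA, chi_single, zpow_one]
  rfl

theorem mem_centralizer_GL_iff {T : AdmissibleTriple (simpleRootsA n)}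
    {r : Matrix (Fin (n + 1)) (Fin (n + 1)) K ⊗[K] Matrix (Fin (n + 1)) (Fin (n + 1)) K}
    (hr : IsBDMatrix (LieAlgebra.SpecialLinear.sl (Fin (n + 1)) K) id T r)
    (X : GL (Fin (n + 1)) K) :
    X ∈ centralizer ⊤ r ↔ ∃ t ∈ T.torusSubgroup K, torus (weightA n) t = X :=
  (isRootDatum_A K).mem_centralizer_iff (isRoot_push_A K T) hr (fun _ => Subgroup.mem_top _)
    (fun X _ => GL_exists_torus hr X) X

end TypeA

/-! ### Square classes of complex Laurent series -/

section Laurent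

open PowerSeries in
-- Substitute h into the binomial series of (1 + X)^{1/2}.
theorem exists_sq_eq_one_add {h : PowerSeries ℂ} (h0 : constantCoeff h = 0) :
    ∃ g : PowerSeries ℂ, g ^ 2 = 1 + h := by
  have hs : PowerSeries.HasSubst h := HasSubst.of_constantCoeff_zero' h0
  have hB : (PowerSeries.binomialSeries ℂ (1 / 2 : ℚ)) ^ 2 = 1 + (X : PowerSeries ℂ) := by
    rw [sq, ← binomialSeries_add, add_halves]
    simpa using binomialSeries_nat (R := ℚ) (A := ℂ) 1
  refine ⟨(substAlgHom (R := ℂ) hs) (PowerSeries.binomialSeries ℂ (1 / 2 : ℚ)), ?_⟩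
  refine (map_pow (substAlgHom (R := ℂ) hs) _ 2).symm.trans ?_
  rw [hB, map_add, map_one, substAlgHom_X]

open PowerSeries in
theorem PowerSeries.exists_sq_eq {g : PowerSeries ℂ} (hg : constantCoeff g ≠ 0) :
    ∃ f : PowerSeries ℂ, f ^ 2 = g := by
  set a := constantCoeff g with ha
  obtain ⟨b, hb⟩ := IsAlgClosed.exists_pow_nat_eq a (n := 2) two_pos
  obtain ⟨f, hf⟩ := exists_sq_eq_one_add (h := C a⁻¹ * g - 1) (by simp [← ha, hg])
  refine ⟨C b * f, ?_⟩
  rw [mul_pow, hf, ← map_pow, hb, add_sub_cancel, ← mul_assoc, ← map_mul, mul_inv_cancel₀ hg,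
    map_one, one_mul]

/-- Split off the power of the variable given by the order, which can be halved; the remaining power
series has nonzero constant term. -/
theorem LaurentSeries.exists_sq_eq {f : LaurentSeries ℂ} (hf : f ≠ 0)
    (h : Even (HahnSeries.order f)) : ∃ g : LaurentSeries ℂ, g ^ 2 = f := by
  obtain ⟨k, hk⟩ := h
  obtain ⟨g, hg⟩ := PowerSeries.exists_sq_eq (g := f.powerSeriesPart) (by
    rw [← PowerSeries.coeff_zero_eq_constantCoeff_apply, LaurentSeries.powerSeriesPart_coeff,
      Nat.cast_zero, add_zero]
    exact HahnSeries.coeff_order_eq_zero.not.2 hf)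
  refine ⟨HahnSeries.single k 1 * HahnSeries.ofPowerSeries ℤ ℂ g, ?_⟩
  conv_rhs => rw [← LaurentSeries.single_order_mul_powerSeriesPart f]
  rw [mul_pow, ← map_pow (HahnSeries.ofPowerSeries ℤ ℂ), hg, sq, HahnSeries.single_mul_single, mul_one, hk]

/-- The order modulo 2 is a surjective homomorphism onto ℤ/2 whose kernel is the group of squares.
-/
theorem card_square_classes_eq_two {F : Type*} [Field F] (o : Fˣ → ℤ)
    (hmul : ∀ u u', o (u * u') = o u + o u') (hone : ∃ u, o u = 1)
    (hsq : ∀ u : Fˣ, Even (o u) → ∃ g : F, g ^ 2 = u) :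
    Nat.card (Fˣ ⧸ (powMonoidHom 2 : Fˣ →* Fˣ).range) = 2 := by
  let φ : Fˣ →* Multiplicative (ZMod 2) :=
    MonoidHom.mk' (fun u => Multiplicative.ofAdd ((o u : ℤ) : ZMod 2)) fun u u' => by
      rw [hmul, Int.cast_add, ofAdd_add]
  have hsurj : Function.Surjective φ := by
    intro x
    obtain ⟨u, hu⟩ := hone
    obtain h | h : x = 1 ∨ x = Multiplicative.ofAdd 1 := by
      revert x
      decide
    · exact ⟨1, by rw [h, map_one]⟩
    · exact ⟨u, by rw [h]; simp [φ, hu]⟩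
  have hker : (powMonoidHom 2 : Fˣ →* Fˣ).range = φ.ker := by
    ext u
    rw [MonoidHom.mem_ker]
    constructor
    · rintro ⟨g, rfl⟩
      rw [powMonoidHom_apply, map_pow]
      generalize φ g = x
      revert x
      decide
    · intro h
      have h1 : ((o u : ℤ) : ZMod 2) = 0 := h
      obtain ⟨g, hg⟩ := hsq u ((ZMod.intCast_eq_zero_iff_even).1 h1)
      have hg0 : g ≠ 0 := by
        rintro rfl
        exact u.ne_zero (by rw [← hg]; simp)
      exact ⟨Units.mk0 g hg0, Units.ext hg⟩
  rw [hker, ← Subgroup.index_eq_card, Subgroup.index_ker, MonoidHom.range_eq_top.2 hsurj,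
    Subgroup.card_top, Nat.card_eq_fintype_card]
  rfl

theorem charZero_laurentSeries : CharZero (LaurentSeries ℂ) :=
  charZero_of_injective_ringHom (f := (HahnSeries.C : ℂ →+* HahnSeries ℤ ℂ))
    HahnSeries.C_injective

end Laurent

/-! ### The cohomology -/

section Main

variable (F : Type*) [Field F] [CharZero F] {n : ℕ}

theorem card_HBD_A (T : AdmissibleTriple (simpleRootsA n))
    {r : Matrix (Fin (n + 1)) (Fin (n + 1)) (AlgebraicClosure F) ⊗[AlgebraicClosure F]
      Matrix (Fin (n + 1)) (Fin (n + 1)) (AlgebraicClosure F)}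
    (hr : IsBDMatrix (LieAlgebra.SpecialLinear.sl (Fin (n + 1)) (AlgebraicClosure F)) id T r) :
    Nat.card (HBD F ⊤ r) = 1 := by
  refine card_HBD_eq_one (d := id) (fun k => rfl) (fun _ => Subgroup.mem_top _)
    (mem_centralizer_GL_iff hr) fun p hp => ?_
  refine T.exists_eq_baseMap_mul hp T.source
    (fun i => T.source_eq (T.source_notMem i) .refl) T.source_tau fun g _ => ?_
  -- The n simple roots leave the last of the n + 1 coordinates free; it is set to 1.
  refine ⟨tailProd (fun k => if h : (k : ℕ) < n then g ⟨k, h⟩ else 1), fun i => ?_⟩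
  have h := chi_tailProd_sub (fun k : Fin (n + 1) => if h : (k : ℕ) < n then g ⟨k, h⟩ else 1)
    (i : ℕ) (Nat.succ_lt_succ i.2)
  rw [← simpleRootsA_of_lt] at h
  simpa using h

theorem card_HBD_B (T : AdmissibleTriple (simpleRootsB n))
    {r : Matrix (Unit ⊕ Fin n ⊕ Fin n) (Unit ⊕ Fin n ⊕ Fin n) (AlgebraicClosure F)
      ⊗[AlgebraicClosure F]
      Matrix (Unit ⊕ Fin n ⊕ Fin n) (Unit ⊕ Fin n ⊕ Fin n) (AlgebraicClosure F)}
    (hr : IsBDMatrix (LieAlgebra.Orthogonal.typeB (Fin n) (AlgebraicClosure F))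
      (Sum.inr ∘ Sum.inl) T r) :
    Nat.card (HBD F (SOodd n (AlgebraicClosure F)) r) = 1 := by
  refine card_HBD_eq_one (d := Sum.inr ∘ Sum.inl) (fun k => rfl) torus_mem_SOodd
    (mem_centralizer_SOodd_iff hr) fun p hp => ?_
  refine T.exists_eq_baseMap_mul hp T.source
    (fun i => T.source_eq (T.source_notMem i) .refl) T.source_tau fun g _ => ?_
  -- In type B the simple roots form a basis of the character lattice, so every g lifts.
  refine ⟨tailProd g, fun i => ?_⟩
  by_cases h : (i : ℕ) + 1 < n
  · rw [show simpleRootsB n i = _ from simpleRootsB_of_lt i h]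
    exact chi_tailProd_sub g i h
  · rw [simpleRootsB_last h, chi_single, zpow_one, tailProd_last g (by omega)]

theorem card_HBD_C (T : AdmissibleTriple (simpleRootsC n))
    {r : Matrix (Fin n ⊕ Fin n) (Fin n ⊕ Fin n) (AlgebraicClosure F) ⊗[AlgebraicClosure F]
      Matrix (Fin n ⊕ Fin n) (Fin n ⊕ Fin n) (AlgebraicClosure F)}
    (hr : IsBDMatrix (LieAlgebra.Symplectic.sp (Fin n) (AlgebraicClosure F)) Sum.inl T r) :
    Nat.card (HBD F (Sp n (AlgebraicClosure F)) r) = 1 := by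
  refine card_HBD_eq_one (d := Sum.inl) (fun k => rfl) torus_mem_Sp
    (mem_centralizer_Sp_iff hr) fun p hp => ?_
  refine T.exists_eq_baseMap_mul hp T.source
    (fun i => T.source_eq (T.source_notMem i) .refl) T.source_tau fun g hg => ?_
  refine ⟨tailProd g, fun i => ?_⟩
  by_cases h : (i : ℕ) + 1 < n
  · rw [show simpleRootsC n i = _ from simpleRootsC_of_lt i h]
    exact chi_tailProd_sub g i h
  -- The long simple root is its own source, so g is 1 there and no square root has to be extracted.
  · have hi : i ∉ T.Γ₂ := by
      intro hi
      have h1 := (lt_of_mem_C T (T.τ.symm ⟨i, hi⟩)).2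
      rw [Equiv.apply_symm_apply] at h1
      exact h h1
    have h1 : g i = 1 := by
      have h2 := hg i
      rw [T.source_eq hi .refl, right_eq_mul] at h2
      exact units_map_algebraMap_injective (K := AlgebraicClosure F) (by rw [h2, map_one])
    rw [simpleRootsC_last h, chi_single, tailProd_last g (by omega), h1, one_zpow]

/-- Values at the simple roots of type `D_n` lift to the torus if they agree at the two end nodes
of the branch. -/
theorem exists_chi_simpleRootsD_eq {F : Type*} [Field F] (hn : 3 ≤ n) (g : Fin n → Fˣ)
    (hg : g ⟨n - 1, sub_one_lt_of_three_le hn⟩ = g ⟨n - 2, sub_two_lt_of_three_le hn⟩) :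
    ∃ f : Fin n → Fˣ, ∀ i, chi f (simpleRootsD n i) = g i := by
  -- With the last coordinate equal to 1, both end nodes take the value of the coordinate ε_{n-1}.
  set g' : Fin n → Fˣ := fun k => if (k : ℕ) + 1 < n then g k else 1 with hg'
  refine ⟨tailProd g', fun i => ?_⟩
  by_cases h : (i : ℕ) + 1 < n
  · rw [show simpleRootsD n i = _ from simpleRootsD_of_lt i h]
    refine (chi_tailProd_sub g' i h).trans ?_
    simp [hg', h]
  · have h1 : tailProd g' ⟨n - 1, sub_one_lt_of_three_le hn⟩ = 1 := by
      rw [tailProd_last g' (by simp only; omega)]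
      simp only [hg']
      rw [if_neg (by omega)]
    have h2 := tailProd_eq g' (n - 2) (by omega)
    have h3 : (⟨n - 2 + 1, by omega⟩ : Fin n) = ⟨n - 1, sub_one_lt_of_three_le hn⟩ := Fin.ext (by simp only; omega)
    rw [h3, h1, mul_one] at h2
    rw [eq_last_of_not_lt h (by omega), simpleRootsD_last hn, chi_add, chi_single, chi_single, h1,
      h2, zpow_one, one_zpow, mul_one, hg]
    simp only [hg']
    rw [if_pos (by omega)]

theorem card_HBD_D (hn : 3 ≤ n) (T : AdmissibleTriple (simpleRootsD n))
    {r : Matrix (Fin n ⊕ Fin n) (Fin n ⊕ Fin n) (AlgebraicClosure F) ⊗[AlgebraicClosure F]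
      Matrix (Fin n ⊕ Fin n) (Fin n ⊕ Fin n) (AlgebraicClosure F)}
    (hr : IsBDMatrix (LieAlgebra.Orthogonal.typeD (Fin n) (AlgebraicClosure F)) Sum.inl T r)
    (hT : ¬ T.SameString ⟨n - 2, sub_two_lt_of_three_le hn⟩ ⟨n - 1, sub_one_lt_of_three_le hn⟩) :
    Nat.card (HBD F (SOeven n (AlgebraicClosure F)) r) = 1 := by
  set M : Fin n := ⟨n - 2, sub_two_lt_of_three_le hn⟩ with hM
  set N : Fin n := ⟨n - 1, sub_one_lt_of_three_le hn⟩ with hN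
  have hMN : M ≠ N := by
    rw [hM, hN, Ne, Fin.mk.injEq]
    omega
  rw [T.sameString_iff hMN] at hT
  refine card_HBD_eq_one (d := Sum.inl) (fun k => rfl) torus_mem_SOeven
    (mem_centralizer_SOeven_iff hn hr) fun p hp => ?_
  -- The end nodes have different sources, so each can represent its own class; then g is 1 at both
  -- and lifts.
  refine T.exists_eq_baseMap_mul hp (fun i => if T.source i = T.source N then N else
    if T.source i = T.source M then M else T.source i) (fun i => ?_) (fun i => ?_) fun g hg => ?_
  · split_ifs with h1 h2
    · exact h1.symm
    · exact h2.symm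
    · exact T.source_eq (T.source_notMem i) .refl
  · rw [T.source_tau]
  · have h1 : ∀ i, chi p (simpleRootsD n i) = Units.map
        (algebraMap F (AlgebraicClosure F) : F →* AlgebraicClosure F) (g i) *
          chi p (simpleRootsD n i) → g i = 1 := by
      intro i h
      rw [right_eq_mul] at h
      exact units_map_algebraMap_injective (K := AlgebraicClosure F) (by rw [h, map_one])
    have hgN : g N = 1 := h1 N (by simpa using hg N)
    have hgM : g M = 1 := h1 M (by simpa [hT] using hg M)
    exact exists_chi_simpleRootsD_eq hn g (hgN.trans hgM.symm)

/-- The relation α_n = α_{n-1} + 2ε_n, from which the square classes arise. -/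
theorem chi_simpleRootsD_last {K : Type*} [Field K] (hn : 3 ≤ n) (t : Fin n → Kˣ) :
    chi t (simpleRootsD n ⟨n - 1, sub_one_lt_of_three_le hn⟩)
      = chi t (simpleRootsD n ⟨n - 2, sub_two_lt_of_three_le hn⟩) * t ⟨n - 1, sub_one_lt_of_three_le hn⟩ ^ 2 := by
  have h := simpleRootsD_of_lt (n := n) (n - 2) (by omega)
  have h3 : (⟨n - 2 + 1, by omega⟩ : Fin n) = ⟨n - 1, sub_one_lt_of_three_le hn⟩ := Fin.ext (by simp only; omega)
  rw [h3] at h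
  rw [h, simpleRootsD_last hn, chi_add, chi_sub, chi_single, chi_single, zpow_one, zpow_one, sq,
    ← mul_assoc, div_mul_cancel]

theorem exists_HBD_D_equiv (hn : 3 ≤ n) (T : AdmissibleTriple (simpleRootsD n))
    {r : Matrix (Fin n ⊕ Fin n) (Fin n ⊕ Fin n) (AlgebraicClosure F) ⊗[AlgebraicClosure F]
      Matrix (Fin n ⊕ Fin n) (Fin n ⊕ Fin n) (AlgebraicClosure F)}
    (hr : IsBDMatrix (LieAlgebra.Orthogonal.typeD (Fin n) (AlgebraicClosure F)) Sum.inl T r)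
    (hT : T.SameString ⟨n - 2, sub_two_lt_of_three_le hn⟩ ⟨n - 1, sub_one_lt_of_three_le hn⟩) :
    ∃ φ : HBD F (SOeven n (AlgebraicClosure F)) r ≃ Fˣ ⧸ (powMonoidHom 2 : Fˣ →* Fˣ).range,
      φ (HBD.trivialClass F (SOeven n (AlgebraicClosure F)) r) = 1 := by
  have hlast := fun t => chi_simpleRootsD_last (K := AlgebraicClosure F) hn t
  set M : Fin n := ⟨n - 2, sub_two_lt_of_three_le hn⟩ with hM
  set N : Fin n := ⟨n - 1, sub_one_lt_of_three_le hn⟩ with hN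
  have hMN : M ≠ N := by
    rw [hM, hN, Ne, Fin.mk.injEq]
    omega
  rw [T.sameString_iff hMN] at hT
  refine exists_HBD_equiv (d := Sum.inl) (fun k => rfl) torus_mem_SOeven
    (mem_centralizer_SOeven_iff hn hr) (N := N) (fun s hs => ?_) (fun p hp hx => ?_)
    fun x y hxy => ?_
  · have h := T.chi_eq_of_source_eq hs hT
    rwa [hlast, left_eq_mul] at h
  · obtain ⟨x, hx⟩ := hx
    -- Dividing by this rational element reduces to p_N = 1, where the two end nodes take equal
    -- values and g lifts.
    set f : Fin n → Fˣ := Pi.mulSingle N x with hf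
    have hgal : ∀ σ : AlgebraicClosure F ≃ₐ[F] AlgebraicClosure F,
        galMap σ (baseMap (AlgebraicClosure F) f) = baseMap (AlgebraicClosure F) f := by
      intro σ
      ext k
      simp [galMap, baseMap]
    have hp' : IsTorusCocycle F (T.torusSubgroup (AlgebraicClosure F))
        (p * (baseMap (AlgebraicClosure F) f)⁻¹) := by
      refine hp.div fun σ => ?_
      rw [hgal, inv_mul_cancel]
      exact one_mem _
    have hN1 : (p * (baseMap (AlgebraicClosure F) f)⁻¹) N = 1 := by
      rw [Pi.mul_apply, Pi.inv_apply, ← hx, hf, baseMap, Pi.mulSingle_eq_same, mul_inv_cancel]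
    obtain ⟨f', s, hs, h⟩ := T.exists_eq_baseMap_mul hp' T.source
      (fun i => T.source_eq (T.source_notMem i) .refl) T.source_tau fun g hg => by
        refine exists_chi_simpleRootsD_eq hn g ?_
        have h1 := hg N
        rw [hlast, hN1, one_pow, mul_one, hg M, hT, mul_left_inj] at h1
        exact (units_map_algebraMap_injective h1).symm
    refine ⟨f * f', s, hs, ?_⟩
    rw [mul_inv_eq_iff_eq_mul] at h
    rw [h]
    ext k
    simp [baseMap]
    ring
  -- At N, g prescribes the coordinate itself and not the value of α_n. The other simple roots with
  -- the source of N take the value y, in particular α_{n-1}, so α_n takes the value y · y² = y³.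
  · set g : Fin n → (AlgebraicClosure F)ˣ := fun i =>
      if (i : ℕ) + 1 = n then y else if T.source i = T.source N then y else 1 with hg
    have hpN : tailProd g N = y := by
      rw [tailProd_last g (by simp only [hN]; omega)]
      simp only [hg, hN]
      rw [if_pos (by omega)]
    have hchi : ∀ i, i ≠ N → chi (tailProd g) (simpleRootsD n i)
        = if T.source i = T.source N then y else 1 := by
      intro i hi
      have hlt : (i : ℕ) + 1 < n := by
        have := i.2
        rw [hN, Ne, Fin.ext_iff] at hi
        simp only at hi
        omega
      rw [show simpleRootsD n i = _ from simpleRootsD_of_lt i hlt]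
      refine (chi_tailProd_sub g i hlt).trans ?_
      simp only [hg, Fin.eta]
      rw [if_neg hlt.ne]
    refine ⟨tailProd g, fun σ => ?_, hpN⟩
    -- Since y² is rational, e = ±1; hence the factor e³ at α_n is again e, as on the rest of the
    -- string.
    set e : (AlgebraicClosure F)ˣ :=
      y⁻¹ * Units.map ((σ : AlgebraicClosure F →+* AlgebraicClosure F) : _ →* _) y with he
    have he2 : e ^ 2 = 1 := by
      rw [he, mul_pow, inv_pow, ← map_pow, hxy, inv_mul_eq_one]
      ext
      simp
    have hδ : ∀ i, chi ((tailProd g)⁻¹ * galMap σ (tailProd g)) (simpleRootsD n i)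
        = if T.source i = T.source N then e else 1 := by
      have haux : ∀ i, i ≠ N →
          chi ((tailProd g)⁻¹ * galMap σ (tailProd g)) (simpleRootsD n i)
            = if T.source i = T.source N then e else 1 := by
        intro i hi
        rw [chi_mul, chi_inv, ← galMap_chi, hchi i hi]
        split_ifs
        · rfl
        · simp
      intro i
      by_cases hi : i = N
      · have hδN : ((tailProd g)⁻¹ * galMap σ (tailProd g)) N = e := by
          rw [Pi.mul_apply, Pi.inv_apply, hpN, he, galMap, hpN]
        rw [hi, hlast, haux M hMN, if_pos hT, if_pos rfl, hδN, he2, mul_one]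
      · exact haux i hi
    intro i
    rw [hδ, hδ, T.source_tau]

theorem card_HBD_D_laurentSeries (hn : 3 ≤ n) (T : AdmissibleTriple (simpleRootsD n))
    {r : Matrix (Fin n ⊕ Fin n) (Fin n ⊕ Fin n) (AlgebraicClosure (LaurentSeries ℂ))
      ⊗[AlgebraicClosure (LaurentSeries ℂ)]
      Matrix (Fin n ⊕ Fin n) (Fin n ⊕ Fin n) (AlgebraicClosure (LaurentSeries ℂ))}
    (hr : IsBDMatrix (LieAlgebra.Orthogonal.typeD (Fin n)
      (AlgebraicClosure (LaurentSeries ℂ))) Sum.inl T r)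
    (hT : T.SameString ⟨n - 2, sub_two_lt_of_three_le hn⟩ ⟨n - 1, sub_one_lt_of_three_le hn⟩) :
    Nat.card (HBD (LaurentSeries ℂ) (SOeven n (AlgebraicClosure (LaurentSeries ℂ))) r) = 2 := by
  have := charZero_laurentSeries
  obtain ⟨φ, -⟩ := exists_HBD_D_equiv (LaurentSeries ℂ) hn T hr hT
  rw [Nat.card_congr φ]
  have hx : (HahnSeries.single (1 : ℤ) (1 : ℂ) : LaurentSeries ℂ) ≠ 0 := by simp
  exact card_square_classes_eq_two (F := LaurentSeries ℂ)
    (fun u => HahnSeries.order (u : LaurentSeries ℂ))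
    (fun u u' => HahnSeries.order_mul u.ne_zero u'.ne_zero)
    ⟨Units.mk0 _ hx, HahnSeries.order_single one_ne_zero⟩
    fun u hu => LaurentSeries.exists_sq_eq u.ne_zero hu

end Main

end

end BelavinDrinfeld

theorem mainTheorem2 :
    -- an arbitrary field of characteristic zero
    (∀ (F : Type*) [Field F] [CharZero F],
      -- type `A_n`, with respect to `GL(n+1)`
      (∀ n : ℕ, 1 ≤ n → ∀ (T : BelavinDrinfeld.AdmissibleTriple (BelavinDrinfeld.simpleRootsA n)) r,
        BelavinDrinfeld.IsBDMatrix
          (LieAlgebra.SpecialLinear.sl (Fin (n + 1)) (AlgebraicClosure F)) id T r →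
        Nat.card (BelavinDrinfeld.HBD F ⊤ r) = 1) ∧
      -- type `B_n`
      (∀ n : ℕ, 1 ≤ n → ∀ (T : BelavinDrinfeld.AdmissibleTriple (BelavinDrinfeld.simpleRootsB n)) r,
        BelavinDrinfeld.IsBDMatrix
          (LieAlgebra.Orthogonal.typeB (Fin n) (AlgebraicClosure F)) (Sum.inr ∘ Sum.inl) T r →
        Nat.card (BelavinDrinfeld.HBD F (BelavinDrinfeld.SOodd n (AlgebraicClosure F)) r) = 1) ∧
      -- type `C_n`
      (∀ n : ℕ, 1 ≤ n → ∀ (T : BelavinDrinfeld.AdmissibleTriple (BelavinDrinfeld.simpleRootsC n)) r,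
        BelavinDrinfeld.IsBDMatrix
          (LieAlgebra.Symplectic.sp (Fin n) (AlgebraicClosure F)) Sum.inl T r →
        Nat.card (BelavinDrinfeld.HBD F (BelavinDrinfeld.Sp n (AlgebraicClosure F)) r) = 1) ∧
      -- type `D_n`; the simple roots `α_{n-1}`, `α_n` have the indices `n - 2`, `n - 1` in `Fin n`
      (∀ (n : ℕ) (hn : 3 ≤ n)
          (T : BelavinDrinfeld.AdmissibleTriple (BelavinDrinfeld.simpleRootsD n)) r,
        BelavinDrinfeld.IsBDMatrix
          (LieAlgebra.Orthogonal.typeD (Fin n) (AlgebraicClosure F)) Sum.inl T r →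
        (T.SameString ⟨n - 2, by omega⟩ ⟨n - 1, by omega⟩ →
          ∃ φ : BelavinDrinfeld.HBD F (BelavinDrinfeld.SOeven n (AlgebraicClosure F)) r ≃
              Fˣ ⧸ (powMonoidHom 2 : Fˣ →* Fˣ).range,
            φ (BelavinDrinfeld.HBD.trivialClass F
              (BelavinDrinfeld.SOeven n (AlgebraicClosure F)) r) = 1) ∧
        (¬ T.SameString ⟨n - 2, by omega⟩ ⟨n - 1, by omega⟩ →
          Nat.card (BelavinDrinfeld.HBD F
            (BelavinDrinfeld.SOeven n (AlgebraicClosure F)) r) = 1))) ∧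
    -- the field of Laurent series over `ℂ`, type `D_n`
    (∀ (n : ℕ) (hn : 3 ≤ n)
        (T : BelavinDrinfeld.AdmissibleTriple (BelavinDrinfeld.simpleRootsD n)) r,
      BelavinDrinfeld.IsBDMatrix
        (LieAlgebra.Orthogonal.typeD (Fin n) (AlgebraicClosure (LaurentSeries ℂ))) Sum.inl T r →
      T.SameString ⟨n - 2, by omega⟩ ⟨n - 1, by omega⟩ →
      Nat.card (BelavinDrinfeld.HBD (LaurentSeries ℂ)
        (BelavinDrinfeld.SOeven n (AlgebraicClosure (LaurentSeries ℂ))) r) = 2) := by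
  refine ⟨fun F _ _ => ⟨?_, ?_, ?_, ?_⟩, ?_⟩
  · intro n _ T r hr
    exact BelavinDrinfeld.card_HBD_A F T hr
  · intro n _ T r hr
    exact BelavinDrinfeld.card_HBD_B F T hr
  · intro n _ T r hr
    exact BelavinDrinfeld.card_HBD_C F T hr
  · intro n hn T r hr
    exact ⟨BelavinDrinfeld.exists_HBD_D_equiv F hn T hr, BelavinDrinfeld.card_HBD_D F hn T hr⟩
  · intro n hn T r hr hT
    exact BelavinDrinfeld.card_HBD_D_laurentSeries hn T hr hT
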